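/- Let $X$ be a compact complex manifold of dimension $n$ with an ample holomorphic line bundle $L$, let $V_k=H^0(X,kL)$, and let $\phi$ be a continuous positive (i.e. with plurisubharmonic local weights) metric on $L$; we write $|\cdot|e^{-k\phi}$ for the induced metric on $kL$. Put $\|s\|_{k\phi,\infty}=\sup_X|s|e^{-k\phi}$ and, for a smooth volume form $dV$, $\|s\|_{k\phi}^2=\int_X|s|^2e^{-2k\phi}\,dV$. Let $\|\cdot\|^{NA}_\bullet$ be a bounded graded non-Archimedean norm on $L$: each $\|\cdot\|^{NA}_k$ is an ultrametric norm on $V_k$ with respect to the trivial absolute value of $\mathbb C$, $\|s\cdot t\|^{NA}_{k+m}\le\|s\|^{NA}_k\|t\|^{NA}_m$ for $s\in V_k$, $t\in V_m$, and there is $\delta>0$ with $e^{-\delta k}\le\|s\|^{NA}_k\le e^{\delta k}$ for all $k$ and all $0\ne s\in V_k$. A basis $(s_i)$ of $V_k$ is orthogonal for $\|\cdot\|_k^{NA}$ if $\|\sum_i c_is_i\|^{NA}_k=\max_{c_i\neq0}\|s_i\|^{NA}_k$. The Duistermaat–Heckman measure $\sigma$ of $\|\cdot\|^{NA}_\bullet$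 is the weak limit of the measures $k^{-n}\sum_i\delta_{-k^{-1}\log\|s_{i,k}\|^{NA}_k}$, where $(s_{i,k})_i$ is an orthogonal basis of $V_k$. Let $I\subset\mathbb R$ be the convex hull of the support of $\sigma$ and of the normalised jumping numbers $-k^{-1}\log\|s\|^{NA}_k$ ($k\ge1$, $0\ne s\in V_k$); if all of these lie in the support, and the support is an interval, then $I$ is the support. Let $\mathfrak f$ be a bounded, decreasing (not necessarily strictly), convex function on $I$. Given bases $\underline s_k=(s_{i,k})_i$ of $V_k$ that are orthogonal both for $\|\cdot\|_{k\phi}$ and for $\|\cdot\|^{NA}_k$, let $\iota(\|\cdot\|_{k\phi},\mathfrak f)$ be the Hermitian norm on $V_k$ with orthogonal basis $\underline s_k$ and $$\iota(\|\cdot\|_{k\phi},\mathfrak f)(s_{i,k})=\|s_{i,k}\|_{k\phi}\,e^{k\mathfrak f(-k^{-1}\log\|s_{i,k}\|^{NA}_k)}.$$ Given bases $\underline s_k$ that are orthogonal for $\|\cdot\|^{NA}_k$, let $$\gamma_k\Big(\sum_i c_is_{i,k}\Big)=\max_{c_i\ne0}e^{k\mathfrak f(-k^{-1}\log\|s_{i,k}\|^{NA}_k)},\qquad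 \gamma_k(0)=0,$$ $$\iota^1(\|\cdot\|_{k\phi,\infty},\mathfrak f)(w)=\inf\Big\{\sum_j\|w_j\|_{k\phi,\infty}\,\gamma_k(w_j)\ :\ w=\sum_jw_j\text{ a finite sum in }V_k\Big\}.$$ For a norm $\|\cdot\|$ on $V_k$, the Fubini–Study metric $FS(\|\cdot\|)$ on $kL$ is $|\ell|_{FS(\|\cdot\|)}=\inf\{\|s\|: s\in V_k,\ s(x)=\ell\}$ for $\ell\in (kL)_x$ (with value $+\infty$ if there is no such $s$). In additive notation, for a sequence of norms $\|\cdot\|_\bullet$ on the $V_k$, $FS(\|\cdot\|_\bullet)$ denotes the upper semicontinuous regularisation of the pointwise limit on $X$ of $k^{-1}FS(\|\cdot\|_k)$ as $k\to\infty$; it is said to be well defined if this pointwise limit exists at every point of $X$ and is finite. Then jointly orthogonal bases as above exist for every smooth volume form $dV$. Moreover, $FS(\iota(\|\cdot\|_{\bullet\phi},\mathfrak f))$ and $FS(\iota^1(\|\cdot\|_{\bullet\phi,\infty},\mathfrak f))$ are well defined, do not depend on the choices of $dV$ and of the bases, and are equal to one and the same bounded positive metric on $L$ (i.e. a metric whose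 local weights are locally bounded and plurisubharmonic): $$FS(\iota(\|\cdot\|_{\bullet\phi},\mathfrak f))=FS(\iota^1(\|\cdot\|_{\bullet\phi,\infty},\mathfrak f)).$$ -/

import Mathlib

open Bundle Filter MeasureTheory
open scoped Manifold ContDiff Topology TensorProduct ENNReal

noncomputable section

namespace FubiniStudy

/-! ### Norms on a complex vector space -/

section LinearAlgebra

variable {V : Type*} [AddCommGroup V] [Module ℂ V]

/-- A non-Archimedean norm on a complex vector space, with respect to the trivial absolute
value of `ℂ`. -/
structure NANorm (V : Type*) [AddCommGroup V] [Module ℂ V] where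
  toFun : V → ℝ
  map_zero : toFun 0 = 0
  pos : ∀ v, v ≠ 0 → 0 < toFun v
  map_smul : ∀ (c : ℂ) (v : V), c ≠ 0 → toFun (c • v) = toFun v
  ultrametric : ∀ v w, toFun (v + w) ≤ max (toFun v) (toFun w)

instance : CoeFun (NANorm V) (fun _ => V → ℝ) := ⟨NANorm.toFun⟩

variable {N : ℕ}

/-- The non-Archimedean norm `∑ cᵢ vᵢ ↦ max {exp (-aᵢ) | cᵢ ≠ 0}` attached to a basis `v` and a
real vector `a` (its value at `0` is `0`). -/
def gaugeNorm (b : Module.Basis (Fin N) ℂ V) (a : Fin N → ℝ) (v : V) : ℝ :=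
  open Classical in ⨆ i : Fin N, if b.repr v i = 0 then 0 else Real.exp (-a i)

/-- `b` is orthogonal for the non-Archimedean norm `ν`. -/
def IsNAOrthogonal (ν : NANorm V) (b : Module.Basis (Fin N) ℂ V) : Prop :=
  ∃ a : Fin N → ℝ, ∀ v, ν v = gaugeNorm b a v

/-- `b` is an orthogonal basis for the norm `ν` in the Hermitian sense:
`‖∑ cᵢ vᵢ‖² = ∑ |cᵢ|² ‖vᵢ‖²`. -/
def IsHermOrthogonal (ν : V → ℝ) (b : Module.Basis (Fin N) ℂ V) : Prop :=
  ∀ v, ν v ^ 2 = ∑ i, ‖b.repr v i‖ ^ 2 * ν (b i) ^ 2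

/-- `ι_b(ν, a)`: the Hermitian norm which has `b` as an orthogonal basis and takes the value
`ν (b i) * exp (-aᵢ)` at `b i`. -/
def rescale (b : Module.Basis (Fin N) ℂ V) (ν : V → ℝ) (a : Fin N → ℝ) (v : V) : ℝ :=
  Real.sqrt (∑ i, ‖b.repr v i‖ ^ 2 * (ν (b i) * Real.exp (-a i)) ^ 2)

/-- `ι¹(ν, γ)`: the envelope `w ↦ inf {∑ ν(wⱼ) γ(wⱼ) | w = ∑ wⱼ}` over all finite
decompositions. -/
def envelope (ν γ : V → ℝ) (w : V) : ℝ :=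
  sInf {r | ∃ (m : ℕ) (u : Fin m → V), ∑ j, u j = w ∧ r = ∑ j, ν (u j) * γ (u j)}

end LinearAlgebra

/-! ### Plurisubharmonic functions -/

/-- A real-valued function `u` is plurisubharmonic on the open set `Ω ⊆ ℂⁿ`: it is upper
semicontinuous and satisfies the sub-mean value inequality on every closed affine disc contained
in `Ω`. (For finite-valued upper semicontinuous `u`, integrability on the circle says exactly that
the mean value is not `-∞`.) -/
def PshOn {n : ℕ} (u : (Fin n → ℂ) → ℝ) (Ω : Set (Fin n → ℂ)) : Prop :=
  UpperSemicontinuousOn u Ω ∧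
    ∀ a v : Fin n → ℂ, (∀ ζ : ℂ, ‖ζ‖ ≤ 1 → a + ζ • v ∈ Ω) →
      CircleIntegrable (fun ζ : ℂ => u (a + ζ • v)) 0 1 ∧
        u a ≤ Real.circleAverage (fun ζ : ℂ => u (a + ζ • v)) 0 1

/-- `μ` is given by a smooth volume form on the complex manifold `X`: in every chart it has a
smooth positive density with respect to Lebesgue measure. -/
def IsSmoothVolume {n : ℕ} {X : Type*} [TopologicalSpace X] [ChartedSpace (Fin n → ℂ) X]
    [MeasurableSpace X] (μ : Measure X) : Prop :=
  ∀ c ∈ atlas (Fin n → ℂ) X, ∃ ρ : (Fin n → ℂ) → ℝ, ContDiffOn ℝ ∞ ρ c.target ∧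
    (∀ z ∈ c.target, 0 < ρ z) ∧
    (μ.restrict c.source).map c =
      (volume.restrict c.target).withDensity (fun z => ENNReal.ofReal (ρ z))

/-! ### Powers of a line bundle, their sections, and metrics -/

section LineBundle

variable {n : ℕ} {X : Type*} [TopologicalSpace X] [ChartedSpace (Fin n → ℂ) X]
  (L : X → Type*) [∀ x, AddCommGroup (L x)] [∀ x, Module ℂ (L x)]
  [∀ x, TopologicalSpace (L x)] [TopologicalSpace (TotalSpace ℂ L)]
  [FiberBundle ℂ L] [VectorBundle ℂ ℂ L]

variable {L} in
/-- The trivialization of `kL = L^{⊗k}` induced by a trivialization `e` of `L`, on the fibre over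
`x`: it sends `ℓ₁ ⊗ ⋯ ⊗ ℓ_k` to `e(ℓ₁) ⋯ e(ℓ_k)`. -/
def coord (e : Trivialization ℂ (π ℂ L)) [MemTrivializationAtlas e] (k : ℕ) (x : X) :
    (⨂[ℂ]^k (L x)) →ₗ[ℂ] ℂ :=
  PiTensorProduct.lift
    ((MultilinearMap.mkPiAlgebra ℂ (Fin k) ℂ).compLinearMap (fun _ => e.linearMapAt ℂ x))

variable {L} in
/-- The product `L_x^{⊗k} × L_x^{⊗m} → L_x^{⊗(k+m)}`. -/
def tmul {x : X} {k m : ℕ} (s : ⨂[ℂ]^k (L x)) (t : ⨂[ℂ]^m (L x)) : ⨂[ℂ]^(k + m) (L x) :=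
  TensorPower.mulEquiv (s ⊗ₜ[ℂ] t)

/-- `H⁰(X, kL)`: the holomorphic sections of the `k`-th tensor power of `L`. -/
def holSections (k : ℕ) : Submodule ℂ (∀ x, ⨂[ℂ]^k (L x)) where
  carrier := {s | ∀ (e : Trivialization ℂ (π ℂ L)) [MemTrivializationAtlas e],
    MDifferentiableOn 𝓘(ℂ, Fin n → ℂ) 𝓘(ℂ) (fun x => coord e k x (s x)) e.baseSet}
  add_mem' := by
    intro s t hs ht e _
    simpa using! (hs e).add (ht e)
  zero_mem' := by
    intro e _
    simpa using! mdifferentiableOn_const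
  smul_mem' := by
    intro c s hs e _
    simpa using! (hs e).const_smul c

variable {L} in
theorem coord_tmul (e : Trivialization ℂ (π ℂ L)) [MemTrivializationAtlas e] {k m : ℕ} (x : X)
    (s : ⨂[ℂ]^k (L x)) (t : ⨂[ℂ]^m (L x)) :
    coord e (k + m) x (tmul s t) = coord e k x s * coord e m x t := by
  induction s using PiTensorProduct.induction_on with
  | smul_tprod r a =>
    induction t using PiTensorProduct.induction_on with
    | smul_tprod q b =>
      have h : tmul (PiTensorProduct.tprod ℂ a) (PiTensorProduct.tprod ℂ b) =
          PiTensorProduct.tprod ℂ (Fin.append a b) := TensorPower.tprod_mul_tprod ℂ a b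
      have h2 : tmul (r • PiTensorProduct.tprod ℂ a) (q • PiTensorProduct.tprod ℂ b) =
          (r * q) • PiTensorProduct.tprod ℂ (Fin.append a b) := by
        rw [← h]
        simp only [tmul]
        rw [TensorProduct.smul_tmul_smul, map_smul]
      rw [h2]
      simp [coord, Fin.prod_univ_add]
      ring
    | add t t' ht ht' =>
      have : tmul (r • PiTensorProduct.tprod ℂ a) (t + t') =
          tmul (r • PiTensorProduct.tprod ℂ a) t + tmul (r • PiTensorProduct.tprod ℂ a) t' := by
        simp only [tmul, TensorProduct.tmul_add, map_add]
      rw [this, map_add, map_add, ht, ht', mul_add]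
  | add s s' hs hs' =>
    have : tmul (s + s') t = tmul s t + tmul s' t := by
      simp only [tmul, TensorProduct.add_tmul, map_add]
    rw [this, map_add, map_add, hs, hs', add_mul]

variable {L} in
/-- The product `H⁰(X, kL) × H⁰(X, mL) → H⁰(X, (k+m)L)` of the section ring. -/
def mulSection {k m : ℕ} (s : holSections (n := n) L k) (t : holSections (n := n) L m) :
    holSections (n := n) L (k + m) :=
  ⟨fun x => tmul (s.1 x) (t.1 x), by
    intro e _
    simp only [coord_tmul]
    exact (s.2 e).mul (t.2 e)⟩

/-- `kL` is very ample: its global sections have no common zero, separate points and separate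
tangent vectors. -/
def IsVeryAmple (k : ℕ) : Prop :=
  (∀ x : X, ∃ s : holSections (n := n) L k, s.1 x ≠ 0) ∧
  (∀ x y : X, x ≠ y → ∃ s : holSections (n := n) L k, s.1 x = 0 ∧ s.1 y ≠ 0) ∧
  (∀ (x : X) (v : TangentSpace 𝓘(ℂ, Fin n → ℂ) x), v ≠ 0 →
    ∃ s : holSections (n := n) L k, s.1 x = 0 ∧
      mfderiv 𝓘(ℂ, Fin n → ℂ) 𝓘(ℂ)
        (fun y => coord (trivializationAt ℂ L x) k y (s.1 y)) x v ≠ 0)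

/-- `L` is ample: `kL` is very ample for all sufficiently large `k`. -/
def IsAmple : Prop := ∀ᶠ k : ℕ in atTop, IsVeryAmple (n := n) L k

/-- A Hermitian metric on the line bundle `L` (finite and nonzero in every fibre, not necessarily
continuous). -/
structure LineMetric (L : X → Type*) [∀ x, AddCommGroup (L x)] [∀ x, Module ℂ (L x)] where
  norm : ∀ x, L x → ℝ
  norm_pos : ∀ x (l : L x), l ≠ 0 → 0 < norm x l
  norm_smul : ∀ x (c : ℂ) (l : L x), norm x (c • l) = ‖c‖ * norm x l

variable {L}

/-- The local weight `φ_e` of the metric in the trivialization `e`: on `e.baseSet` the metric is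
`|l| = |e(l)| exp (-φ_e)`. -/
def LineMetric.weight (φ : LineMetric L) (e : Trivialization ℂ (π ℂ L)) (x : X) : ℝ :=
  -Real.log (φ.norm x (e.symm x 1))

/-- The metric is continuous. -/
def LineMetric.IsContinuous (φ : LineMetric L) : Prop :=
  ∀ (e : Trivialization ℂ (π ℂ L)) [MemTrivializationAtlas e],
    ContinuousOn (φ.weight e) e.baseSet

/-- The metric is bounded: its local weights are locally bounded (on a compact `X`: it differs by
a bounded factor from a continuous metric). -/
def LineMetric.IsBounded (φ : LineMetric L) : Prop :=
  ∀ (e : Trivialization ℂ (π ℂ L)) [MemTrivializationAtlas e], ∀ x ∈ e.baseSet,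
    ∃ C : ℝ, ∀ᶠ y in 𝓝 x, |φ.weight e y| ≤ C

/-- The metric is positive: its local weights are plurisubharmonic. -/
def LineMetric.IsPositive (φ : LineMetric L) : Prop :=
  ∀ (e : Trivialization ℂ (π ℂ L)) [MemTrivializationAtlas e], ∀ c ∈ atlas (Fin n → ℂ) X,
    PshOn (φ.weight e ∘ c.symm) (c.target ∩ c.symm ⁻¹' e.baseSet)

/-- The metric `kφ` induced by `φ` on `kL`. -/
def LineMetric.powNorm (φ : LineMetric L) (k : ℕ) (x : X) (t : ⨂[ℂ]^k (L x)) : ℝ :=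
  ‖coord (trivializationAt ℂ L x) k x t‖ *
    φ.norm x ((trivializationAt ℂ L x).symm x 1) ^ k

/-- The sup-norm `‖s‖_{kφ,∞}` on `H⁰(X, kL)`. -/
def supNorm (φ : LineMetric L) (k : ℕ) (s : holSections (n := n) L k) : ℝ :=
  ⨆ x : X, φ.powNorm k x (s.1 x)

/-- The `L²`-norm `‖s‖_{kφ}` on `H⁰(X, kL)` with respect to the volume form `μ`. -/
def l2Norm [MeasurableSpace X] (μ : Measure X) (φ : LineMetric L) (k : ℕ)
    (s : holSections (n := n) L k) : ℝ :=
  Real.sqrt (∫ x, φ.powNorm k x (s.1 x) ^ 2 ∂μ)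

/-! ### Fubini–Study metrics and their limits -/

/-- The Fubini–Study metric of a norm `ν` on `H⁰(X, kL)`, on `t ∈ (kL)_x`: the infimum of `ν s`
over the sections `s` with `s(x) = t` (it is `∞` if there are none). -/
def fsNorm {k : ℕ} (ν : holSections (n := n) L k → ℝ) (x : X) (t : ⨂[ℂ]^k (L x)) : ℝ≥0∞ :=
  ⨅ (s : holSections (n := n) L k) (_ : s.1 x = t), ENNReal.ofReal (ν s)

/-- The local weight of the metric `k⁻¹ FS(ν)` on `L` in the trivialization `e`; its value is
`-∞` where all sections of `kL` vanish. -/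
def fsWeight {k : ℕ} (ν : holSections (n := n) L k → ℝ) (e : Trivialization ℂ (π ℂ L)) (x : X) :
    EReal :=
  -ENNReal.log (fsNorm ν x (PiTensorProduct.tprod ℂ (fun _ : Fin k => e.symm x (1 : ℂ)))) / (k : EReal)

/-- `FS(ν_•) = ψ`: the metrics `k⁻¹ FS(ν_k)` converge pointwise on `X`, to a finite metric `u`,
and `ψ` is the upper semicontinuous regularisation of `u` (in terms of local weights). -/
def IsFSLimit (ν : ∀ k : ℕ, holSections (n := n) L k → ℝ) (ψ : LineMetric L) : Prop :=
  ∃ u : LineMetric L, ∀ (e : Trivialization ℂ (π ℂ L)) [MemTrivializationAtlas e],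
    ∀ x ∈ e.baseSet,
      Tendsto (fun k : ℕ => fsWeight (ν k) e x) atTop (𝓝 (u.weight e x : EReal)) ∧
      (ψ.weight e x : EReal) = limsup (fun y => (u.weight e y : EReal)) (𝓝 x)

/-! ### Bounded graded non-Archimedean norms -/

variable (L) in
/-- A bounded graded non-Archimedean norm on the section ring of `L`. -/
structure GradedNANorm where
  norm : ∀ k : ℕ, NANorm (holSections (n := n) L k)
  submul : ∀ (k m : ℕ) (s : holSections (n := n) L k) (t : holSections (n := n) L m),
    norm (k + m) (mulSection s t) ≤ norm k s * norm m t
  bounded : ∃ δ : ℝ, 0 < δ ∧ ∀ (k : ℕ) (s : holSections (n := n) L k), s ≠ 0 →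
    Real.exp (-δ * k) ≤ norm k s ∧ norm k s ≤ Real.exp (δ * k)

variable (n L) in
/-- A choice of a basis of `H⁰(X, kL)` for every `k`. -/
abbrev SectionBases :=
  ∀ k : ℕ, Module.Basis (Fin (Module.finrank ℂ (holSections (n := n) L k))) ℂ
    (holSections (n := n) L k)

namespace GradedNANorm

variable (ν : GradedNANorm (n := n) L)

/-- The normalised jumping number `-k⁻¹ log ‖s‖_k`. -/
def jump {k : ℕ} (s : holSections (n := n) L k) : ℝ := -Real.log (ν.norm k s) / k

/-- The measure `σ_k = k⁻ⁿ ∑ᵢ δ_{-k⁻¹ log ‖s_{i,k}‖}` on the real line. -/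
def jumpMeasure (s : SectionBases n L) (k : ℕ) : Measure ℝ :=
  ENNReal.ofReal (((k : ℝ) ^ n)⁻¹) • ∑ i, Measure.dirac (ν.jump (s k i))

/-- `σ` is the weak limit of the measures `σ_k`, for all choices of orthogonal bases. -/
def IsDHMeasure (σ : Measure ℝ) : Prop :=
  IsFiniteMeasure σ ∧ ∀ s : SectionBases n L, (∀ k, IsNAOrthogonal (ν.norm k) (s k)) →
    ∀ g : BoundedContinuousFunction ℝ ℝ,
      Tendsto (fun k : ℕ => ∫ t, g t ∂(ν.jumpMeasure s k)) atTop (𝓝 (∫ t, g t ∂σ))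

/-- The Duistermaat–Heckman measure of `ν` (with the value `0` if the weak limit did not
exist). -/
def dhMeasure : Measure ℝ :=
  open Classical in if h : ∃ σ, ν.IsDHMeasure σ then h.choose else 0

/-- The interval on which the functions `f` have to be defined: the convex hull of the support of
the Duistermaat–Heckman measure and of the normalised jumping numbers in degrees `k ≥ 1`. It is
the support itself as soon as the latter is an interval and contains these numbers. -/
def dhInterval : Set ℝ :=
  convexHull ℝ (ν.dhMeasure.support ∪
    {t | ∃ (k : ℕ) (s : holSections (n := n) L k), 0 < k ∧ s ≠ 0 ∧ t = ν.jump s})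

/-- The vector `a` with `exp (-aᵢ) = exp (k f(-k⁻¹ log ‖s_{i,k}‖))`. -/
def shift (f : ℝ → ℝ) (s : SectionBases n L) (k : ℕ)
    (i : Fin (Module.finrank ℂ (holSections (n := n) L k))) : ℝ :=
  -(k * f (ν.jump (s k i)))

/-- The sequence of Hermitian norms `ι(‖·‖_{•φ}, f)`: in degree `k` it has `s_k` as an orthogonal
basis and takes the value `‖s_{i,k}‖_{kφ} exp (k f(-k⁻¹ log ‖s_{i,k}‖))` at `s_{i,k}`. -/
def iotaL2 [MeasurableSpace X] (μ : Measure X) (φ : LineMetric L) (f : ℝ → ℝ)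
    (s : SectionBases n L) (k : ℕ) : holSections (n := n) L k → ℝ :=
  rescale (s k) (l2Norm μ φ k) (ν.shift f s k)

/-- The sequence of norms `ι¹(‖·‖_{•φ,∞}, f)`: in degree `k`, the envelope of the sup-norm by the
non-Archimedean norm which has `s_k` as an orthogonal basis and takes the value
`exp (k f(-k⁻¹ log ‖s_{i,k}‖))` at `s_{i,k}`. -/
def iotaSup (φ : LineMetric L) (f : ℝ → ℝ) (s : SectionBases n L) (k : ℕ) :
    holSections (n := n) L k → ℝ :=
  envelope (supNorm φ k) (gaugeNorm (s k) (ν.shift f s k))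

end GradedNANorm

end LineBundle

end FubiniStudy

/-! Everything is read off the envelope norm `N_k = ι¹(‖·‖_{kφ,∞}, f)` and the function `R_k(x) =
sup_s |s(x)|_{kφ} / N_k(s)` (`fsRatio`). Since the fibres are lines, the weight of `k⁻¹ FS(N_k)` is
the weight of `φ` plus `k⁻¹ log R_k`, so the whole question is the behaviour of `k⁻¹ log R_k`.

Jumping numbers are superadditive: the jump of `s * t` is at least the mean of the jumps of `s` and
`t`, weighted by degree. As `f` is decreasing and convex, the gauge `w ↦ exp (k f(jump w))` is
therefore submultiplicative (`gauge_mul_le`). So is the sup-norm, hence so is the envelope, and `R_k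
R_m ≤ R_{k+m}` follows. Fekete's lemma gives `k⁻¹ log R_k → h` pointwise, with `h` the supremum of
these functions over `k ≥ k₀`. Boundedness of `f` bounds `h` above; ampleness (base point freeness
in large degrees) and compactness bound it below. Because `f` is decreasing, the gauge is also what
every orthogonal basis produces (`gaugeNorm_shift`), so no choice of basis enters `h`.

Locally `φ + h` is a supremum of functions `(log |g| - b) / k` with `g` holomorphic. Jensen's
inequality, together with the reverse Fatou lemma, shows that its upper semicontinuous
regularisation is plurisubharmonic (`pshOn_of_approx`).

The Hermitian norms `ι` are compared with `N_k` up to factors `C exp (kε)` for every `ε > 0`, which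
disappear after taking `k⁻¹ log`. One direction is orthogonality and the triangle inequality
(`iotaL2_le`). The other (`exists_supEnvelope_le`) expands a section in the basis and uses the
Bernstein–Markov inequality and the subexponential growth of `dim V_k`. Jointly orthogonal bases
come from repeatedly splitting off a vector of minimal non-Archimedean norm and passing to its
Hermitian orthogonal complement. -/

namespace FubiniStudy

set_option linter.unusedSectionVars false

/-! ### Coordinates on tensor powers of a line bundle -/

section Coordinates

variable {n : ℕ} {X : Type*} [TopologicalSpace X] [ChartedSpace (Fin n → ℂ) X]
  {L : X → Type*} [∀ x, AddCommGroup (L x)] [∀ x, Module ℂ (L x)]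
  [∀ x, TopologicalSpace (L x)] [TopologicalSpace (TotalSpace ℂ L)]
  [FiberBundle ℂ L] [VectorBundle ℂ ℂ L]

theorem linearMapAt_frame (e : Trivialization ℂ (π ℂ L)) [MemTrivializationAtlas e] {x : X}
    (hx : x ∈ e.baseSet) : e.linearMapAt ℂ x (e.symm x 1) = 1 :=
  e.linearMapAt_symm hx 1

theorem eq_linearMapAt_smul_frame (e : Trivialization ℂ (π ℂ L)) [MemTrivializationAtlas e]
    {x : X} (hx : x ∈ e.baseSet) (l : L x) : l = e.linearMapAt ℂ x l • e.symm x 1 := by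
  conv_lhs => rw [← e.symmₗ_linearMapAt (R := ℂ) hx l]
  rw [← e.symmₗ_apply (R := ℂ) hx, ← map_smul, smul_eq_mul, mul_one]

theorem frame_ne_zero (e : Trivialization ℂ (π ℂ L)) [MemTrivializationAtlas e] {x : X}
    (hx : x ∈ e.baseSet) : e.symm x (1 : ℂ) ≠ 0 := by
  intro h
  have := linearMapAt_frame e hx
  rw [h, map_zero] at this
  exact zero_ne_one this

theorem coord_tprod (e : Trivialization ℂ (π ℂ L)) [MemTrivializationAtlas e] (k : ℕ) (x : X)
    (l : Fin k → L x) :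
    coord e k x (PiTensorProduct.tprod ℂ l) = ∏ i, e.linearMapAt ℂ x (l i) := by
  simp [coord]

theorem coord_frame (e : Trivialization ℂ (π ℂ L)) [MemTrivializationAtlas e] (k : ℕ) {x : X}
    (hx : x ∈ e.baseSet) :
    coord e k x (PiTensorProduct.tprod ℂ (fun _ : Fin k => e.symm x (1 : ℂ))) = 1 := by
  rw [coord_tprod]
  simp [linearMapAt_frame e hx]

theorem eq_coord_smul_frame (e : Trivialization ℂ (π ℂ L)) [MemTrivializationAtlas e] (k : ℕ)
    {x : X} (hx : x ∈ e.baseSet) (t : ⨂[ℂ]^k (L x)) :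
    t = coord e k x t • PiTensorProduct.tprod ℂ (fun _ : Fin k => e.symm x (1 : ℂ)) := by
  induction t using PiTensorProduct.induction_on with
  | smul_tprod r a =>
    rw [map_smul, coord_tprod, smul_eq_mul, mul_smul]
    congr 1
    rw [← MultilinearMap.map_smul_univ]
    congr 1
    ext i
    exact eq_linearMapAt_smul_frame e hx (a i)
  | add s t hs ht =>
    rw [map_add, add_smul, ← hs, ← ht]

theorem coord_eq_zero_iff (e : Trivialization ℂ (π ℂ L)) [MemTrivializationAtlas e] (k : ℕ)
    {x : X} (hx : x ∈ e.baseSet) (t : ⨂[ℂ]^k (L x)) : coord e k x t = 0 ↔ t = 0 := by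
  refine ⟨fun h => ?_, fun h => by rw [h, map_zero]⟩
  rw [eq_coord_smul_frame e k hx t, h, zero_smul]

theorem coord_eq_mul (e e' : Trivialization ℂ (π ℂ L)) [MemTrivializationAtlas e]
    [MemTrivializationAtlas e'] (k : ℕ) {x : X} (hx : x ∈ e.baseSet) (t : ⨂[ℂ]^k (L x)) :
    coord e' k x t = coord e k x t * (e'.linearMapAt ℂ x (e.symm x 1)) ^ k := by
  conv_lhs => rw [eq_coord_smul_frame e k hx t, map_smul, coord_tprod]
  simp

/-- The coefficient comparing a metric to a trivialization, in exponential form. -/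
theorem LineMetric.norm_frame (φ : LineMetric L) (e : Trivialization ℂ (π ℂ L))
    [MemTrivializationAtlas e] {x : X} (hx : x ∈ e.baseSet) :
    φ.norm x (e.symm x 1) = Real.exp (-φ.weight e x) := by
  rw [LineMetric.weight, neg_neg, Real.exp_log (φ.norm_pos x _ (frame_ne_zero e hx))]

theorem mem_baseSet_at (x : X) : x ∈ (trivializationAt ℂ L x).baseSet :=
  FiberBundle.mem_baseSet_trivializationAt' x

theorem LineMetric.norm_frame_eq (φ : LineMetric L) (e e' : Trivialization ℂ (π ℂ L))
    [MemTrivializationAtlas e] [MemTrivializationAtlas e'] {x : X} (hx' : x ∈ e'.baseSet) :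
    φ.norm x (e.symm x 1) = ‖e'.linearMapAt ℂ x (e.symm x 1)‖ * φ.norm x (e'.symm x 1) := by
  conv_lhs => rw [eq_linearMapAt_smul_frame e' hx' (e.symm x 1)]
  rw [φ.norm_smul]

/-- `powNorm` uses the preferred trivialization at each point, which may jump with the point. The
transition factors of the coordinate and of the frame cancel, so one trivialization can serve a
whole neighbourhood; continuity and the local holomorphic estimates rest on this. -/
theorem LineMetric.powNorm_eq (φ : LineMetric L) (e : Trivialization ℂ (π ℂ L))
    [MemTrivializationAtlas e] (k : ℕ) {x : X} (hx : x ∈ e.baseSet) (t : ⨂[ℂ]^k (L x)) :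
    φ.powNorm k x t = ‖coord e k x t‖ * Real.exp (-φ.weight e x) ^ k := by
  rw [← φ.norm_frame e hx, LineMetric.powNorm,
    coord_eq_mul (trivializationAt ℂ L x) e k (mem_baseSet_at x),
    φ.norm_frame_eq (trivializationAt ℂ L x) e hx, norm_mul, norm_pow, mul_pow]
  ring

theorem LineMetric.powNorm_nonneg (φ : LineMetric L) (k : ℕ) (x : X) (t : ⨂[ℂ]^k (L x)) :
    0 ≤ φ.powNorm k x t := by
  rw [φ.powNorm_eq _ k (mem_baseSet_at x)]
  positivity

theorem LineMetric.powNorm_eq_zero_iff (φ : LineMetric L) (k : ℕ) (x : X) (t : ⨂[ℂ]^k (L x)) :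
    φ.powNorm k x t = 0 ↔ t = 0 := by
  rw [φ.powNorm_eq _ k (mem_baseSet_at x), mul_eq_zero,
    or_iff_left (pow_ne_zero _ (Real.exp_pos _).ne'), norm_eq_zero,
    coord_eq_zero_iff _ k (mem_baseSet_at x)]

theorem LineMetric.powNorm_pos (φ : LineMetric L) (k : ℕ) (x : X) {t : ⨂[ℂ]^k (L x)}
    (ht : t ≠ 0) : 0 < φ.powNorm k x t :=
  (φ.powNorm_nonneg k x t).lt_of_ne' (mt (φ.powNorm_eq_zero_iff k x t).1 ht)

theorem LineMetric.powNorm_smul (φ : LineMetric L) (k : ℕ) (x : X) (c : ℂ) (t : ⨂[ℂ]^k (L x)) :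
    φ.powNorm k x (c • t) = ‖c‖ * φ.powNorm k x t := by
  simp [LineMetric.powNorm, mul_assoc]

theorem LineMetric.powNorm_add_le (φ : LineMetric L) (k : ℕ) (x : X) (s t : ⨂[ℂ]^k (L x)) :
    φ.powNorm k x (s + t) ≤ φ.powNorm k x s + φ.powNorm k x t := by
  simp only [φ.powNorm_eq _ k (mem_baseSet_at x), map_add, ← add_mul]
  gcongr
  exact norm_add_le _ _

theorem LineMetric.powNorm_tmul (φ : LineMetric L) {k m : ℕ} (x : X) (s : ⨂[ℂ]^k (L x))
    (t : ⨂[ℂ]^m (L x)) :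
    φ.powNorm (k + m) x (tmul s t) = φ.powNorm k x s * φ.powNorm m x t := by
  simp only [φ.powNorm_eq _ _ (mem_baseSet_at x), coord_tmul, norm_mul, pow_add]
  ring

/-- The Hermitian pairing on `kL` attached to a metric on `L`. -/
def LineMetric.powInner (φ : LineMetric L) (k : ℕ) (x : X) (s t : ⨂[ℂ]^k (L x)) : ℂ :=
  starRingEnd ℂ (coord (trivializationAt ℂ L x) k x s) * coord (trivializationAt ℂ L x) k x t *
    ((φ.norm x ((trivializationAt ℂ L x).symm x 1) ^ k : ℝ) : ℂ) ^ 2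

theorem LineMetric.powInner_eq (φ : LineMetric L) (e : Trivialization ℂ (π ℂ L))
    [MemTrivializationAtlas e] (k : ℕ) {x : X} (hx : x ∈ e.baseSet) (s t : ⨂[ℂ]^k (L x)) :
    φ.powInner k x s t = starRingEnd ℂ (coord e k x s) * coord e k x t *
      ((Real.exp (-φ.weight e x) ^ k : ℝ) : ℂ) ^ 2 := by
  rw [← φ.norm_frame e hx, LineMetric.powInner,
    coord_eq_mul (trivializationAt ℂ L x) e k (mem_baseSet_at x) s,
    coord_eq_mul (trivializationAt ℂ L x) e k (mem_baseSet_at x) t,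
    φ.norm_frame_eq (trivializationAt ℂ L x) e hx]
  have h (z : ℂ) : (‖z‖ : ℂ) ^ 2 = starRingEnd ℂ z * z := (Complex.conj_mul' z).symm
  have h2 : ((‖(e.linearMapAt ℂ x) ((trivializationAt ℂ L x).symm x 1)‖ ^ k : ℝ) : ℂ) ^ 2 =
      starRingEnd ℂ ((e.linearMapAt ℂ x) ((trivializationAt ℂ L x).symm x 1)) ^ k *
        ((e.linearMapAt ℂ x) ((trivializationAt ℂ L x).symm x 1)) ^ k := by
    rw [← norm_pow, h, map_pow]
  rw [mul_pow, Complex.ofReal_mul, mul_pow, h2, map_mul, map_pow]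
  ring

theorem LineMetric.powInner_self (φ : LineMetric L) (k : ℕ) (x : X) (t : ⨂[ℂ]^k (L x)) :
    φ.powInner k x t t = ((φ.powNorm k x t ^ 2 : ℝ) : ℂ) := by
  rw [LineMetric.powInner, LineMetric.powNorm, Complex.conj_mul', mul_pow]
  push_cast
  ring

/-! ### Continuity of lengths of sections -/

theorem holSections.continuousOn_coord {k : ℕ} (s : holSections (n := n) L k)
    (e : Trivialization ℂ (π ℂ L)) [MemTrivializationAtlas e] :
    ContinuousOn (fun x => coord e k x (s.1 x)) e.baseSet :=
  (s.2 e).continuousOn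

theorem continuousOn_exp_weight {φ : LineMetric L} (hφ : φ.IsContinuous)
    (e : Trivialization ℂ (π ℂ L)) [MemTrivializationAtlas e] (k : ℕ) :
    ContinuousOn (fun x => Real.exp (-φ.weight e x) ^ k) e.baseSet :=
  (Real.continuous_exp.comp_continuousOn (hφ e).neg).pow k

theorem continuous_powNorm {φ : LineMetric L} (hφ : φ.IsContinuous) {k : ℕ}
    (s : holSections (n := n) L k) : Continuous fun x => φ.powNorm k x (s.1 x) := by
  rw [continuous_iff_continuousAt]
  intro x
  set e := trivializationAt ℂ L x
  have hb : e.baseSet ∈ 𝓝 x := e.open_baseSet.mem_nhds (mem_baseSet_at x)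
  have h : ContinuousOn (fun y => ‖coord e k y (s.1 y)‖ * Real.exp (-φ.weight e y) ^ k)
      e.baseSet := (holSections.continuousOn_coord s e).norm.mul (continuousOn_exp_weight hφ e k)
  refine (h.continuousAt hb).congr ?_
  filter_upwards [hb] with y hy
  exact (φ.powNorm_eq e k hy _).symm

theorem continuous_powInner {φ : LineMetric L} (hφ : φ.IsContinuous) {k : ℕ}
    (s t : holSections (n := n) L k) : Continuous fun x => φ.powInner k x (s.1 x) (t.1 x) := by
  rw [continuous_iff_continuousAt]
  intro x
  set e := trivializationAt ℂ L x
  have hb : e.baseSet ∈ 𝓝 x := e.open_baseSet.mem_nhds (mem_baseSet_at x)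
  have h : ContinuousOn (fun y => starRingEnd ℂ (coord e k y (s.1 y)) * coord e k y (t.1 y) *
      ((Real.exp (-φ.weight e y) ^ k : ℝ) : ℂ) ^ 2) e.baseSet :=
    ((Complex.continuous_conj.comp_continuousOn (holSections.continuousOn_coord s e)).mul
      (holSections.continuousOn_coord t e)).mul
      ((Complex.continuous_ofReal.comp_continuousOn (continuousOn_exp_weight hφ e k)).pow 2)
  refine (h.continuousAt hb).congr ?_
  filter_upwards [hb] with y hy
  exact (φ.powInner_eq e k hy _ _).symm

/-- In a chart and a trivialization, a holomorphic section is a holomorphic function. -/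
theorem holSections.differentiableOn_chart [IsManifold 𝓘(ℂ, Fin n → ℂ) ω X] {k : ℕ}
    (s : holSections (n := n) L k)
    (e : Trivialization ℂ (π ℂ L)) [MemTrivializationAtlas e]
    {c : OpenPartialHomeomorph X (Fin n → ℂ)} (hc : c ∈ atlas (Fin n → ℂ) X) :
    DifferentiableOn ℂ (fun z => coord e k (c.symm z) (s.1 (c.symm z)))
      (c.target ∩ c.symm ⁻¹' e.baseSet) := by
  rw [← mdifferentiableOn_iff_differentiableOn]
  have : IsManifold 𝓘(ℂ, Fin n → ℂ) 1 X := IsManifold.of_le (n := ω) le_top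
  exact (s.2 e).comp ((mdifferentiableOn_atlas_symm hc).mono Set.inter_subset_left)
    Set.inter_subset_right

end Coordinates

/-! ### Sup-norms and finiteness of the space of sections -/

section Finiteness

variable {n : ℕ} {X : Type*} [TopologicalSpace X] [ChartedSpace (Fin n → ℂ) X]
  {L : X → Type*} [∀ x, AddCommGroup (L x)] [∀ x, Module ℂ (L x)]
  [∀ x, TopologicalSpace (L x)] [TopologicalSpace (TotalSpace ℂ L)]
  [FiberBundle ℂ L] [VectorBundle ℂ ℂ L]

section SupNorm

variable [CompactSpace X] {φ : LineMetric L}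

theorem bddAbove_powNorm (hφ : φ.IsContinuous) {k : ℕ} (s : holSections (n := n) L k) :
    BddAbove (Set.range fun x => φ.powNorm k x (s.1 x)) :=
  (isCompact_range (continuous_powNorm hφ s)).bddAbove

theorem powNorm_le_supNorm (hφ : φ.IsContinuous) {k : ℕ} (s : holSections (n := n) L k) (x : X) :
    φ.powNorm k x (s.1 x) ≤ supNorm φ k s :=
  le_ciSup (bddAbove_powNorm hφ s) x

theorem supNorm_nonneg (φ : LineMetric L) {k : ℕ} (s : holSections (n := n) L k) :
    0 ≤ supNorm φ k s :=
  Real.iSup_nonneg fun _ => φ.powNorm_nonneg _ _ _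

theorem supNorm_le {k : ℕ} (s : holSections (n := n) L k) {C : ℝ} (hC : 0 ≤ C)
    (h : ∀ x, φ.powNorm k x (s.1 x) ≤ C) : supNorm φ k s ≤ C :=
  Real.iSup_le h hC

theorem section_ext_zero {k : ℕ} {s : holSections (n := n) L k}
    (h : ∀ x, φ.powNorm k x (s.1 x) ≤ 0) : s = 0 := by
  ext x
  exact (φ.powNorm_eq_zero_iff k x _).1 ((h x).antisymm (φ.powNorm_nonneg _ _ _))

theorem supNorm_pos (hφ : φ.IsContinuous) {k : ℕ} {s : holSections (n := n) L k} (hs : s ≠ 0) :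
    0 < supNorm φ k s := by
  refine (supNorm_nonneg φ s).lt_of_ne' fun h => hs ?_
  exact section_ext_zero (φ := φ) fun x => h ▸ powNorm_le_supNorm hφ s x

theorem supNorm_smul (φ : LineMetric L) {k : ℕ} (c : ℂ) (s : holSections (n := n) L k) :
    supNorm φ k (c • s) = ‖c‖ * supNorm φ k s := by
  simp only [supNorm, Real.mul_iSup_of_nonneg (norm_nonneg c)]
  exact iSup_congr fun x => φ.powNorm_smul k x c _

theorem supNorm_zero (φ : LineMetric L) {k : ℕ} :
    supNorm φ k (0 : holSections (n := n) L k) = 0 := by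
  have := supNorm_smul φ 0 (0 : holSections (n := n) L k)
  simpa using this

theorem supNorm_mulSection_le (hφ : φ.IsContinuous) {k m : ℕ} (s : holSections (n := n) L k)
    (t : holSections (n := n) L m) :
    supNorm φ (k + m) (mulSection s t) ≤ supNorm φ k s * supNorm φ m t := by
  refine supNorm_le _ (mul_nonneg (supNorm_nonneg φ s) (supNorm_nonneg φ t)) fun x => ?_
  have : φ.powNorm (k + m) x ((mulSection s t).1 x) =
    φ.powNorm k x (s.1 x) * φ.powNorm m x (t.1 x) := φ.powNorm_tmul x _ _
  rw [this]
  exact mul_le_mul (powNorm_le_supNorm hφ s x) (powNorm_le_supNorm hφ t x)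
    (φ.powNorm_nonneg _ _ _) (supNorm_nonneg φ s)

theorem powNorm_sum_le (φ : LineMetric L) {ι : Type*} (k : ℕ) (x : X) (S : Finset ι)
    (u : ι → holSections (n := n) L k) :
    φ.powNorm k x ((∑ j ∈ S, u j).1 x) ≤ ∑ j ∈ S, φ.powNorm k x ((u j).1 x) := by
  classical
  induction S using Finset.induction_on with
  | empty =>
    simpa using ((φ.powNorm_eq_zero_iff k x (0 : ⨂[ℂ]^k (L x))).2 rfl).le
  | insert a S ha ih =>
    rw [Finset.sum_insert ha, Finset.sum_insert ha]
    exact (φ.powNorm_add_le k x _ _).trans (by gcongr)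

theorem supNorm_sum_le (hφ : φ.IsContinuous) {ι : Type*} {k : ℕ} (S : Finset ι)
    (u : ι → holSections (n := n) L k) :
    supNorm φ k (∑ j ∈ S, u j) ≤ ∑ j ∈ S, supNorm φ k (u j) :=
  supNorm_le _ (Finset.sum_nonneg fun _ _ => supNorm_nonneg φ _) fun x =>
    (powNorm_sum_le φ k x S u).trans (Finset.sum_le_sum fun _ _ => powNorm_le_supNorm hφ _ x)

end SupNorm

/-- Around every point there is a coordinate polydisc, on which the bundle is trivial and the
weight of a given continuous metric oscillates little. -/
theorem exists_ball_weight {φ : LineMetric L} (hφ : φ.IsContinuous) (x : X) {ε : ℝ}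
    (hε : 0 < ε) :
    ∃ r > 0, Metric.ball (chartAt (Fin n → ℂ) x x) r ⊆
        (chartAt (Fin n → ℂ) x).target ∩
          (chartAt (Fin n → ℂ) x).symm ⁻¹' (trivializationAt ℂ L x).baseSet ∧
      ∀ z ∈ Metric.ball (chartAt (Fin n → ℂ) x x) r,
        |φ.weight (trivializationAt ℂ L x) ((chartAt (Fin n → ℂ) x).symm z) -
          φ.weight (trivializationAt ℂ L x) x| < ε := by
  set c := chartAt (Fin n → ℂ) x
  set e := trivializationAt ℂ L x
  have hcx : c x ∈ c.target := c.map_source (mem_chart_source _ x)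
  have hsymm : c.symm (c x) = x := c.left_inv (mem_chart_source _ x)
  have hcont : ContinuousAt c.symm (c x) := c.continuousAt_symm hcx
  have h1 : ∀ᶠ z in 𝓝 (c x), z ∈ c.target := c.open_target.mem_nhds hcx
  have h2 : ∀ᶠ z in 𝓝 (c x), c.symm z ∈ e.baseSet :=
    hcont.eventually (by rw [hsymm]; exact e.open_baseSet.mem_nhds (mem_baseSet_at x))
  have h3 : ∀ᶠ y in 𝓝 x, |φ.weight e y - φ.weight e x| < ε := by
    have := (hφ e).continuousAt (e.open_baseSet.mem_nhds (mem_baseSet_at x))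
    simpa [Real.dist_eq] using Metric.tendsto_nhds.1 this ε hε
  have h4 : ∀ᶠ z in 𝓝 (c x), |φ.weight e (c.symm z) - φ.weight e x| < ε :=
    hcont.eventually (by rwa [hsymm])
  obtain ⟨r, hr, h⟩ := Metric.eventually_nhds_iff_ball.1 (h1.and (h2.and h4))
  exact ⟨r, hr, fun z hz => ⟨(h z hz).1, (h z hz).2.1⟩, fun z hz => (h z hz).2.2⟩

variable [IsManifold 𝓘(ℂ, Fin n → ℂ) ω X] [CompactSpace X]

/-- A section which vanishes at `x` is small near `x`, by the Schwarz lemma. -/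
theorem eventually_powNorm_le_half {φ : LineMetric L} (hφ : φ.IsContinuous) (k : ℕ) (x : X) :
    ∀ᶠ y in 𝓝 x, ∀ s : holSections (n := n) L k, s.1 x = 0 →
      φ.powNorm k y (s.1 y) ≤ supNorm φ k s / 2 := by
  obtain ⟨r, hr, hsub, hw⟩ := exists_ball_weight (n := n) hφ x one_pos
  set c := chartAt (Fin n → ℂ) x with hc
  set e := trivializationAt ℂ L x with he
  have hcx : c.symm (c x) = x := c.left_inv (mem_chart_source _ x)
  -- The weight varies by less than 1 from its value at `x`, so passing from lengths to `|g|` and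
  -- back costs `exp k` twice. The radius `exp (-2k) r / 2` absorbs this loss and leaves the Schwarz
  -- factor `1 / 2`.
  have hδ : 0 < Real.exp (-(2 * k)) * (r / 2) := by positivity
  have h1 : ∀ᶠ y in 𝓝 x, c y ∈ Metric.ball (c x) (Real.exp (-(2 * k)) * (r / 2)) :=
    (c.continuousAt (mem_chart_source _ x)).eventually (Metric.ball_mem_nhds _ hδ)
  filter_upwards [h1, c.open_source.mem_nhds (mem_chart_source _ x)] with y hy hys s hs
  have hball : c y ∈ Metric.ball (c x) r := by
    refine Metric.ball_subset_ball ?_ hy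
    have : Real.exp (-(2 * k)) ≤ 1 := Real.exp_le_one_iff.2 (by simp)
    nlinarith
  have hyy : c.symm (c y) = y := c.left_inv hys
  set g : (Fin n → ℂ) → ℂ := fun z => coord e k (c.symm z) (s.1 (c.symm z)) with hg
  set A := supNorm φ k s
  set w := φ.weight e x
  have hA : 0 ≤ A := supNorm_nonneg φ s
  have hgx : g (c x) = 0 := by
    have h0 : s.1 (c.symm (c x)) = 0 := by rw [hcx]; exact hs
    change coord e k (c.symm (c x)) (s.1 (c.symm (c x))) = 0
    rw [h0, map_zero]
  have hpow (z) (hz : z ∈ Metric.ball (c x) r) : φ.powNorm k (c.symm z) (s.1 (c.symm z)) =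
      ‖g z‖ * Real.exp (-φ.weight e (c.symm z)) ^ k := φ.powNorm_eq e k (hsub hz).2 _
  have hmaps : Set.MapsTo g (Metric.ball (c x) r)
      (Metric.closedBall (g (c x)) (A * Real.exp (w + 1) ^ k)) := by
    intro z hz
    have h2 := powNorm_le_supNorm hφ s (c.symm z)
    rw [hpow z hz] at h2
    rw [hgx, mem_closedBall_zero_iff]
    have h3 : Real.exp (φ.weight e (c.symm z)) ≤ Real.exp (w + 1) :=
      Real.exp_le_exp.2 (by linarith [(abs_lt.1 (hw z hz)).2])
    calc ‖g z‖ = ‖g z‖ * Real.exp (-φ.weight e (c.symm z)) ^ k *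
          Real.exp (φ.weight e (c.symm z)) ^ k := by
            rw [mul_assoc, ← mul_pow, ← Real.exp_add]; simp
      _ ≤ A * Real.exp (w + 1) ^ k := by gcongr
  have key := Complex.dist_le_div_mul_dist_of_mapsTo_ball
    ((holSections.differentiableOn_chart s e (chart_mem_atlas _ x)).mono hsub) hmaps hball
  change dist (g (c y)) (g (c x)) ≤ _ at key
  rw [hgx, dist_zero_right] at key
  rw [← hyy, hpow _ hball]
  have h4 : Real.exp (-φ.weight e (c.symm (c y))) ≤ Real.exp (-w + 1) :=
    Real.exp_le_exp.2 (by linarith [(abs_lt.1 (hw _ hball)).1])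
  have h5 : Real.exp (w + 1) ^ k * Real.exp (-w + 1) ^ k * Real.exp (-(2 * k)) = 1 := by
    rw [← mul_pow, ← Real.exp_add, ← Real.exp_nat_mul, ← Real.exp_add, Real.exp_eq_one_iff]
    ring
  calc ‖g (c y)‖ * Real.exp (-φ.weight e (c.symm (c y))) ^ k
      ≤ (A * Real.exp (w + 1) ^ k / r * (Real.exp (-(2 * k)) * (r / 2))) *
          Real.exp (-w + 1) ^ k := by
        gcongr
        exact key.trans (by gcongr; exact (Metric.mem_ball.1 hy).le)
    _ = A / 2 * (Real.exp (w + 1) ^ k * Real.exp (-w + 1) ^ k * Real.exp (-(2 * k))) := by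
        field_simp
    _ = A / 2 := by rw [h5, mul_one]

/-- The space of holomorphic sections over a compact manifold is finite dimensional. -/
theorem finiteDimensional_holSections {φ : LineMetric L} (hφ : φ.IsContinuous) (k : ℕ) :
    FiniteDimensional ℂ (holSections (n := n) L k) := by
  -- A section vanishing at the finitely many centres `t` has sup-norm at most half of itself, hence
  -- is zero: evaluation at `t` is injective.
  obtain ⟨t, ht⟩ := CompactSpace.elim_nhds_subcover _
    (fun x : X => eventually_powNorm_le_half (n := n) hφ k x)
  let T : holSections (n := n) L k →ₗ[ℂ] (t → ℂ) :=
    { toFun := fun s p => coord (trivializationAt ℂ L p.1) k p.1 (s.1 p.1)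
      map_add' := fun s u => by ext p; simp
      map_smul' := fun a s => by ext p; simp }
  refine FiniteDimensional.of_injective T ((injective_iff_map_eq_zero T).2 fun s hs => ?_)
  have h0 (p) (hp : p ∈ t) : s.1 p = 0 :=
    (coord_eq_zero_iff _ k (mem_baseSet_at p) _).1 (congr_fun hs ⟨p, hp⟩)
  by_contra hne
  have hpos := supNorm_pos hφ hne
  have : supNorm φ k s ≤ supNorm φ k s / 2 := by
    refine supNorm_le s (by positivity) fun y => ?_
    have hy : y ∈ ⋃ x ∈ t, _ := ht.ge (Set.mem_univ y)
    simp only [Set.mem_iUnion] at hy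
    obtain ⟨p, hp, hyp⟩ := hy
    exact hyp s (h0 p hp)
  linarith

end Finiteness

/-! ### Linear algebra of non-Archimedean and Hermitian norms -/

section GaugeNorm

variable {V : Type*} [AddCommGroup V] [Module ℂ V] {N : ℕ}

theorem gaugeNorm_le (b : Module.Basis (Fin N) ℂ V) (a : Fin N → ℝ) (v : V) {C : ℝ} (hC : 0 ≤ C)
    (h : ∀ i, b.repr v i ≠ 0 → Real.exp (-a i) ≤ C) : gaugeNorm b a v ≤ C := by
  classical
  refine Real.iSup_le (fun i => ?_) hC
  split_ifs with hi
  · exact hC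
  · exact h i hi

theorem le_gaugeNorm (b : Module.Basis (Fin N) ℂ V) (a : Fin N → ℝ) {v : V} {i : Fin N}
    (hi : b.repr v i ≠ 0) : Real.exp (-a i) ≤ gaugeNorm b a v := by
  classical
  have h : (if b.repr v i = 0 then 0 else Real.exp (-a i)) ≤ gaugeNorm b a v :=
    le_ciSup (f := fun i : Fin N => if b.repr v i = 0 then 0 else Real.exp (-a i))
      (Set.finite_range _).bddAbove i
  rwa [if_neg hi] at h

theorem gaugeNorm_nonneg (b : Module.Basis (Fin N) ℂ V) (a : Fin N → ℝ) (v : V) :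
    0 ≤ gaugeNorm b a v := by
  classical
  refine Real.iSup_nonneg fun i => ?_
  split_ifs
  · exact le_rfl
  · positivity

theorem gaugeNorm_zero (b : Module.Basis (Fin N) ℂ V) (a : Fin N → ℝ) :
    gaugeNorm b a 0 = 0 :=
  (gaugeNorm_le b a 0 le_rfl fun i hi => by simp at hi).antisymm (gaugeNorm_nonneg b a 0)

theorem gaugeNorm_basis (b : Module.Basis (Fin N) ℂ V) (a : Fin N → ℝ) (i : Fin N) :
    gaugeNorm b a (b i) = Real.exp (-a i) := by
  refine (gaugeNorm_le b a _ (Real.exp_pos _).le fun j hj => ?_).antisymm (le_gaugeNorm b a ?_)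
  · rcases eq_or_ne i j with rfl | h
    · rfl
    · simp [Finsupp.single_eq_of_ne' h] at hj
  · simp

theorem exists_gaugeNorm_eq (b : Module.Basis (Fin N) ℂ V) (a : Fin N → ℝ) {v : V} (hv : v ≠ 0) :
    ∃ i, b.repr v i ≠ 0 ∧ gaugeNorm b a v = Real.exp (-a i) := by
  classical
  have hne : (Finset.univ.filter fun i => b.repr v i ≠ 0).Nonempty := by
    by_contra h
    refine hv (b.repr.map_eq_zero_iff.1 ?_)
    ext i
    by_contra hi
    exact h ⟨i, by simpa using hi⟩
  obtain ⟨i, hi, hmax⟩ := Finset.exists_max_image _ (fun i => Real.exp (-a i)) hne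
  simp only [Finset.mem_filter, Finset.mem_univ, true_and] at hi hmax
  exact ⟨i, hi, (gaugeNorm_le b a v (Real.exp_pos _).le hmax).antisymm (le_gaugeNorm b a hi)⟩

theorem NANorm.nonneg (ν : NANorm V) (v : V) : 0 ≤ ν v := by
  rcases eq_or_ne v 0 with rfl | h
  · exact ν.map_zero.ge
  · exact (ν.pos v h).le

theorem NANorm.map_smul_le (ν : NANorm V) (c : ℂ) (v : V) : ν (c • v) ≤ ν v := by
  rcases eq_or_ne c 0 with rfl | h
  · rw [zero_smul, ν.map_zero]
    exact ν.nonneg v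
  · exact (ν.map_smul c v h).le

theorem NANorm.sum_le (ν : NANorm V) {ι : Type*} (S : Finset ι) (u : ι → V) {C : ℝ} (hC : 0 ≤ C)
    (h : ∀ i ∈ S, ν (u i) ≤ C) : ν (∑ i ∈ S, u i) ≤ C :=
  Finset.sum_induction u (fun v => ν v ≤ C)
    (fun v w hv hw => (ν.ultrametric v w).trans (max_le hv hw)) (ν.map_zero.le.trans hC) h

/-- The ball of a non-Archimedean norm with the norm of a given vector as its radius. -/
def NANorm.ballAt (ν : NANorm V) (v : V) : Submodule ℂ V where
  carrier := {w | ν w ≤ ν v}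
  add_mem' := fun {a b} ha hb => (ν.ultrametric a b).trans (max_le ha hb)
  zero_mem' := ν.map_zero.le.trans (ν.nonneg v)
  smul_mem' := fun c w hw => (ν.map_smul_le c w).trans hw

/-- Balls are subspaces, and a strictly smaller value of `ν` gives a strictly smaller ball. A vector
whose ball has least dimension therefore minimises `ν`, without knowing beforehand that `ν` takes
finitely many values. -/
theorem NANorm.exists_min [FiniteDimensional ℂ V] (ν : NANorm V) {W : Submodule ℂ V}
    (hW : W ≠ ⊥) : ∃ v ∈ W, v ≠ 0 ∧ ∀ w ∈ W, w ≠ 0 → ν v ≤ ν w := by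
  obtain ⟨v₀, hv₀, hne₀⟩ := W.exists_mem_ne_zero_of_ne_bot hW
  have hne : {v | v ∈ W ∧ v ≠ 0}.Nonempty := ⟨v₀, hv₀, hne₀⟩
  let F : V → ℕ := fun v => Module.finrank ℂ (ν.ballAt v)
  refine ⟨Function.argminOn F _ hne, (Function.argminOn_mem F _ hne).1,
    (Function.argminOn_mem F _ hne).2, fun w hw hw0 => ?_⟩
  by_contra! hlt
  set v := Function.argminOn F _ hne
  have hmin : F v ≤ F w := Function.argminOn_le F _ (show w ∈ {v | v ∈ W ∧ v ≠ 0} from ⟨hw, hw0⟩)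
  refine absurd (Submodule.finrank_lt_finrank_of_lt (s := ν.ballAt w) (t := ν.ballAt v) ?_)
    hmin.not_gt
  refine lt_of_le_of_ne (fun x (hx : ν x ≤ ν w) => (hx.trans hlt.le : ν x ≤ ν v)) fun h => ?_
  have : v ∈ ν.ballAt w := h ▸ (le_refl (ν v) : v ∈ ν.ballAt v)
  exact absurd (this : ν v ≤ ν w) hlt.not_ge

end GaugeNorm

/-! ### Simultaneous orthogonalisation of a Hermitian and a non-Archimedean norm. -/

section Joint

variable {V : Type*} [NormedAddCommGroup V] [InnerProductSpace ℂ V] [FiniteDimensional ℂ V]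

/-- Induction on the dimension: split off a minimiser `v` of `ν` on `W` and continue in its
orthogonal complement in `W`. Minimality of `v` prevents cancellation between `v` and the
complement. Only the lower bound on `ν (∑ cⱼ bⱼ)` is carried along, as the upper bound is the
ultrametric inequality. -/
theorem NANorm.exists_orthogonal_family (ν : NANorm V) (d : ℕ) :
    ∀ W : Submodule ℂ V, Module.finrank ℂ W = d → ∃ b : Fin d → V, (∀ i, b i ∈ W) ∧
      (∀ i, b i ≠ 0) ∧ (Pairwise fun i j => inner ℂ (b i) (b j) = 0) ∧
      ∀ (c : Fin d → ℂ) (i : Fin d), c i ≠ 0 → ν (b i) ≤ ν (∑ j, c j • b j) := by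
  induction d with
  | zero =>
    exact fun W _ => ⟨Fin.elim0, fun i => i.elim0, fun i => i.elim0, fun i => i.elim0,
      fun _ i => i.elim0⟩
  | succ d ih =>
    intro W hW
    have hbot : W ≠ ⊥ := by
      rintro rfl
      simp at hW
    obtain ⟨v, hvW, hv0, hmin⟩ := ν.exists_min hbot
    have hle : Submodule.span ℂ {v} ≤ W := by simpa using hvW
    have hfin := Submodule.finrank_add_inf_finrank_orthogonal hle
    rw [finrank_span_singleton hv0, hW, add_comm] at hfin
    obtain ⟨b, hbW, hb0, hbo, hbν⟩ := ih _ (Nat.succ_injective hfin)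
    have hvb (i) : inner ℂ v (b i) = 0 :=
      Submodule.mem_orthogonal_singleton_iff_inner_right.1 (hbW i).1
    have hvw (c : Fin d → ℂ) : inner ℂ v (∑ j, c j • b j) = 0 := by
      simp [hvb]
    refine ⟨Fin.cons v b, ?_, ?_, ?_, ?_⟩
    · intro i
      refine Fin.cases hvW (fun j => (hbW j).2) i
    · intro i
      refine Fin.cases hv0 hb0 i
    · intro i j hij
      induction i using Fin.cases with
      | zero =>
        induction j using Fin.cases with
        | zero => exact absurd rfl hij
        | succ j => simpa using hvb j
      | succ i =>
        induction j using Fin.cases with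
        | zero => simpa using inner_eq_zero_symm.1 (hvb i)
        | succ j => simpa using hbo (fun h => hij (by rw [h]))
    · intro c i hi
      set w := ∑ j : Fin d, c j.succ • b j with hw
      have hsum : ∑ j, c j • (Fin.cons v b : Fin (d + 1) → V) j = c 0 • v + w := by
        simp [Fin.sum_univ_succ, hw]
      have hvw' : inner ℂ v w = 0 := hvw _
      have hwW : w ∈ W := Submodule.sum_mem _ fun j _ => W.smul_mem _ (hbW j).2
      have hmem : c 0 • v + w ∈ W := W.add_mem (W.smul_mem _ hvW) hwW
      rw [hsum]
      induction i using Fin.cases with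
      | zero =>
        refine hmin _ hmem fun h => ?_
        have h2 : inner ℂ v (c 0 • v + w) = c 0 * inner ℂ v v := by
          rw [inner_add_right, hvw', add_zero, inner_smul_right]
        rw [h, inner_zero_right, eq_comm, mul_eq_zero, inner_self_eq_zero] at h2
        exact h2.elim hi hv0
      | succ j =>
        have h1 : ν (b j) ≤ ν w := hbν (fun j => c j.succ) j hi
        have hw0 : w ≠ 0 := by
          intro h
          rw [h, ν.map_zero] at h1
          exact absurd (ν.pos _ (hb0 j)) h1.not_gt
        have hne : c 0 • v + w ≠ 0 := by
          intro h
          have h2 : inner ℂ w (c 0 • v + w) = inner ℂ w w := by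
            rw [inner_add_right, inner_smul_right, inner_eq_zero_symm.1 hvw', mul_zero, zero_add]
          rw [h, inner_zero_right, eq_comm, inner_self_eq_zero] at h2
          exact hw0 h2
        have h3 : ν v ≤ ν (c 0 • v + w) := hmin _ hmem hne
        -- Writing `w` as the full vector minus `c₀ v`, where `ν v` is at most the norm of the full
        -- vector, bounds `ν w` by that norm.
        have h4 : w = (c 0 • v + w) + (-c 0) • v := by rw [neg_smul]; abel
        have h5 : ν w ≤ max (ν (c 0 • v + w)) (ν ((-c 0) • v)) := by
          conv_lhs => rw [h4]
          exact ν.ultrametric _ _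
        exact h1.trans (h5.trans (max_le le_rfl ((ν.map_smul_le _ _).trans h3)))

/-- A non-Archimedean norm and a Hermitian norm have a common orthogonal basis. -/
theorem NANorm.exists_orthogonal_basis (ν : NANorm V) :
    ∃ b : Module.Basis (Fin (Module.finrank ℂ V)) ℂ V, IsNAOrthogonal ν b ∧
      Pairwise fun i j => inner ℂ (b i) (b j) = 0 := by
  obtain ⟨u, -, hu0, huo, huν⟩ := ν.exists_orthogonal_family (Module.finrank ℂ V) ⊤ (by simp)
  have hli : LinearIndependent ℂ u := linearIndependent_of_ne_zero_of_inner_eq_zero hu0 huo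
  have hcard : Fintype.card (Fin (Module.finrank ℂ V)) = Module.finrank ℂ V := by simp
  let b := basisOfLinearIndependentOfCardEqFinrank' u hli hcard
  have hb : ⇑b = u := coe_basisOfLinearIndependentOfCardEqFinrank' u hli hcard
  refine ⟨b, ⟨fun i => -Real.log (ν (b i)), fun v => ?_⟩, by rw [hb]; exact huo⟩
  have hexp (i) : Real.exp (-(-Real.log (ν (b i)))) = ν (b i) := by
    rw [neg_neg, Real.exp_log (ν.pos _ (b.ne_zero i))]
  have hv : v = ∑ j, b.repr v j • b j := (b.sum_repr v).symm
  refine le_antisymm ?_ (gaugeNorm_le _ _ _ (ν.nonneg v) fun i hi => ?_)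
  · conv_lhs => rw [hv]
    refine ν.sum_le _ _ (gaugeNorm_nonneg _ _ _) fun i _ => ?_
    by_cases hi : b.repr v i = 0
    · rw [hi, zero_smul, ν.map_zero]
      exact gaugeNorm_nonneg _ _ _
    · exact (ν.map_smul_le _ _).trans ((hexp i).ge.trans (le_gaugeNorm _ (fun i => -Real.log (ν (b i))) hi))
  · rw [hexp]
    conv_rhs => rw [hv]
    rw [hb]
    exact huν _ i hi

theorem norm_sq_eq_sum_of_orthogonal {N : ℕ} (b : Module.Basis (Fin N) ℂ V)
    (hb : Pairwise fun i j => inner ℂ (b i) (b j) = 0) (v : V) :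
    ‖v‖ ^ 2 = ∑ i, ‖b.repr v i‖ ^ 2 * ‖b i‖ ^ 2 := by
  have h : (inner ℂ v v : ℂ) = ∑ i, (‖b.repr v i‖ ^ 2 * ‖b i‖ ^ 2 : ℂ) := by
    conv_lhs => rw [← b.sum_repr v]
    rw [sum_inner]
    refine Finset.sum_congr rfl fun i _ => ?_
    rw [inner_sum, Finset.sum_eq_single i]
    · rw [inner_smul_left, inner_smul_right, inner_self_eq_norm_sq_to_K, ← mul_assoc,
        Complex.conj_mul']
      simp
    · intro j _ hj
      rw [inner_smul_left, inner_smul_right, hb hj.symm, mul_zero, mul_zero]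
    · simp
  rw [inner_self_eq_norm_sq_to_K] at h
  exact Complex.ofReal_injective (by push_cast; exact h)

end Joint

/-! ### Rescaled Hermitian norms as Euclidean norms. -/

section Rescale

variable {V : Type*} [AddCommGroup V] [Module ℂ V] {N : ℕ}

/-- The coordinates of a vector, weighted so that their Euclidean norm is `rescale`. -/
def rescaleMap (b : Module.Basis (Fin N) ℂ V) (ν : V → ℝ) (a : Fin N → ℝ) :
    V →ₗ[ℂ] EuclideanSpace ℂ (Fin N) where
  toFun v := WithLp.toLp 2 fun i => b.repr v i * ((ν (b i) * Real.exp (-a i) : ℝ) : ℂ)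
  map_add' v w := by ext i; simp [add_mul]
  map_smul' c v := by ext i; simp [mul_assoc]

theorem rescale_eq_norm (b : Module.Basis (Fin N) ℂ V) (ν : V → ℝ) (a : Fin N → ℝ) (v : V) :
    rescale b ν a v = ‖rescaleMap b ν a v‖ := by
  rw [EuclideanSpace.norm_eq, rescale]
  congr 1
  refine Finset.sum_congr rfl fun i _ => ?_
  simp only [rescaleMap, LinearMap.coe_mk, AddHom.coe_mk, norm_mul, mul_pow, Complex.norm_real,
    Real.norm_eq_abs, sq_abs]

theorem rescale_smul (b : Module.Basis (Fin N) ℂ V) (ν : V → ℝ) (a : Fin N → ℝ) (c : ℂ) (v : V) :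
    rescale b ν a (c • v) = ‖c‖ * rescale b ν a v := by
  simp only [rescale_eq_norm, map_smul, norm_smul]

theorem rescale_sum_le (b : Module.Basis (Fin N) ℂ V) (ν : V → ℝ) (a : Fin N → ℝ) {ι : Type*}
    (S : Finset ι) (u : ι → V) : rescale b ν a (∑ j ∈ S, u j) ≤ ∑ j ∈ S, rescale b ν a (u j) := by
  simp only [rescale_eq_norm, map_sum]
  exact norm_sum_le _ _

end Rescale

/-! ### The mean value inequality on polydiscs -/

/-- The mean value property of the holomorphic function `f²` gives the inequality for `|f|²`
directly. Extended nonnegative values let Tonelli be applied later without integrability conditions.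
-/
theorem enorm_sq_le_lintegral_circle {f : ℂ → ℂ} (hf : DiffContOnCl ℂ f (Metric.ball 0 1)) :
    ENNReal.ofReal (2 * Real.pi) * ‖f 0‖ₑ ^ 2 ≤
      ∫⁻ θ in Set.Ioc 0 (2 * Real.pi), ‖f (circleMap 0 1 θ)‖ₑ ^ 2 := by
  have h2 : DiffContOnCl ℂ (fun z => f z ^ 2) (Metric.ball 0 |1|) := by
    rw [abs_one]
    have := hf.smul hf
    simpa only [smul_eq_mul, ← sq] using this
  have h := h2.circleAverage
  rw [Real.circleAverage, intervalIntegral.integral_of_le Real.two_pi_pos.le] at h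
  have h3 : ‖f 0‖ₑ ^ 2 = ‖(2 * Real.pi)⁻¹‖ₑ *
      ‖∫ θ in Set.Ioc 0 (2 * Real.pi), f (circleMap 0 1 θ) ^ 2‖ₑ := by
    rw [← enorm_smul, h, enorm_pow]
  have h4 : ENNReal.ofReal (2 * Real.pi) * ‖(2 * Real.pi)⁻¹‖ₑ = 1 := by
    rw [Real.enorm_eq_ofReal (by positivity), ← ENNReal.ofReal_mul (by positivity),
      mul_inv_cancel₀ (by positivity), ENNReal.ofReal_one]
  rw [h3, ← mul_assoc, h4, one_mul]
  refine (enorm_integral_le_lintegral_enorm _).trans (le_of_eq ?_)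
  simp only [enorm_pow]

theorem measurable_indicator_of_continuousOn {α β : Type*} [TopologicalSpace α] [MeasurableSpace α]
    [OpensMeasurableSpace α] [TopologicalSpace β] [MeasurableSpace β] [BorelSpace β] [Zero β]
    {f : α → β} {s : Set α} (hf : ContinuousOn f s) (hs : MeasurableSet s) :
    Measurable (s.indicator f) := by
  classical
  rw [← Set.piecewise_eq_indicator]
  exact hf.measurable_piecewise continuousOn_const hs

theorem measurePreserving_rotation {n : ℕ} (a : Circle) :
    MeasurePreserving (fun v : Fin n → ℂ => (a : ℂ) • v) := by
  have := volume_preserving_pi (fun _ : Fin n => (rotation a).measurePreserving)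
  convert this using 1
  ext v i
  simp [rotation_apply]

/-- The ball is circled: apply the one-variable inequality on the disc `ζ ↦ z + ζ v`, integrate over
`v` in the ball, and exchange the integrals. For each angle, rotation and translation invariance of
Lebesgue measure bound the inner integral, and `2π` cancels. No iteration over the coordinates is
needed. -/
theorem enorm_sq_mul_volume_le {n : ℕ} {g : (Fin n → ℂ) → ℂ} {z : Fin n → ℂ} {r : ℝ}
    (hg : DifferentiableOn ℂ g (Metric.ball z r)) :
    ‖g z‖ₑ ^ 2 * volume (Metric.ball (0 : Fin n → ℂ) r) ≤
      ∫⁻ w in Metric.ball z r, ‖g w‖ₑ ^ 2 := by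
  -- Extension by zero gives a function measurable on the whole space, as Tonelli and the invariance
  -- of the measure require.
  set G : (Fin n → ℂ) → ℝ≥0∞ := (Metric.ball z r).indicator fun w => ‖g w‖ₑ ^ 2 with hG
  have hGm : Measurable G := by
    have h1 : Measurable ((Metric.ball z r).indicator g) :=
      measurable_indicator_of_continuousOn hg.continuousOn Metric.isOpen_ball.measurableSet
    have : G = fun w => ‖(Metric.ball z r).indicator g w‖ₑ ^ 2 := by
      ext w
      by_cases hw : w ∈ Metric.ball z r <;> simp [hG, hw]
    rw [this]
    exact h1.enorm.pow_const 2
  have hpt (v : Fin n → ℂ) (hv : v ∈ Metric.ball (0 : Fin n → ℂ) r) :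
      ENNReal.ofReal (2 * Real.pi) * ‖g z‖ₑ ^ 2 ≤
        ∫⁻ θ in Set.Ioc 0 (2 * Real.pi), G (z + circleMap 0 1 θ • v) := by
    have hmaps (ζ : ℂ) (hζ : ζ ∈ Metric.closedBall (0 : ℂ) 1) :
        z + ζ • v ∈ Metric.ball z r := by
      rw [mem_ball_iff_norm, add_sub_cancel_left, norm_smul]
      rw [mem_closedBall_zero_iff] at hζ
      rw [mem_ball_zero_iff] at hv
      exact (mul_le_of_le_one_left (norm_nonneg _) hζ).trans_lt hv
    have hd : DifferentiableOn ℂ (fun ζ : ℂ => g (z + ζ • v)) (Metric.closedBall 0 1) :=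
      hg.comp (by fun_prop) hmaps
    have := enorm_sq_le_lintegral_circle (f := fun ζ : ℂ => g (z + ζ • v))
      (hd.diffContOnCl_ball subset_rfl)
    simp only [zero_smul, add_zero] at this
    refine this.trans (le_of_eq (lintegral_congr fun θ => ?_))
    rw [hG, Set.indicator_of_mem (hmaps _ (circleMap_mem_closedBall 0 zero_le_one θ))]
  have hrot (θ : ℝ) : ∫⁻ v in Metric.ball (0 : Fin n → ℂ) r, G (z + circleMap 0 1 θ • v) ≤
      ∫⁻ w, G w := by
    refine (setLIntegral_le_lintegral _ _).trans (le_of_eq ?_)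
    have h1 : circleMap 0 1 θ = (Circle.exp θ : ℂ) := by simp [circleMap]
    rw [h1, (measurePreserving_rotation (n := n) (Circle.exp θ)).lintegral_comp
      (f := fun w => G (z + w)) (hGm.comp (measurable_const_add z)), lintegral_add_left_eq_self]
  have hmeas : Measurable (Function.uncurry fun (v : Fin n → ℂ) (θ : ℝ) =>
      G (z + circleMap 0 1 θ • v)) := by
    refine hGm.comp (Continuous.measurable ?_)
    have : Continuous (circleMap 0 1) := continuous_circleMap 0 1
    fun_prop
  have h2pi : ENNReal.ofReal (2 * Real.pi) ≠ 0 := by simp [Real.pi_pos]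
  have key : ENNReal.ofReal (2 * Real.pi) *
      (‖g z‖ₑ ^ 2 * volume (Metric.ball (0 : Fin n → ℂ) r)) ≤
      ENNReal.ofReal (2 * Real.pi) * ∫⁻ w, G w := by
    calc ENNReal.ofReal (2 * Real.pi) * (‖g z‖ₑ ^ 2 * volume (Metric.ball (0 : Fin n → ℂ) r))
        = ∫⁻ _ in Metric.ball (0 : Fin n → ℂ) r, ENNReal.ofReal (2 * Real.pi) * ‖g z‖ₑ ^ 2 := by
          rw [setLIntegral_const, mul_assoc]
      _ ≤ ∫⁻ v in Metric.ball (0 : Fin n → ℂ) r,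
            ∫⁻ θ in Set.Ioc 0 (2 * Real.pi), G (z + circleMap 0 1 θ • v) :=
          setLIntegral_mono' Metric.isOpen_ball.measurableSet hpt
      _ = ∫⁻ θ in Set.Ioc 0 (2 * Real.pi),
            ∫⁻ v in Metric.ball (0 : Fin n → ℂ) r, G (z + circleMap 0 1 θ • v) :=
          lintegral_lintegral_swap hmeas.aemeasurable
      _ ≤ ∫⁻ _ in Set.Ioc 0 (2 * Real.pi), ∫⁻ w, G w := lintegral_mono hrot
      _ = ENNReal.ofReal (2 * Real.pi) * ∫⁻ w, G w := by
          rw [setLIntegral_const, Real.volume_Ioc, sub_zero, mul_comm]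
  rw [ENNReal.mul_le_mul_iff_right h2pi ENNReal.ofReal_ne_top] at key
  rwa [hG, lintegral_indicator Metric.isOpen_ball.measurableSet] at key

/-! ### Smooth volume forms -/

section Volume

variable {n : ℕ} {X : Type*} [TopologicalSpace X] [ChartedSpace (Fin n → ℂ) X]
  [MeasurableSpace X] [BorelSpace X]

theorem aemeasurable_chart (μ : Measure X) (c : OpenPartialHomeomorph X (Fin n → ℂ)) :
    AEMeasurable c (μ.restrict c.source) :=
  c.continuousOn.aemeasurable c.open_source.measurableSet

theorem IsSmoothVolume.isFiniteMeasure [CompactSpace X] {μ : Measure X}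
    (hμ : IsSmoothVolume (n := n) μ) : IsFiniteMeasure μ := by
  have : IsLocallyFiniteMeasure μ := by
    refine ⟨fun x => ?_⟩
    set c := chartAt (Fin n → ℂ) x
    have hx : x ∈ c.source := mem_chart_source _ x
    have hcx : c x ∈ c.target := c.map_source hx
    obtain ⟨ρ, hρ, -, hmap⟩ := hμ c (chart_mem_atlas _ x)
    have htgt : ∀ᶠ z in 𝓝 (c x), z ∈ c.target := c.open_target.mem_nhds hcx
    have hev : ∀ᶠ z in 𝓝 (c x), z ∈ c.target ∧ ρ z < ρ (c x) + 1 :=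
      htgt.and
        ((hρ.continuousOn.continuousAt (c.open_target.mem_nhds hcx)).eventually_lt_const
          (lt_add_one _))
    obtain ⟨r, hr, hball⟩ := Metric.eventually_nhds_iff_ball.1 hev
    refine ⟨c.source ∩ c ⁻¹' Metric.ball (c x) r,
      (c.isOpen_inter_preimage Metric.isOpen_ball).mem_nhds
        ⟨hx, Metric.mem_ball_self hr⟩, ?_⟩
    have h1 : μ (c.source ∩ c ⁻¹' Metric.ball (c x) r) =
        ∫⁻ z in Metric.ball (c x) r, ENNReal.ofReal (ρ z) ∂(volume.restrict c.target) := by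
      rw [← withDensity_apply _ Metric.isOpen_ball.measurableSet, ← hmap,
        Measure.map_apply_of_aemeasurable (aemeasurable_chart μ c)
          Metric.isOpen_ball.measurableSet,
        Measure.restrict_apply' c.open_source.measurableSet, Set.inter_comm]
    rw [h1]
    calc ∫⁻ z in Metric.ball (c x) r, ENNReal.ofReal (ρ z) ∂(volume.restrict c.target)
        ≤ ∫⁻ _ in Metric.ball (c x) r, ENNReal.ofReal (ρ (c x) + 1)
            ∂(volume.restrict c.target) :=
          setLIntegral_mono' Metric.isOpen_ball.measurableSet fun z hz =>
            ENNReal.ofReal_le_ofReal (hball z hz).2.le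
      _ < ⊤ := by
          rw [setLIntegral_const]
          exact ENNReal.mul_lt_top ENNReal.ofReal_lt_top
            ((Measure.restrict_apply_le _ _).trans_lt measure_ball_lt_top)
  infer_instance

/-- One half of the change of variables: it feeds integrals over small polydiscs into the global
`L²`-norm, and only this inequality is needed. -/
theorem setLIntegral_chart_le {μ : Measure X} {c : OpenPartialHomeomorph X (Fin n → ℂ)}
    {ρ : (Fin n → ℂ) → ℝ} (hρ : ContinuousOn ρ c.target)
    (hmap : (μ.restrict c.source).map c =
      (volume.restrict c.target).withDensity (fun z => ENNReal.ofReal (ρ z)))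
    {F : X → ℝ} (hF : Continuous F) {A : Set (Fin n → ℂ)} (hA : A ⊆ c.target) :
    ∫⁻ z in A, ENNReal.ofReal (ρ z) * ENNReal.ofReal (F (c.symm z)) ≤
      ∫⁻ x, ENNReal.ofReal (F x) ∂μ := by
  set G : (Fin n → ℂ) → ℝ≥0∞ := fun z =>
    ENNReal.ofReal (c.target.indicator (F ∘ c.symm) z)
  have hGm : Measurable G :=
    (measurable_indicator_of_continuousOn (hF.comp_continuousOn c.continuousOn_symm)
      c.open_target.measurableSet).ennreal_ofReal
  have hρm : AEMeasurable (fun z => ENNReal.ofReal (ρ z)) (volume.restrict c.target) :=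
    (hρ.aemeasurable c.open_target.measurableSet).ennreal_ofReal
  calc ∫⁻ z in A, ENNReal.ofReal (ρ z) * ENNReal.ofReal (F (c.symm z))
      ≤ ∫⁻ z in c.target, ENNReal.ofReal (ρ z) * ENNReal.ofReal (F (c.symm z)) :=
        lintegral_mono_set hA
    _ = ∫⁻ z in c.target, ENNReal.ofReal (ρ z) * G z := by
        refine setLIntegral_congr_fun c.open_target.measurableSet fun z hz => ?_
        simp only [G, Set.indicator_of_mem hz, Function.comp_apply]
    _ = ∫⁻ z, G z ∂((μ.restrict c.source).map c) := by
        rw [hmap, lintegral_withDensity_eq_lintegral_mul₀ hρm hGm.aemeasurable]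
        rfl
    _ = ∫⁻ x in c.source, G (c x) ∂μ :=
        lintegral_map' hGm.aemeasurable (aemeasurable_chart μ c)
    _ = ∫⁻ x in c.source, ENNReal.ofReal (F x) ∂μ := by
        refine setLIntegral_congr_fun c.open_source.measurableSet fun x hx => ?_
        simp only [G, Set.indicator_of_mem (c.map_source hx), Function.comp_apply, c.left_inv hx]
    _ ≤ ∫⁻ x, ENNReal.ofReal (F x) ∂μ := setLIntegral_le_lintegral _ _

end Volume

/-! ### The Bernstein–Markov inequality -/

section BernsteinMarkov

variable {n : ℕ} {X : Type*} [TopologicalSpace X] [ChartedSpace (Fin n → ℂ) X]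
  {L : X → Type*} [∀ x, AddCommGroup (L x)] [∀ x, Module ℂ (L x)]
  [∀ x, TopologicalSpace (L x)] [TopologicalSpace (TotalSpace ℂ L)]
  [FiberBundle ℂ L] [VectorBundle ℂ ℂ L]
  [IsManifold 𝓘(ℂ, Fin n → ℂ) ω X] [CompactSpace X] [MeasurableSpace X] [BorelSpace X]

theorem integrable_powNorm_sq {φ : LineMetric L} (hφ : φ.IsContinuous) {μ : Measure X}
    (hμ : IsSmoothVolume (n := n) μ) {k : ℕ} (s : holSections (n := n) L k) :
    Integrable (fun x => φ.powNorm k x (s.1 x) ^ 2) μ := by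
  have := hμ.isFiniteMeasure
  exact ((continuous_powNorm hφ s).pow 2).integrable_of_hasCompactSupport
    (HasCompactSupport.of_compactSpace _)

theorem l2Norm_sq (φ : LineMetric L) (μ : Measure X) {k : ℕ}
    (s : holSections (n := n) L k) :
    l2Norm μ φ k s ^ 2 = ∫ x, φ.powNorm k x (s.1 x) ^ 2 ∂μ :=
  Real.sq_sqrt (integral_nonneg fun _ => sq_nonneg _)

/-- On a polydisc where the weight stays within `ε / 4` of its central value, `exp (-2kφ)` varies at
most by the factor `exp (kε)`. The mean value inequality for `|g|²` then costs only a constant,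
coming from the volume of the polydisc and a lower bound on the density. The polydisc depends
neither on `k` nor on `s`. -/
theorem eventually_powNorm_sq_le {φ : LineMetric L} (hφ : φ.IsContinuous) {μ : Measure X}
    (hμ : IsSmoothVolume (n := n) μ) {ε : ℝ} (hε : 0 < ε) (x : X) :
    ∃ C : ℝ, 0 ≤ C ∧ ∀ᶠ y in 𝓝 x, ∀ (k : ℕ) (s : holSections (n := n) L k),
      φ.powNorm k y (s.1 y) ^ 2 ≤ C * Real.exp (k * ε) * l2Norm μ φ k s ^ 2 := by
  obtain ⟨r₁, hr₁, hsub, hw⟩ := exists_ball_weight (n := n) hφ x (div_pos hε four_pos)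
  set c := chartAt (Fin n → ℂ) x with hc
  set e := trivializationAt ℂ L x with he
  have hx : x ∈ c.source := mem_chart_source _ x
  have hcx : c x ∈ c.target := c.map_source hx
  obtain ⟨ρ, hρ, hρpos, hmap⟩ := hμ c (chart_mem_atlas _ x)
  set m := ρ (c x) / 2
  have hm : 0 < m := half_pos (hρpos _ hcx)
  have hev : ∀ᶠ z in 𝓝 (c x), m < ρ z ∧ z ∈ Metric.ball (c x) r₁ :=
    ((hρ.continuousOn.continuousAt (c.open_target.mem_nhds hcx)).eventually_const_lt
      (half_lt_self (hρpos _ hcx))).and (Metric.ball_mem_nhds _ hr₁)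
  obtain ⟨r, hr, hball⟩ := Metric.eventually_nhds_iff_ball.1 hev
  set V := (volume (Metric.ball (0 : Fin n → ℂ) (r / 2))).toReal
  have hVtop : volume (Metric.ball (0 : Fin n → ℂ) (r / 2)) ≠ ⊤ := measure_ball_lt_top.ne
  have hV : 0 < V := ENNReal.toReal_pos (Metric.measure_ball_pos _ _ (half_pos hr)).ne' hVtop
  refine ⟨(m * V)⁻¹, by positivity, ?_⟩
  filter_upwards [(c.continuousAt hx).eventually (Metric.ball_mem_nhds _ (half_pos hr)),
    c.open_source.mem_nhds hx] with y hy hys k s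
  have hsub2 : Metric.ball (c y) (r / 2) ⊆ Metric.ball (c x) r :=
    Metric.ball_subset_ball' (by linarith [Metric.mem_ball.1 hy])
  have hyb : c y ∈ Metric.ball (c x) r := hsub2 (Metric.mem_ball_self (half_pos hr))
  have hsub3 : Metric.ball (c y) (r / 2) ⊆ c.target ∩ c.symm ⁻¹' e.baseSet :=
    fun z hz => hsub (hball z (hsub2 hz)).2
  have hyy : c.symm (c y) = y := c.left_inv hys
  set g : (Fin n → ℂ) → ℂ := fun z => coord e k (c.symm z) (s.1 (c.symm z)) with hg
  set I := ∫ x, φ.powNorm k x (s.1 x) ^ 2 ∂μ with hI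
  have hI0 : 0 ≤ I := integral_nonneg fun _ => sq_nonneg _
  have hpow (z) (hz : z ∈ Metric.ball (c x) r) : φ.powNorm k (c.symm z) (s.1 (c.symm z)) =
      ‖g z‖ * Real.exp (-φ.weight e (c.symm z)) ^ k :=
    φ.powNorm_eq e k (hsub (hball z hz).2).2 _
  -- `K` collects the density bound, the oscillation of the weight, and the weight at `y`, which is
  -- cancelled when returning from `|g|` to the length at `y`.
  set K := (m)⁻¹ * Real.exp (k * ε) * Real.exp (φ.weight e y) ^ (2 * k) with hK
  have hK0 : 0 ≤ K := by positivity
  have hpt (z) (hz : z ∈ Metric.ball (c y) (r / 2)) : ‖g z‖ₑ ^ 2 ≤ ENNReal.ofReal K *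
      (ENNReal.ofReal (ρ z) * ENNReal.ofReal (φ.powNorm k (c.symm z) (s.1 (c.symm z)) ^ 2)) := by
    have hzb := hsub2 hz
    have hρz : m < ρ z := (hball z hzb).1
    have h1 := abs_lt.1 (hw z (hball z hzb).2)
    have h2 := abs_lt.1 (hw _ (hball _ hyb).2)
    rw [hyy] at h2
    rw [← ENNReal.ofReal_mul (hm.trans hρz).le, ← ENNReal.ofReal_mul hK0, ← ofReal_norm,
      ← ENNReal.ofReal_pow (norm_nonneg _)]
    refine ENNReal.ofReal_le_ofReal ?_
    rw [hpow z hzb]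
    have h3 : 1 ≤ Real.exp (k * ε) * Real.exp (φ.weight e y) ^ (2 * k) *
        Real.exp (-φ.weight e (c.symm z)) ^ (2 * k) := by
      rw [← Real.exp_nat_mul, ← Real.exp_nat_mul, ← Real.exp_add, ← Real.exp_add]
      refine Real.one_le_exp ?_
      push_cast
      have : 0 ≤ (k : ℝ) * (ε + 2 * (φ.weight e y - φ.weight e (c.symm z))) :=
        mul_nonneg k.cast_nonneg (by linarith [h1.2, h2.1])
      linarith
    have h4 : 1 ≤ m⁻¹ * ρ z := by
      rw [inv_mul_eq_div, one_le_div hm]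
      exact hρz.le
    calc ‖g z‖ ^ 2 = 1 * 1 * ‖g z‖ ^ 2 := by ring
      _ ≤ (m⁻¹ * ρ z) * (Real.exp (k * ε) * Real.exp (φ.weight e y) ^ (2 * k) *
        Real.exp (-φ.weight e (c.symm z)) ^ (2 * k)) * ‖g z‖ ^ 2 := by gcongr
      _ = _ := by rw [hK, mul_pow, ← pow_mul, mul_comm k 2]; ring
  have hmain : ‖g (c y)‖ₑ ^ 2 * volume (Metric.ball (0 : Fin n → ℂ) (r / 2)) ≤
      ENNReal.ofReal K * ENNReal.ofReal I := by
    calc ‖g (c y)‖ₑ ^ 2 * volume (Metric.ball (0 : Fin n → ℂ) (r / 2))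
        ≤ ∫⁻ z in Metric.ball (c y) (r / 2), ‖g z‖ₑ ^ 2 :=
          enorm_sq_mul_volume_le
            ((holSections.differentiableOn_chart s e (chart_mem_atlas _ x)).mono hsub3)
      _ ≤ ∫⁻ z in Metric.ball (c y) (r / 2), ENNReal.ofReal K * (ENNReal.ofReal (ρ z) *
            ENNReal.ofReal (φ.powNorm k (c.symm z) (s.1 (c.symm z)) ^ 2)) :=
          setLIntegral_mono' Metric.isOpen_ball.measurableSet hpt
      _ = ENNReal.ofReal K * ∫⁻ z in Metric.ball (c y) (r / 2), ENNReal.ofReal (ρ z) *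
            ENNReal.ofReal (φ.powNorm k (c.symm z) (s.1 (c.symm z)) ^ 2) :=
          lintegral_const_mul' _ _ ENNReal.ofReal_ne_top
      _ ≤ ENNReal.ofReal K * ∫⁻ x, ENNReal.ofReal (φ.powNorm k x (s.1 x) ^ 2) ∂μ := by
          gcongr
          exact setLIntegral_chart_le hρ.continuousOn hmap ((continuous_powNorm hφ s).pow 2)
            fun z hz => (hsub3 hz).1
      _ = ENNReal.ofReal K * ENNReal.ofReal I := by
          rw [hI, ofReal_integral_eq_lintegral_ofReal (integrable_powNorm_sq hφ hμ s)
            (ae_of_all _ fun _ => sq_nonneg _)]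
  have hreal : ‖g (c y)‖ ^ 2 * V ≤ K * I := by
    have := ENNReal.toReal_mono (by finiteness) hmain
    rwa [ENNReal.toReal_mul, ENNReal.toReal_mul, ENNReal.toReal_pow, toReal_enorm,
      ENNReal.toReal_ofReal hK0, ENNReal.toReal_ofReal hI0] at this
  have hgy : φ.powNorm k y (s.1 y) = ‖g (c y)‖ * Real.exp (-φ.weight e y) ^ k := by
    have := hpow _ hyb
    rwa [hyy] at this
  rw [hgy, l2Norm_sq, ← hI]
  have h5 : Real.exp (φ.weight e y) ^ (2 * k) * Real.exp (-φ.weight e y) ^ (2 * k) = 1 := by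
    rw [← mul_pow, ← Real.exp_add]; simp
  calc (‖g (c y)‖ * Real.exp (-φ.weight e y) ^ k) ^ 2
      = ‖g (c y)‖ ^ 2 * V * (V⁻¹ * Real.exp (-φ.weight e y) ^ (2 * k)) := by
        rw [mul_pow, ← pow_mul, mul_comm k 2]
        field_simp
    _ ≤ K * I * (V⁻¹ * Real.exp (-φ.weight e y) ^ (2 * k)) := by gcongr
    _ = m⁻¹ * Real.exp (k * ε) * I * V⁻¹ *
        (Real.exp (φ.weight e y) ^ (2 * k) * Real.exp (-φ.weight e y) ^ (2 * k)) := by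
        rw [hK]; ring
    _ = (m * V)⁻¹ * Real.exp (k * ε) * I := by rw [h5, mul_inv]; ring

/-- The Bernstein–Markov inequality for a continuous metric and a smooth volume form. -/
theorem exists_powNorm_sq_le {φ : LineMetric L} (hφ : φ.IsContinuous) {μ : Measure X}
    (hμ : IsSmoothVolume (n := n) μ) {ε : ℝ} (hε : 0 < ε) :
    ∃ C : ℝ, 0 ≤ C ∧ ∀ (k : ℕ) (s : holSections (n := n) L k) (y : X),
      φ.powNorm k y (s.1 y) ^ 2 ≤ C * Real.exp (k * ε) * l2Norm μ φ k s ^ 2 := by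
  have h := isCompact_univ.induction_on (X := X)
    (p := fun S => ∃ C : ℝ, 0 ≤ C ∧ ∀ y ∈ S, ∀ (k : ℕ) (s : holSections (n := n) L k),
      φ.powNorm k y (s.1 y) ^ 2 ≤ C * Real.exp (k * ε) * l2Norm μ φ k s ^ 2)
    ⟨0, le_rfl, by simp⟩
    (fun S T hST ⟨C, hC, h⟩ => ⟨C, hC, fun y hy => h y (hST hy)⟩)
    (fun S T ⟨C, hC, h⟩ ⟨D, hD, h'⟩ => by
      refine ⟨C + D, add_nonneg hC hD, fun y hy k s => ?_⟩
      rcases hy with hy | hy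
      · exact (h y hy k s).trans (by gcongr; linarith)
      · exact (h' y hy k s).trans (by gcongr; linarith))
    (fun x _ => by
      obtain ⟨C, hC, h⟩ := eventually_powNorm_sq_le hφ hμ hε x
      exact ⟨_, mem_nhdsWithin_of_mem_nhds h, C, hC, fun y hy => hy⟩)
  obtain ⟨C, hC, h⟩ := h
  exact ⟨C, hC, fun k s y => h y trivial k s⟩

theorem l2Norm_nonneg (φ : LineMetric L) (μ : Measure X) {k : ℕ}
    (s : holSections (n := n) L k) : 0 ≤ l2Norm μ φ k s :=
  Real.sqrt_nonneg _

theorem l2Norm_pos {φ : LineMetric L} (hφ : φ.IsContinuous) {μ : Measure X}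
    (hμ : IsSmoothVolume (n := n) μ) {k : ℕ} {s : holSections (n := n) L k} (hs : s ≠ 0) :
    0 < l2Norm μ φ k s := by
  refine (l2Norm_nonneg φ μ s).lt_of_ne' fun h => hs ?_
  obtain ⟨C, -, hC⟩ := exists_powNorm_sq_le hφ hμ one_pos
  refine section_ext_zero (φ := φ) fun x => ?_
  have := hC k s x
  rw [h] at this
  nlinarith [φ.powNorm_nonneg k x (s.1 x)]

/-- The `L²`-norm is bounded by the sup-norm, up to the total volume. -/
theorem l2Norm_sq_le {φ : LineMetric L} (hφ : φ.IsContinuous) {μ : Measure X}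
    (hμ : IsSmoothVolume (n := n) μ) {k : ℕ} (s : holSections (n := n) L k) :
    l2Norm μ φ k s ^ 2 ≤ μ.real Set.univ * supNorm φ k s ^ 2 := by
  have := hμ.isFiniteMeasure
  rw [l2Norm_sq]
  calc ∫ x, φ.powNorm k x (s.1 x) ^ 2 ∂μ ≤ ∫ _, supNorm φ k s ^ 2 ∂μ := by
        refine integral_mono (integrable_powNorm_sq hφ hμ s) (integrable_const _) fun x => ?_
        exact pow_le_pow_left₀ (φ.powNorm_nonneg _ _ _) (powNorm_le_supNorm hφ s x) 2
    _ = _ := by simp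

/-- The `L²` inner product on the space of sections. -/
@[reducible]
def l2Core {φ : LineMetric L} (hφ : φ.IsContinuous) {μ : Measure X}
    (hμ : IsSmoothVolume (n := n) μ) (k : ℕ) :
    InnerProductSpace.Core ℂ (holSections (n := n) L k) where
  inner s t := ∫ x, φ.powInner k x (s.1 x) (t.1 x) ∂μ
  conj_inner_symm s t := by
    rw [← integral_conj]
    refine integral_congr_ae (ae_of_all _ fun x => ?_)
    simp only [LineMetric.powInner, map_mul, Complex.conj_conj, map_pow, Complex.conj_ofReal]
    ring
  re_inner_nonneg s := by
    simp only [LineMetric.powInner_self]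
    rw [integral_complex_ofReal]
    exact integral_nonneg fun _ => sq_nonneg _
  add_left s t u := by
    have := hμ.isFiniteMeasure
    have hint (s t : holSections (n := n) L k) :
        Integrable (fun x => φ.powInner k x (s.1 x) (t.1 x)) μ :=
      (continuous_powInner hφ s t).integrable_of_hasCompactSupport
        (HasCompactSupport.of_compactSpace _)
    rw [← integral_add (hint s u) (hint t u)]
    refine integral_congr_ae (ae_of_all _ fun x => ?_)
    simp only [LineMetric.powInner, Submodule.coe_add, Pi.add_apply, map_add]
    ring
  smul_left s t c := by
    rw [← integral_const_mul]
    refine integral_congr_ae (ae_of_all _ fun x => ?_)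
    simp only [LineMetric.powInner, Submodule.coe_smul, Pi.smul_apply, map_smul, smul_eq_mul,
      map_mul]
    ring
  definite s h := by
    by_contra hs
    have hpos := l2Norm_pos hφ hμ hs
    change ∫ x, φ.powInner k x (s.1 x) (s.1 x) ∂μ = 0 at h
    simp only [LineMetric.powInner_self] at h
    rw [integral_complex_ofReal, ← l2Norm_sq] at h
    exact (pow_pos hpos 2).ne' (by exact_mod_cast h)

/-- A graded piece carries bases which are orthogonal both for the `L²`-norm and for a given
non-Archimedean norm. -/
theorem exists_jointly_orthogonal {φ : LineMetric L} (hφ : φ.IsContinuous) {μ : Measure X}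
    (hμ : IsSmoothVolume (n := n) μ) (k : ℕ) (ν : NANorm (holSections (n := n) L k)) :
    ∃ b : Module.Basis (Fin (Module.finrank ℂ (holSections (n := n) L k))) ℂ
      (holSections (n := n) L k), IsHermOrthogonal (l2Norm μ φ k) b ∧ IsNAOrthogonal ν b := by
  have := finiteDimensional_holSections (n := n) hφ k
  let core := l2Core hφ hμ k
  let : NormedAddCommGroup (holSections (n := n) L k) := core.toNormedAddCommGroup
  let : InnerProductSpace ℂ (holSections (n := n) L k) := InnerProductSpace.ofCore core.toCore
  obtain ⟨b, hνb, hb⟩ := ν.exists_orthogonal_basis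
  have hnorm (s : holSections (n := n) L k) : ‖s‖ = l2Norm μ φ k s := by
    have h : ‖s‖ = Real.sqrt (RCLike.re (∫ x, φ.powInner k x (s.1 x) (s.1 x) ∂μ)) := rfl
    rw [h, l2Norm]
    simp only [LineMetric.powInner_self]
    rw [integral_complex_ofReal]
    rfl
  refine ⟨b, fun s => ?_, hνb⟩
  simpa only [hnorm] using norm_sq_eq_sum_of_orthogonal b hb s

/-- The dimension of the space of sections grows subexponentially. -/
theorem exists_finrank_le {φ : LineMetric L} (hφ : φ.IsContinuous) {μ : Measure X}
    (hμ : IsSmoothVolume (n := n) μ) {ε : ℝ} (hε : 0 < ε) :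
    ∃ C : ℝ, 0 ≤ C ∧ ∀ (k N : ℕ) (b : Module.Basis (Fin N) ℂ (holSections (n := n) L k)),
      IsHermOrthogonal (l2Norm μ φ k) b → (N : ℝ) ≤ C * Real.exp (k * ε) := by
  have := hμ.isFiniteMeasure
  obtain ⟨C, hC, hBM⟩ := exists_powNorm_sq_le hφ hμ hε
  refine ⟨C * μ.real Set.univ, by positivity, fun k N b hb => ?_⟩
  have hpos (i) : 0 < l2Norm μ φ k (b i) := l2Norm_pos hφ hμ (b.ne_zero i)
  -- This sum is the Bergman function. Bernstein–Markov bounds it pointwise, while its integral is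
  -- the dimension `N`.
  have hpt (x : X) : ∑ i, φ.powNorm k x ((b i).1 x) ^ 2 / l2Norm μ φ k (b i) ^ 2 ≤
      C * Real.exp (k * ε) := by
    set e := trivializationAt ℂ L x
    set l : Fin N → ℂ := fun i => coord e k x ((b i).1 x)
    set E := Real.exp (-φ.weight e x) ^ k
    have hE : 0 < E := by positivity
    set S := ∑ i, ‖l i‖ ^ 2 / l2Norm μ φ k (b i) ^ 2
    have hS0 : 0 ≤ S := Finset.sum_nonneg fun i _ => by positivity
    -- The section representing evaluation at `x`: with these coefficients both its squared
    -- `L²`-norm and its coordinate at `x` equal `S`, so Bernstein–Markov for `w` bounds `S` itself.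
    set w : holSections (n := n) L k :=
      ∑ i, (starRingEnd ℂ (l i) / ((l2Norm μ φ k (b i) ^ 2 : ℝ) : ℂ)) • b i with hw
    have hrepr (i) : b.repr w i = starRingEnd ℂ (l i) / ((l2Norm μ φ k (b i) ^ 2 : ℝ) : ℂ) := by
      rw [hw, b.repr_sum_self]
    have hw2 : l2Norm μ φ k w ^ 2 = S := by
      rw [hb w]
      refine Finset.sum_congr rfl fun i _ => ?_
      rw [hrepr, norm_div, RCLike.norm_conj, Complex.norm_real, Real.norm_eq_abs,
        abs_of_nonneg (sq_nonneg _)]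
      have := (hpos i).ne'
      field_simp
    have hwx : coord e k x (w.1 x) = (S : ℂ) := by
      let T : holSections (n := n) L k →ₗ[ℂ] ℂ :=
        { toFun := fun s => coord e k x (s.1 x)
          map_add' := fun s u => by simp
          map_smul' := fun a s => by simp }
      change T w = _
      rw [hw, map_sum, Complex.ofReal_sum]
      refine Finset.sum_congr rfl fun i _ => ?_
      rw [map_smul, smul_eq_mul]
      change _ * l i = _
      rw [div_mul_eq_mul_div, Complex.conj_mul']
      push_cast
      rfl
    have hle := hBM k w x
    rw [hw2, φ.powNorm_eq e k (mem_baseSet_at x), hwx, Complex.norm_real, Real.norm_eq_abs,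
      abs_of_nonneg hS0] at hle
    have hsum : ∑ i, φ.powNorm k x ((b i).1 x) ^ 2 / l2Norm μ φ k (b i) ^ 2 = S * E ^ 2 := by
      rw [Finset.sum_mul]
      refine Finset.sum_congr rfl fun i _ => ?_
      rw [φ.powNorm_eq e k (mem_baseSet_at x), mul_pow]
      ring
    rw [hsum]
    rcases hS0.eq_or_lt with h0 | h0
    · rw [← h0, zero_mul]
      positivity
    · refine le_of_mul_le_mul_right ?_ h0
      calc S * E ^ 2 * S = (S * E) ^ 2 := by ring
        _ ≤ _ := hle
  have hint (i) : Integrable (fun x => φ.powNorm k x ((b i).1 x) ^ 2 / l2Norm μ φ k (b i) ^ 2) μ :=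
    (integrable_powNorm_sq hφ hμ (b i)).div_const _
  have h1 : ∫ x, ∑ i, φ.powNorm k x ((b i).1 x) ^ 2 / l2Norm μ φ k (b i) ^ 2 ∂μ = N := by
    rw [integral_finsetSum _ fun i _ => hint i]
    simp_rw [integral_div, ← l2Norm_sq]
    rw [Finset.sum_congr rfl fun i _ => div_self (pow_pos (hpos i) 2).ne']
    simp
  calc (N : ℝ) = ∫ x, ∑ i, φ.powNorm k x ((b i).1 x) ^ 2 / l2Norm μ φ k (b i) ^ 2 ∂μ := h1.symm
    _ ≤ ∫ _, C * Real.exp (k * ε) ∂μ :=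
        integral_mono (integrable_finsetSum _ fun i _ => hint i) (integrable_const _) hpt
    _ = C * μ.real Set.univ * Real.exp (k * ε) := by simp; ring

end BernsteinMarkov

/-! ### Envelopes -/

section Envelope

variable {V : Type*} [AddCommGroup V] [Module ℂ V] {ν γ : V → ℝ}

theorem envelope_nonneg (hν : ∀ v, 0 ≤ ν v) (hγ : ∀ v, 0 ≤ γ v) (w : V) :
    0 ≤ envelope ν γ w := by
  refine Real.sInf_nonneg ?_
  rintro _ ⟨m, u, -, rfl⟩
  exact Finset.sum_nonneg fun j _ => mul_nonneg (hν _) (hγ _)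

theorem envelope_le_sum (hν : ∀ v, 0 ≤ ν v) (hγ : ∀ v, 0 ≤ γ v) {ι : Type*} [Fintype ι]
    (u : ι → V) : envelope ν γ (∑ j, u j) ≤ ∑ j, ν (u j) * γ (u j) := by
  refine csInf_le ⟨0, ?_⟩ ⟨Fintype.card ι, u ∘ (Fintype.equivFin ι).symm, ?_, ?_⟩
  · rintro _ ⟨m, u, -, rfl⟩
    exact Finset.sum_nonneg fun j _ => mul_nonneg (hν _) (hγ _)
  · exact (Fintype.equivFin ι).symm.sum_comp u
  · exact ((Fintype.equivFin ι).symm.sum_comp fun j => ν (u j) * γ (u j)).symm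

theorem le_envelope {w : V} {C : ℝ}
    (h : ∀ (m : ℕ) (u : Fin m → V), ∑ j, u j = w → C ≤ ∑ j, ν (u j) * γ (u j)) :
    C ≤ envelope ν γ w := by
  refine le_csInf ⟨_, 1, fun _ => w, by simp, rfl⟩ ?_
  rintro _ ⟨m, u, hu, rfl⟩
  exact h m u hu

theorem envelope_smul_le (hν : ∀ v, 0 ≤ ν v) (hγ : ∀ v, 0 ≤ γ v)
    (hν' : ∀ (c : ℂ) v, ν (c • v) = ‖c‖ * ν v) (hγ' : ∀ (c : ℂ) v, c ≠ 0 → γ (c • v) = γ v)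
    {c : ℂ} (hc : c ≠ 0) (w : V) : envelope ν γ (c • w) ≤ ‖c‖ * envelope ν γ w := by
  have hc' : 0 < ‖c‖ := norm_pos_iff.2 hc
  rw [← div_le_iff₀' hc']
  refine le_envelope fun m u hu => ?_
  rw [div_le_iff₀' hc', Finset.mul_sum, ← hu, Finset.smul_sum]
  refine (envelope_le_sum hν hγ _).trans (le_of_eq (Finset.sum_congr rfl fun j _ => ?_))
  rw [hν', hγ' c _ hc, mul_assoc]

theorem envelope_smul (hν : ∀ v, 0 ≤ ν v) (hγ : ∀ v, 0 ≤ γ v)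
    (hν' : ∀ (c : ℂ) v, ν (c • v) = ‖c‖ * ν v) (hγ' : ∀ (c : ℂ) v, c ≠ 0 → γ (c • v) = γ v)
    (c : ℂ) (w : V) : envelope ν γ (c • w) = ‖c‖ * envelope ν γ w := by
  rcases eq_or_ne c 0 with rfl | hc
  · rw [zero_smul, norm_zero, zero_mul]
    refine le_antisymm ?_ (envelope_nonneg hν hγ 0)
    simpa using envelope_le_sum hν hγ (fun j : Fin 0 => (0 : V))
  · refine (envelope_smul_le hν hγ hν' hγ' hc w).antisymm ?_
    have h := envelope_smul_le hν hγ hν' hγ' (inv_ne_zero hc) (c • w)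
    rwa [smul_smul, inv_mul_cancel₀ hc, one_smul, norm_inv,
      inv_mul_eq_div, le_div_iff₀' (norm_pos_iff.2 hc)] at h

/-- Lower bounds with a factor that may vanish; when `b = 0` the one-term decomposition already
gives `C ≤ 0`. -/
theorem le_envelope_mul {w : V} {C b : ℝ} (hb : 0 ≤ b)
    (h : ∀ (m : ℕ) (u : Fin m → V), ∑ j, u j = w → C ≤ (∑ j, ν (u j) * γ (u j)) * b) :
    C ≤ envelope ν γ w * b := by
  rcases hb.eq_or_lt with rfl | hb
  · simpa using h 1 (fun _ => w) (by simp)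
  · rw [← div_le_iff₀ hb]
    exact le_envelope fun m u hu => (div_le_iff₀ hb).2 (h m u hu)

/-- Envelopes of submultiplicative functions are submultiplicative. -/
theorem envelope_mul_le {V' V'' : Type*} [AddCommGroup V'] [Module ℂ V'] [AddCommGroup V'']
    [Module ℂ V''] {ν' γ' : V' → ℝ} {ν'' γ'' : V'' → ℝ}
    (hν : ∀ v, 0 ≤ ν v) (hγ : ∀ v, 0 ≤ γ v) (hν' : ∀ v, 0 ≤ ν' v) (hγ' : ∀ v, 0 ≤ γ' v)
    (B : V' →ₗ[ℂ] V'' →ₗ[ℂ] V) (hν'' : ∀ v, 0 ≤ ν'' v) (hγ'' : ∀ v, 0 ≤ γ'' v)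
    (h1 : ∀ v w, ν (B v w) ≤ ν' v * ν'' w) (h2 : ∀ v w, γ (B v w) ≤ γ' v * γ'' w)
    (v : V') (w : V'') : envelope ν γ (B v w) ≤ envelope ν' γ' v * envelope ν'' γ'' w := by
  refine le_envelope_mul (envelope_nonneg hν'' hγ'' w) fun m u hu => ?_
  rw [mul_comm]
  refine le_envelope_mul (Finset.sum_nonneg fun j _ => mul_nonneg (hν' _) (hγ' _))
    fun m' u' hu' => ?_
  -- Two decompositions multiply to one indexed by pairs, and its cost is at most the product of the
  -- two costs.
  have hB : B v w = ∑ p : Fin m × Fin m', B (u p.1) (u' p.2) := by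
    rw [← hu, ← hu', Fintype.sum_prod_type]
    simp only [map_sum, LinearMap.sum_apply]
    exact Finset.sum_comm
  rw [hB, mul_comm, Finset.sum_mul_sum, ← Finset.sum_product']
  refine (envelope_le_sum hν hγ _).trans (Finset.sum_le_sum fun p _ => ?_)
  calc ν (B (u p.1) (u' p.2)) * γ (B (u p.1) (u' p.2))
      ≤ (ν' (u p.1) * ν'' (u' p.2)) * (γ' (u p.1) * γ'' (u' p.2)) :=
        mul_le_mul (h1 _ _) (h2 _ _) (hγ _) (mul_nonneg (hν' _) (hν'' _))
    _ = _ := by ring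

end Envelope

/-! ### Superadditive sequences -/

/-- Fekete's lemma for sequences which are superadditive from some index on. -/
theorem exists_tendsto_div_of_superadditive {a : ℕ → ℝ} {k₀ : ℕ} (hk₀ : 0 < k₀) {M : ℝ}
    (hadd : ∀ k m, k₀ ≤ k → k₀ ≤ m → a k + a m ≤ a (k + m)) (hle : ∀ k, k₀ ≤ k → a k / k ≤ M) :
    ∃ h : ℝ, Tendsto (fun k => a k / k) atTop (𝓝 h) ∧ (∀ k, k₀ ≤ k → a k / k ≤ h) ∧
      ∀ δ > 0, ∃ k, k₀ ≤ k ∧ h - δ < a k / k := by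
  set T : Set ℝ := (fun k : ℕ => a k / k) '' Set.Ici k₀
  have hne : T.Nonempty := ⟨_, k₀, Set.mem_Ici.2 le_rfl, rfl⟩
  have hbdd : BddAbove T := ⟨M, by rintro _ ⟨k, hk, rfl⟩; exact hle k hk⟩
  have hsup (k) (hk : k₀ ≤ k) : a k / k ≤ sSup T := le_csSup hbdd ⟨k, hk, rfl⟩
  have happrox (δ : ℝ) (hδ : 0 < δ) : ∃ k, k₀ ≤ k ∧ sSup T - δ < a k / k := by
    obtain ⟨_, ⟨k, hk, rfl⟩, h⟩ := exists_lt_of_lt_csSup hne (sub_lt_self (sSup T) hδ)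
    exact ⟨k, hk, h⟩
  refine ⟨sSup T, ?_, hsup, happrox⟩
  rw [Metric.tendsto_atTop]
  intro ε hε
  obtain ⟨p, hp, hpε⟩ := happrox (ε / 2) (half_pos hε)
  have hp0 : 0 < p := hk₀.trans_le hp
  have hmul (q : ℕ) (r : ℕ) (hr : k₀ ≤ r) : q * a p + a r ≤ a (q * p + r) := by
    induction q with
    | zero => simp
    | succ q ih =>
      have := hadd p (q * p + r) hp (hr.trans (Nat.le_add_left _ _))
      rw [show (q + 1) * p + r = p + (q * p + r) by ring]
      push_cast
      linarith
  -- `D` bounds `a r` below for all the remainders that can occur, and `E` bounds the total loss due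
  -- to the remainder.
  obtain ⟨D, hD⟩ := ((Finset.range (k₀ + p)).finite_toSet.image a).bddBelow
  set E := |(k₀ + p) * (a p / p)| + |D|
  obtain ⟨K, hK⟩ := exists_nat_gt (E / (ε / 2))
  refine ⟨max K k₀ + 1, fun k hk => ?_⟩
  have hkk₀ : k₀ ≤ k := by omega
  have hk0 : (0 : ℝ) < k := by exact_mod_cast hk₀.trans_le hkk₀
  rw [Real.dist_eq, abs_sub_lt_iff]
  refine ⟨by linarith [hsup k hkk₀], ?_⟩
  -- Division with the remainder shifted into `[k₀, k₀ + p)`, where superadditivity is available.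
  set q := (k - k₀) / p
  set r := k₀ + (k - k₀) % p
  have hqr : q * p + r = k := by
    have := Nat.div_add_mod (k - k₀) p
    have h2 : q * p + r = p * ((k - k₀) / p) + (k - k₀) % p + k₀ := by
      simp only [q, r]; ring
    omega
  have hrlt : r < k₀ + p := Nat.add_lt_add_left (Nat.mod_lt _ hp0) _
  have hDr : D ≤ a r := hD ⟨r, by simpa using hrlt, rfl⟩
  have h1 := hmul q r (Nat.le_add_right _ _)
  rw [hqr] at h1
  have hqr' : (q : ℝ) * p + r = k := by exact_mod_cast hqr
  have hp0' : (0 : ℝ) < p := by exact_mod_cast hp0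
  have h2 : (q : ℝ) * a p = k * (a p / p) - r * (a p / p) := by
    rw [← hqr']
    field_simp
    ring
  have h3 : (r : ℝ) * (a p / p) ≤ |(k₀ + p) * (a p / p)| := by
    rw [abs_mul, abs_of_nonneg (by positivity : (0 : ℝ) ≤ k₀ + p)]
    have hr' : (r : ℝ) ≤ k₀ + p := by exact_mod_cast hrlt.le
    calc (r : ℝ) * (a p / p) ≤ r * |a p / p| := by gcongr; exact le_abs_self _
      _ ≤ _ := by gcongr
  have h4 : E < k * (ε / 2) := by
    rw [← div_lt_iff₀ (half_pos hε)]
    refine hK.trans ?_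
    exact_mod_cast (show K < k by omega)
  have h5 : a p / p - ε / 2 < a k / k := by
    rw [lt_div_iff₀ hk0]
    have := neg_abs_le D
    have h6 : E = |(k₀ + p) * (a p / p)| + |D| := rfl
    nlinarith
  linarith

/-! ### Fubini–Study weights relative to a reference metric -/

section FubiniStudyRatio

variable {n : ℕ} {X : Type*} [TopologicalSpace X] [ChartedSpace (Fin n → ℂ) X]
  {L : X → Type*} [∀ x, AddCommGroup (L x)] [∀ x, Module ℂ (L x)]
  [∀ x, TopologicalSpace (L x)] [TopologicalSpace (TotalSpace ℂ L)]
  [FiberBundle ℂ L] [VectorBundle ℂ ℂ L]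

/-- The quotient of the metrics `kφ` and `FS(N)`. -/
def fsRatio (φ : LineMetric L) {k : ℕ} (N : holSections (n := n) L k → ℝ) (x : X) : ℝ :=
  ⨆ s : holSections (n := n) L k, φ.powNorm k x (s.1 x) / N s

/-- `N` is nonnegative, homogeneous and dominates the sup-norm up to the factor `A`. -/
structure DominatesSup (φ : LineMetric L) {k : ℕ} (N : holSections (n := n) L k → ℝ) (A : ℝ) :
    Prop where
  nonneg : ∀ s, 0 ≤ N s
  map_smul : ∀ (c : ℂ) s, N (c • s) = ‖c‖ * N s
  le_mul : ∀ s x, φ.powNorm k x (s.1 x) ≤ A * N s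

variable {φ : LineMetric L} {k : ℕ} {N : holSections (n := n) L k → ℝ} {A : ℝ}

theorem DominatesSup.pos (h : DominatesSup φ N A) {s : holSections (n := n) L k} {x : X}
    (hs : s.1 x ≠ 0) : 0 < N s := by
  refine (h.nonneg s).lt_of_ne' fun h0 => ?_
  have := h.le_mul s x
  rw [h0, mul_zero] at this
  exact (φ.powNorm_pos k x hs).not_ge this

theorem DominatesSup.ratio_le (h : DominatesSup φ N A) (hA : 0 ≤ A)
    (s : holSections (n := n) L k) (x : X) : φ.powNorm k x (s.1 x) / N s ≤ A :=
  div_le_of_le_mul₀ (h.nonneg s) hA (h.le_mul s x)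

theorem DominatesSup.fsRatio_le (h : DominatesSup φ N A) (hA : 0 ≤ A) (x : X) :
    fsRatio φ N x ≤ A :=
  ciSup_le fun s => h.ratio_le hA s x

theorem DominatesSup.ratio_le_fsRatio (h : DominatesSup φ N A) (hA : 0 ≤ A)
    (s : holSections (n := n) L k) (x : X) :
    φ.powNorm k x (s.1 x) / N s ≤ fsRatio φ N x :=
  le_ciSup (f := fun s : holSections (n := n) L k => φ.powNorm k x (s.1 x) / N s)
    ⟨A, by rintro _ ⟨s, rfl⟩; exact h.ratio_le hA s x⟩ s

theorem DominatesSup.fsRatio_nonneg (h : DominatesSup φ N A) (x : X) : 0 ≤ fsRatio φ N x :=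
  Real.iSup_nonneg fun s => div_nonneg (φ.powNorm_nonneg k x _) (h.nonneg s)

theorem DominatesSup.fsRatio_pos (h : DominatesSup φ N A) (hA : 0 ≤ A) {x : X}
    {s : holSections (n := n) L k} (hs : s.1 x ≠ 0) : 0 < fsRatio φ N x :=
  (div_pos (φ.powNorm_pos k x hs) (h.pos hs)).trans_le (h.ratio_le_fsRatio hA s x)

/-- The fibre is a line, so every section not vanishing at `x` can be rescaled to take the value `t`
there. Minimising `N` under this constraint is the same as maximising `|s(x)| / N s`. -/
theorem DominatesSup.fsNorm_eq (h : DominatesSup φ N A) (hA : 0 ≤ A) {x : X}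
    (hpos : 0 < fsRatio φ N x) {t : ⨂[ℂ]^k (L x)} (ht : t ≠ 0) :
    fsNorm N x t = ENNReal.ofReal (φ.powNorm k x t / fsRatio φ N x) := by
  have hT := φ.powNorm_pos k x ht
  apply le_antisymm
  · by_contra! hlt
    obtain ⟨y, hy1, hy2⟩ := exists_between hlt
    have hytop : y ≠ ⊤ := hy2.ne_top
    rw [ENNReal.ofReal_lt_iff_lt_toReal (by positivity) hytop] at hy1
    have hy0 : 0 < y.toReal := lt_of_le_of_lt (by positivity) hy1
    rw [div_lt_comm₀ hpos hy0] at hy1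
    obtain ⟨s, hs⟩ := exists_lt_of_lt_ciSup hy1
    have hsx : s.1 x ≠ 0 := by
      intro h0
      rw [h0, (φ.powNorm_eq_zero_iff k x 0).2 rfl, zero_div] at hs
      exact absurd hs (by positivity : 0 < φ.powNorm k x t / y.toReal).not_gt
    have hNs := h.pos hsx
    have hSx := φ.powNorm_pos k x hsx
    set e := trivializationAt ℂ L x
    have hcs : coord e k x (s.1 x) ≠ 0 :=
      mt (coord_eq_zero_iff e k (mem_baseSet_at x) _).1 hsx
    set c := coord e k x t / coord e k x (s.1 x)
    have hc : (c • s).1 x = t := by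
      change c • s.1 x = t
      rw [← sub_eq_zero, ← coord_eq_zero_iff e k (mem_baseSet_at x), map_sub, _root_.map_smul,
        smul_eq_mul, div_mul_cancel₀ _ hcs, sub_self]
    have hnc : ‖c‖ = φ.powNorm k x t / φ.powNorm k x (s.1 x) := by
      rw [eq_div_iff hSx.ne', ← φ.powNorm_smul]
      exact congrArg _ hc
    have h1 : fsNorm N x t ≤ ENNReal.ofReal (N (c • s)) := iInf₂_le (c • s) hc
    have h2 : N (c • s) < y.toReal := by
      rw [h.map_smul, hnc]
      rw [div_lt_div_iff₀ hy0 hNs] at hs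
      rw [div_mul_eq_mul_div, div_lt_iff₀ hSx]
      linarith
    have h3 := (ENNReal.ofReal_lt_ofReal_iff hy0).2 h2
    rw [ENNReal.ofReal_toReal hytop] at h3
    exact absurd (h1.trans_lt h3) hy2.not_gt
  · refine le_iInf₂ fun s hs => ENNReal.ofReal_le_ofReal ?_
    have hsx : s.1 x ≠ 0 := hs ▸ ht
    have := h.ratio_le_fsRatio hA s x
    rw [div_le_iff₀ (h.pos hsx), hs] at this
    rwa [div_le_iff₀' hpos]

/-- This replaces the extended-real weight by the weight of `φ` plus a real function on `X`
independent of the trivialization, so that limits can be taken in `ℝ`. -/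
theorem DominatesSup.fsWeight_eq (h : DominatesSup φ N A) (hA : 0 ≤ A) (hk : 0 < k) {x : X}
    (hpos : 0 < fsRatio φ N x) (e : Trivialization ℂ (π ℂ L)) [MemTrivializationAtlas e]
    (hx : x ∈ e.baseSet) :
    fsWeight N e x = ((φ.weight e x + Real.log (fsRatio φ N x) / k : ℝ) : EReal) := by
  set t : ⨂[ℂ]^k (L x) := PiTensorProduct.tprod ℂ (fun _ : Fin k => e.symm x (1 : ℂ))
  have ht1 : coord e k x t = 1 := coord_frame e k hx
  have ht : t ≠ 0 := by
    intro h0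
    rw [h0, map_zero] at ht1
    exact zero_ne_one ht1
  have hT : φ.powNorm k x t = Real.exp (-(k * φ.weight e x)) := by
    rw [φ.powNorm_eq e k hx, ht1, norm_one, one_mul, ← Real.exp_nat_mul, mul_neg]
  have hk' : (k : ℝ) ≠ 0 := by exact_mod_cast hk.ne'
  rw [fsWeight, h.fsNorm_eq hA hpos ht, ENNReal.log_ofReal_of_pos
    (div_pos (φ.powNorm_pos k x ht) hpos), ← EReal.coe_neg, ← EReal.coe_natCast,
    ← EReal.coe_div, Real.log_div (φ.powNorm_pos k x ht).ne' hpos.ne', hT, Real.log_exp]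
  congr 1
  field_simp
  ring

/-- Comparison of the Fubini–Study metrics of comparable norms. -/
theorem fsRatio_le_of_le {N' : holSections (n := n) L k → ℝ} {A' : ℝ} (h : DominatesSup φ N A)
    (h' : DominatesSup φ N' A') (hA' : 0 ≤ A') {C : ℝ} (hC : 0 ≤ C) (hle : ∀ s, N' s ≤ C * N s)
    (x : X) : fsRatio φ N x ≤ C * fsRatio φ N' x := by
  refine ciSup_le fun s => ?_
  by_cases hs : s.1 x = 0
  · rw [hs, (φ.powNorm_eq_zero_iff k x 0).2 rfl, zero_div]
    exact mul_nonneg hC (h'.fsRatio_nonneg x)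
  · have h1 := h'.ratio_le_fsRatio hA' s x
    have hN := h.pos hs
    have hN' := h'.pos hs
    rw [div_le_iff₀ hN'] at h1
    rw [div_le_iff₀ hN]
    calc φ.powNorm k x (s.1 x) ≤ fsRatio φ N' x * N' s := h1
      _ ≤ fsRatio φ N' x * (C * N s) := by
          gcongr
          · exact h'.fsRatio_nonneg x
          · exact hle s
      _ = _ := by ring

/-- The Fubini–Study metric of a norm on a base point free space is bounded. -/
theorem DominatesSup.exists_le_fsRatio [CompactSpace X] (hφ : φ.IsContinuous)
    (h : DominatesSup φ N A) (hA : 0 ≤ A)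
    (hbpf : ∀ x, ∃ s : holSections (n := n) L k, s.1 x ≠ 0) :
    ∃ c : ℝ, 0 < c ∧ ∀ x, c ≤ fsRatio φ N x := by
  have h1 := isCompact_univ.induction_on (X := X)
    (p := fun S => ∃ c : ℝ, 0 < c ∧ ∀ x ∈ S, c ≤ fsRatio φ N x)
    ⟨1, one_pos, by simp⟩
    (fun S T hST ⟨c, hc, h⟩ => ⟨c, hc, fun y hy => h y (hST hy)⟩)
    (fun S T ⟨c, hc, h⟩ ⟨d, hd, h'⟩ => by
      refine ⟨min c d, lt_min hc hd, fun y hy => ?_⟩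
      rcases hy with hy | hy
      · exact (min_le_left _ _).trans (h y hy)
      · exact (min_le_right _ _).trans (h' y hy))
    (fun x _ => by
      obtain ⟨s, hs⟩ := hbpf x
      have hpos := φ.powNorm_pos k x hs
      have hN := h.pos hs
      have hev := (continuous_powNorm hφ s).continuousAt.eventually_const_lt (half_lt_self hpos)
      refine ⟨_, mem_nhdsWithin_of_mem_nhds hev, φ.powNorm k x (s.1 x) / 2 / N s,
        by positivity, fun y hy => ?_⟩
      exact (div_le_div_of_nonneg_right (le_of_lt hy) hN.le).trans (h.ratio_le_fsRatio hA s y))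
  obtain ⟨c, hc, h1⟩ := h1
  exact ⟨c, hc, fun x => h1 x trivial⟩

end FubiniStudyRatio

/-! ### Plurisubharmonicity of regularised suprema -/

/-- Jensen's inequality. -/
theorem log_norm_le_circleAverage {g : ℂ → ℂ} {W : Set ℂ} (hW : IsOpen W)
    (hsub : Metric.closedBall 0 1 ⊆ W) (hg : DifferentiableOn ℂ g W) (h0 : g 0 ≠ 0) :
    Real.log ‖g 0‖ ≤ Real.circleAverage (fun z => Real.log ‖g z‖) 0 1 := by
  have han : AnalyticOnNhd ℂ g (Metric.closedBall 0 |1|) := by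
    rw [abs_one]
    exact (hg.analyticOnNhd hW).mono hsub
  -- In Jensen's formula the divisor of an analytic function is nonnegative, and a zero `u ≠ 0` in
  -- the closed disc contributes a multiple of `log (1 / |u|) ≥ 0`.
  rw [han.circleAverage_log_norm one_ne_zero h0]
  refine le_add_of_nonneg_left (finsum_nonneg fun u => ?_)
  by_cases hu : u ∈ Metric.closedBall (0 : ℂ) |1|
  · refine mul_nonneg ?_ ?_
    · exact_mod_cast (MeromorphicOn.AnalyticOnNhd.divisor_nonneg han) u
    · rw [zero_sub, norm_neg, one_mul]
      rcases eq_or_ne u 0 with rfl | hne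
      · simp
      · refine Real.log_nonneg ((one_le_inv₀ (norm_pos_iff.2 hne)).2 ?_)
        simpa using hu
  · rw [Function.locallyFinsuppWithin.apply_eq_zero_of_notMem _ hu]
    simp

/-- Since `Real.log 0 = 0`, the bound by `Φ` may fail at zeros of `g` on the circle. These are
discrete because `g 0 ≠ 0`, and replacing `log |g|` by `Φ` there does not change the average. -/
theorem log_norm_le_circleAverage_of_le {g : ℂ → ℂ} {W : Set ℂ} (hW : IsOpen W)
    (hsub : Metric.closedBall 0 1 ⊆ W) (hg : DifferentiableOn ℂ g W) (h0 : g 0 ≠ 0) {Φ : ℂ → ℝ}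
    (hΦ : CircleIntegrable Φ 0 1)
    (hle : ∀ ζ ∈ Metric.sphere (0 : ℂ) 1, g ζ ≠ 0 → Real.log ‖g ζ‖ ≤ Φ ζ) :
    Real.log ‖g 0‖ ≤ Real.circleAverage Φ 0 1 := by
  classical
  have han : AnalyticOnNhd ℂ g (Metric.closedBall 0 1) := (hg.analyticOnNhd hW).mono hsub
  set l : ℂ → ℝ := fun ζ => if g ζ = 0 then Φ ζ else Real.log ‖g ζ‖
  have hne : ∀ᶠ z in codiscreteWithin (Metric.closedBall (0 : ℂ) 1), g z ≠ 0 :=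
    (han.eqOn_zero_or_eventually_ne_zero_of_preconnected
      (convex_closedBall (0 : ℂ) 1).isPreconnected).resolve_left fun h =>
        h0 (h (Metric.mem_closedBall_self zero_le_one))
  have hsph : Metric.sphere (0 : ℂ) |1| ⊆ Metric.closedBall 0 1 := by
    rw [abs_one]
    exact Metric.sphere_subset_closedBall
  have hl : (fun z => Real.log ‖g z‖) =ᶠ[codiscreteWithin (Metric.sphere (0 : ℂ) |1|)] l := by
    filter_upwards [Filter.codiscreteWithin_mono hsph hne] with z hz
    simp only [l, if_neg hz]
  have hint : CircleIntegrable (fun z => Real.log ‖g z‖) 0 1 :=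
    MeromorphicOn.circleIntegrable_log_norm fun z hz => (han z (hsph hz)).meromorphicAt
  calc Real.log ‖g 0‖ ≤ Real.circleAverage (fun z => Real.log ‖g z‖) 0 1 :=
        log_norm_le_circleAverage hW hsub hg h0
    _ = Real.circleAverage l 0 1 := Real.circleAverage_congr_codiscreteWithin hl one_ne_zero
    _ ≤ Real.circleAverage Φ 0 1 := by
        refine Real.circleAverage_mono (hint.congr_codiscreteWithin hl) hΦ fun ζ hζ => ?_
        rw [abs_one] at hζ
        by_cases hz : g ζ = 0
        · simp [l, hz]
        · simpa [l, hz] using hle ζ hζ hz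

section Regularisation

variable {n : ℕ} {Ω : Set (Fin n → ℂ)} {F f : (Fin n → ℂ) → ℝ}

theorem exists_isOpen_bounded (hbdd : ∀ z ∈ Ω, ∃ C : ℝ, ∀ᶠ z' in 𝓝 z, |F z'| ≤ C)
    (hΩ : IsOpen Ω) {K : Set (Fin n → ℂ)} (hK : IsCompact K) (hKΩ : K ⊆ Ω) :
    ∃ (U : Set (Fin n → ℂ)) (C : ℝ), IsOpen U ∧ K ⊆ U ∧ U ⊆ Ω ∧ ∀ z ∈ U, |F z| ≤ C := by
  refine hK.induction_on
    (p := fun S => ∃ (U : Set (Fin n → ℂ)) (C : ℝ), IsOpen U ∧ S ⊆ U ∧ U ⊆ Ω ∧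
      ∀ z ∈ U, |F z| ≤ C)
    ⟨∅, 0, isOpen_empty, subset_rfl, Set.empty_subset _, by simp⟩
    (fun S T hST ⟨U, C, hU, hTU, h⟩ => ⟨U, C, hU, hST.trans hTU, h⟩)
    (fun S T ⟨U, C, hU, hSU, hUΩ, h⟩ ⟨U', C', hU', hTU', hUΩ', h'⟩ =>
      ⟨U ∪ U', max C C', hU.union hU', Set.union_subset_union hSU hTU',
        Set.union_subset hUΩ hUΩ', ?_⟩)
    (fun z hz => ?_)
  · rintro z (hz | hz)
    · exact (h z hz).trans (le_max_left _ _)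
    · exact (h' z hz).trans (le_max_right _ _)
  · obtain ⟨C, hC⟩ := hbdd z (hKΩ hz)
    obtain ⟨U, hU, hUo, hzU⟩ := eventually_nhds_iff.1 (hC.and (hΩ.eventually_mem (hKΩ hz)))
    exact ⟨U, mem_nhdsWithin_of_mem_nhds (hUo.mem_nhds hzU), U, C, hUo, subset_rfl,
      fun w hw => (hU w hw).2, fun w hw => (hU w hw).1⟩

/-- Let `f ≤ F` be functions on an open set such that `F` is the upper semicontinuous
regularisation of `f`, and `f` is pointwise a supremum of functions `(log |g| - b) / k` with `g`
holomorphic. Then `F` is plurisubharmonic. -/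
theorem pshOn_of_approx (hΩ : IsOpen Ω) (husc : UpperSemicontinuousOn F Ω)
    (hbdd : ∀ z ∈ Ω, ∃ C : ℝ, ∀ᶠ z' in 𝓝 z, |F z'| ≤ C)
    (hreg : ∀ z ∈ Ω, ∀ δ > 0, ∃ᶠ z' in 𝓝 z, F z - δ < f z')
    (happ : ∀ z ∈ Ω, ∀ δ > 0, ∃ (g : (Fin n → ℂ) → ℂ) (b k : ℝ), 0 < k ∧
      DifferentiableOn ℂ g Ω ∧ g z ≠ 0 ∧ f z - δ < (Real.log ‖g z‖ - b) / k ∧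
      ∀ z' ∈ Ω, g z' ≠ 0 → (Real.log ‖g z'‖ - b) / k ≤ F z') :
    PshOn F Ω := by
  refine ⟨husc, fun a v hav => ?_⟩
  set K : Set (Fin n → ℂ) := (fun ζ : ℂ => a + ζ • v) '' Metric.closedBall 0 1
  have hK : IsCompact K := (isCompact_closedBall 0 1).image (by fun_prop)
  have hKΩ : K ⊆ Ω := by
    rintro _ ⟨ζ, hζ, rfl⟩
    exact hav ζ (mem_closedBall_zero_iff.1 hζ)
  obtain ⟨U, C, hU, hKU, hUΩ, hC⟩ := exists_isOpen_bounded hbdd hΩ hK hKΩ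
  obtain ⟨r, hr, hrU⟩ := hK.exists_thickening_subset_open hU hKU
  have hmemU {a' : Fin n → ℂ} (ha' : dist a' a < r) {ζ : ℂ} (hζ : ζ ∈ Metric.closedBall (0 : ℂ) 1) :
      a' + ζ • v ∈ U := by
    refine hrU (Metric.mem_thickening_iff.2 ⟨a + ζ • v, ⟨ζ, hζ, rfl⟩, ?_⟩)
    rwa [dist_add_right]
  have hcirc (θ : ℝ) : circleMap 0 1 θ ∈ Metric.closedBall (0 : ℂ) 1 :=
    circleMap_mem_closedBall 0 zero_le_one θ
  have huscAt {a' : Fin n → ℂ} (ha' : dist a' a < r) (θ : ℝ) :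
      UpperSemicontinuousAt F (a' + circleMap 0 1 θ • v) := by
    have hmem : a' + circleMap 0 1 θ • v ∈ Ω := hUΩ (hmemU ha' (hcirc θ))
    intro y hy
    have := husc _ hmem y hy
    rwa [hΩ.nhdsWithin_eq hmem] at this
  have hmeas {a' : Fin n → ℂ} (ha' : dist a' a < r) :
      Measurable fun θ : ℝ => F (a' + circleMap 0 1 θ • v) := by
    refine UpperSemicontinuous.measurable fun θ => ?_
    have hc : Continuous fun θ : ℝ => a' + circleMap 0 1 θ • v := by
      have := continuous_circleMap 0 1
      fun_prop
    exact UpperSemicontinuousAt.comp (g := fun θ : ℝ => a' + circleMap 0 1 θ • v)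
      (huscAt ha' θ) hc.continuousAt
  have hci {a' : Fin n → ℂ} (ha' : dist a' a < r) :
      CircleIntegrable (fun ζ : ℂ => F (a' + ζ • v)) 0 1 := by
    rw [CircleIntegrable, intervalIntegrable_iff]
    refine Measure.integrableOn_of_bounded (M := C)
      (by rw [Set.uIoc_of_le Real.two_pi_pos.le]; exact measure_Ioc_lt_top.ne) (hmeas ha').aestronglyMeasurable
      (ae_of_all _ fun θ => ?_)
    exact hC _ (hmemU ha' (hcirc θ))
  -- Choose `(log |g| - b) / k` within `δ` of `f` at the centre `a'`; Jensen and the domination by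
  -- `F` give the inequality with `f` at the centre and `F` on the circle.
  have hsubmean {a' : Fin n → ℂ} (ha' : dist a' a < r) :
      f a' ≤ Real.circleAverage (fun ζ : ℂ => F (a' + ζ • v)) 0 1 := by
    refine le_of_forall_pos_lt_add fun δ hδ => ?_
    have hmem : a' ∈ Ω := by
      have := hUΩ (hmemU ha' (Metric.mem_closedBall_self zero_le_one))
      simpa using this
    obtain ⟨g, b, k, hk, hg, hg0, h1, h2⟩ := happ a' hmem δ hδ
    have hcont : Continuous fun ζ : ℂ => a' + ζ • v := by fun_prop
    have hdiff : Differentiable ℂ fun ζ : ℂ => a' + ζ • v := by fun_prop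
    have hci' : CircleIntegrable (fun ζ : ℂ => k • F (a' + ζ • v)) 0 1 := (hci ha').const_smul
    have hcib : CircleIntegrable (fun _ : ℂ => b) 0 1 := circleIntegrable_const b 0 1
    have key := log_norm_le_circleAverage_of_le (g := fun ζ : ℂ => g (a' + ζ • v))
      (Φ := fun ζ => k • F (a' + ζ • v) + b) (hΩ.preimage hcont)
      (fun ζ hζ => hUΩ (hmemU ha' hζ))
      (hg.comp hdiff.differentiableOn (Set.mapsTo_preimage _ _)) (by simpa using hg0)
      (hci'.add hcib) (fun ζ hζ hne => by
        have := h2 _ (hUΩ (hmemU ha' (Metric.sphere_subset_closedBall hζ))) hne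
        rw [div_le_iff₀ hk] at this
        rw [smul_eq_mul]
        linarith)
    have hcalc : Real.circleAverage (fun ζ : ℂ => k • F (a' + ζ • v) + b) 0 1 =
        k * Real.circleAverage (fun ζ : ℂ => F (a' + ζ • v)) 0 1 + b := by
      rw [Real.circleAverage_fun_add hci' hcib, Real.circleAverage_const,
        Real.circleAverage_fun_smul, smul_eq_mul]
    rw [hcalc] at key
    simp only [zero_smul, add_zero] at key
    have h3 : (Real.log ‖g a'‖ - b) / k ≤ Real.circleAverage (fun ζ : ℂ => F (a' + ζ • v)) 0 1 := by
      rw [div_le_iff₀ hk]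
      linarith
    linarith
  have haa : dist a a < r := by rwa [dist_self]
  refine ⟨hci haa, ?_⟩
  have haΩ : a ∈ Ω := by simpa using hav 0 (by simp)
  -- To get `F` at the centre, choose centres tending to `a` along which `f` nearly reaches `F a`,
  -- and pass to the limit on the translated circles.
  have hseq (j : ℕ) : ∃ a' : Fin n → ℂ, dist a' a < min r (1 / (j + 1 : ℝ)) ∧
      F a - 1 / (j + 1 : ℝ) < f a' := by
    have h1 : ∀ᶠ a' in 𝓝 a, dist a' a < min r (1 / (j + 1 : ℝ)) :=
      Metric.ball_mem_nhds a (lt_min hr (by positivity))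
    obtain ⟨a', h, h'⟩ := ((hreg a haΩ (1 / (j + 1 : ℝ)) (by positivity)).and_eventually h1).exists
    exact ⟨a', h', h⟩
  choose s hs hsf using hseq
  have hsr (j) : dist (s j) a < r := (hs j).trans_le (min_le_left _ _)
  have hslim : Tendsto s atTop (𝓝 a) := by
    rw [tendsto_iff_dist_tendsto_zero]
    exact squeeze_zero (fun _ => dist_nonneg) (fun j => ((hs j).trans_le (min_le_right _ _)).le)
      tendsto_one_div_add_atTop_nhds_zero_nat
  set I := Set.Ioc (0 : ℝ) (2 * Real.pi)
  have h2pi : 0 < 2 * Real.pi := Real.two_pi_pos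
  have hlint {a' : Fin n → ℂ} (ha' : dist a' a < r) :
      ∫⁻ θ in I, ENNReal.ofReal (F (a' + circleMap 0 1 θ • v) + C) =
        ENNReal.ofReal (2 * Real.pi *
          (Real.circleAverage (fun ζ : ℂ => F (a' + ζ • v)) 0 1 + C)) := by
    have hint : IntegrableOn (fun θ => F (a' + circleMap 0 1 θ • v)) I :=
      (intervalIntegrable_iff_integrableOn_Ioc_of_le h2pi.le).1 (hci ha')
    have hconst : IntegrableOn (fun _ : ℝ => C) I := integrableOn_const measure_Ioc_lt_top.ne
    have hadd : IntegrableOn (fun θ => F (a' + circleMap 0 1 θ • v) + C) I := hint.add hconst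
    rw [← ofReal_integral_eq_lintegral_ofReal hadd, integral_add hint hconst,
      Real.circleAverage, intervalIntegral.integral_of_le h2pi.le]
    · congr 1
      simp only [integral_const, smul_eq_mul, I]
      rw [measureReal_restrict_apply_univ, Real.volume_real_Ioc_of_le h2pi.le]
      field_simp
      ring
    · exact ae_of_all _ fun θ => by
        have := neg_le_of_abs_le (hC _ (hmemU ha' (hcirc θ)))
        change 0 ≤ F (a' + circleMap 0 1 θ • v) + C
        linarith
  -- Reverse Fatou: adding `C` makes the integrands nonnegative, with the constant `2C` as majorant.
  -- Upper semicontinuity of `F` then controls the pointwise limsup.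
  have hfatou := limsup_lintegral_le (μ := volume.restrict I)
    (f := fun j θ => ENNReal.ofReal (F (s j + circleMap 0 1 θ • v) + C))
    (fun _ => ENNReal.ofReal (C + C))
    (fun j => ((hmeas (hsr j)).add_const C).ennreal_ofReal)
    (fun j => ae_of_all _ fun θ => ENNReal.ofReal_le_ofReal (by
      have := le_of_abs_le (hC _ (hmemU (hsr j) (hcirc θ)))
      linarith))
    (by
      rw [lintegral_const]
      exact ENNReal.mul_ne_top ENNReal.ofReal_ne_top (by
        rw [Measure.restrict_apply_univ]
        exact measure_Ioc_lt_top.ne))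
  have hlim (θ : ℝ) : limsup (fun j => ENNReal.ofReal (F (s j + circleMap 0 1 θ • v) + C)) atTop ≤
      ENNReal.ofReal (F (a + circleMap 0 1 θ • v) + C) := by
    refine ENNReal.le_of_forall_pos_le_add fun ε hε _ => ?_
    have hε' : (0 : ℝ) < ε := by exact_mod_cast hε
    have htend : Tendsto (fun j => s j + circleMap 0 1 θ • v) atTop
        (𝓝 (a + circleMap 0 1 θ • v)) := hslim.add_const _
    have h1 := htend.eventually (huscAt haa θ (F (a + circleMap 0 1 θ • v) + ε) (by linarith))
    refine limsup_le_of_le (by isBoundedDefault) (h1.mono fun j hj => ?_)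
    calc ENNReal.ofReal (F (s j + circleMap 0 1 θ • v) + C)
        ≤ ENNReal.ofReal (F (a + circleMap 0 1 θ • v) + C + ε) :=
          ENNReal.ofReal_le_ofReal (by linarith)
      _ ≤ ENNReal.ofReal (F (a + circleMap 0 1 θ • v) + C) + ENNReal.ofReal ε :=
          ENNReal.ofReal_add_le
      _ = _ := by rw [ENNReal.ofReal_coe_nnreal]
  have hlow : ENNReal.ofReal (2 * Real.pi * (F a + C)) ≤
      limsup (fun j => ∫⁻ θ in I, ENNReal.ofReal (F (s j + circleMap 0 1 θ • v) + C)) atTop := by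
    have ht : Tendsto (fun j : ℕ => ENNReal.ofReal (2 * Real.pi * (F a - 1 / (j + 1 : ℝ) + C)))
        atTop (𝓝 (ENNReal.ofReal (2 * Real.pi * (F a + C)))) := by
      refine ENNReal.tendsto_ofReal (Tendsto.const_mul _ (Tendsto.add_const _ ?_))
      simpa using tendsto_const_nhds.sub (tendsto_one_div_add_atTop_nhds_zero_nat (𝕜 := ℝ))
    rw [← ht.limsup_eq]
    refine limsup_le_limsup (Eventually.of_forall fun j => ?_)
    change _ ≤ ∫⁻ θ in I, ENNReal.ofReal (F (s j + circleMap 0 1 θ • v) + C)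
    rw [hlint (hsr j)]
    refine ENNReal.ofReal_le_ofReal ?_
    have := hsubmean (hsr j)
    have := hsf j
    gcongr
    linarith
  have hfinal := (hlow.trans hfatou).trans (lintegral_mono hlim)
  rw [hlint haa] at hfinal
  have hnn : 0 ≤ 2 * Real.pi * (Real.circleAverage (fun ζ : ℂ => F (a + ζ • v)) 0 1 + C) := by
    refine mul_nonneg h2pi.le ?_
    have : Real.circleAverage (fun _ : ℂ => -C) 0 1 ≤
        Real.circleAverage (fun ζ : ℂ => F (a + ζ • v)) 0 1 :=
      Real.circleAverage_mono (circleIntegrable_const _ 0 1) (hci haa) fun ζ hζ => by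
        rw [abs_one] at hζ
        exact neg_le_of_abs_le (hC _ (hmemU haa (Metric.sphere_subset_closedBall hζ)))
    rw [Real.circleAverage_const] at this
    linarith
  rw [ENNReal.ofReal_le_ofReal_iff hnn] at hfinal
  have := le_of_mul_le_mul_left hfinal h2pi
  linarith

end Regularisation

/-! ### Upper semicontinuous regularisation of bounded functions -/

section Usc

variable {X : Type*} [TopologicalSpace X] {h : X → ℝ} {C : ℝ}

/-- The upper semicontinuous regularisation of a real function. -/
def uscReg (h : X → ℝ) (x : X) : ℝ := limsup h (𝓝 x)

theorem eventually_lt_of_uscReg_lt (hC : ∀ x, |h x| ≤ C) {x : X} {c : ℝ} (hc : uscReg h x < c) :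
    ∀ᶠ y in 𝓝 x, h y < c :=
  eventually_lt_of_limsup_lt hc
    (isBoundedUnder_of ⟨C, fun y => le_of_abs_le (hC y)⟩)

theorem frequently_lt_of_lt_uscReg (hC : ∀ x, |h x| ≤ C) {x : X} {c : ℝ} (hc : c < uscReg h x) :
    ∃ᶠ y in 𝓝 x, c < h y :=
  frequently_lt_of_lt_limsup
    ((isBoundedUnder_of ⟨-C, fun y => neg_le_of_abs_le (hC y)⟩ :
      IsBoundedUnder (· ≥ ·) (𝓝 x) h).isCoboundedUnder_le) hc

theorem le_uscReg (hC : ∀ x, |h x| ≤ C) (x : X) : h x ≤ uscReg h x := by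
  refine le_of_forall_gt fun c hc => ?_
  exact (eventually_lt_of_uscReg_lt hC hc).self_of_nhds

theorem uscReg_le (hC : ∀ x, |h x| ≤ C) {x : X} {c : ℝ} (hc : ∀ᶠ y in 𝓝 x, h y ≤ c) :
    uscReg h x ≤ c := by
  by_contra! hlt
  obtain ⟨y, h1, h2⟩ := ((frequently_lt_of_lt_uscReg hC hlt).and_eventually hc).exists
  exact h1.not_ge h2

theorem abs_uscReg_le (hC : ∀ x, |h x| ≤ C) (x : X) : |uscReg h x| ≤ C :=
  abs_le.2 ⟨(neg_le_of_abs_le (hC x)).trans (le_uscReg hC x),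
    uscReg_le hC (Eventually.of_forall fun y => le_of_abs_le (hC y))⟩

theorem upperSemicontinuous_uscReg (hC : ∀ x, |h x| ≤ C) : UpperSemicontinuous (uscReg h) := by
  intro x c hc
  obtain ⟨c', h1, h2⟩ := exists_between (α := ℝ) hc
  filter_upwards [(eventually_lt_of_uscReg_lt hC h1).eventually_nhds] with y hy
  exact (uscReg_le hC (hy.mono fun _ => le_of_lt)).trans_lt h2

/-- Regularisation commutes with adding a continuous function. Thus regularising local weights
amounts to regularising one global function; the limsup is in `EReal` to match `IsFSLimit`. -/
theorem limsup_coe_add_eq (hC : ∀ x, |h x| ≤ C) {w v : X → ℝ} {x : X} (hw : ContinuousAt w x)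
    (hv : ∀ᶠ y in 𝓝 x, v y = w y + h y) :
    limsup (fun y => (v y : EReal)) (𝓝 x) = ((w x + uscReg h x : ℝ) : EReal) := by
  apply le_antisymm
  · refine le_of_forall_gt_imp_ge_of_dense fun c hc => ?_
    obtain ⟨r, hr1, hr2⟩ := EReal.lt_iff_exists_real_btwn.1 hc
    refine le_trans ?_ hr2.le
    have hr : w x + uscReg h x < r := by exact_mod_cast hr1
    set ε := (r - (w x + uscReg h x)) / 2 with hε
    have hε0 : 0 < ε := by linarith
    have h1 := hw.eventually_lt_const (by linarith : w x < w x + ε)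
    have h2 := eventually_lt_of_uscReg_lt hC (by linarith : uscReg h x < uscReg h x + ε)
    refine limsup_le_of_le (by isBoundedDefault) ?_
    filter_upwards [h1, h2, hv] with y hy1 hy2 hy3
    rw [hy3]
    exact_mod_cast (by linarith : w y + h y ≤ r)
  · refine le_of_forall_lt_imp_le_of_dense fun c hc => ?_
    obtain ⟨r, hr1, hr2⟩ := EReal.lt_iff_exists_real_btwn.1 hc
    refine hr1.le.trans ?_
    have hr : r < w x + uscReg h x := by exact_mod_cast hr2
    set ε := (w x + uscReg h x - r) / 2 with hε
    have hε0 : 0 < ε := by linarith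
    have h1 := hw.eventually_const_lt (by linarith : w x - ε < w x)
    have h2 := frequently_lt_of_lt_uscReg hC (by linarith : uscReg h x - ε < uscReg h x)
    refine le_limsup_of_frequently_le ((h2.and_eventually (h1.and hv)).mono ?_)
      (by isBoundedDefault)
    rintro y ⟨hy2, hy1, hy3⟩
    rw [hy3]
    exact_mod_cast (by linarith : r ≤ w y + h y)

end Usc

section Limits

variable {n : ℕ} {X : Type*} [TopologicalSpace X] [ChartedSpace (Fin n → ℂ) X]
  {L : X → Type*} [∀ x, AddCommGroup (L x)] [∀ x, Module ℂ (L x)]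
  [∀ x, TopologicalSpace (L x)] [TopologicalSpace (TotalSpace ℂ L)]
  [FiberBundle ℂ L] [VectorBundle ℂ ℂ L]

/-! ### Twisting a metric by a function -/

/-- The metric whose weights are those of `φ` plus the function `h`. -/
def LineMetric.twist (φ : LineMetric L) (h : X → ℝ) : LineMetric L where
  norm x l := φ.norm x l * Real.exp (-h x)
  norm_pos x l hl := mul_pos (φ.norm_pos x l hl) (Real.exp_pos _)
  norm_smul x c l := by rw [φ.norm_smul, mul_assoc]

theorem LineMetric.weight_twist (φ : LineMetric L) (h : X → ℝ) (e : Trivialization ℂ (π ℂ L))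
    [MemTrivializationAtlas e] {x : X} (hx : x ∈ e.baseSet) :
    (φ.twist h).weight e x = φ.weight e x + h x := by
  have := φ.norm_pos x _ (frame_ne_zero e hx)
  rw [LineMetric.weight, LineMetric.weight, LineMetric.twist,
    Real.log_mul this.ne' (Real.exp_pos _).ne', Real.log_exp]
  ring

theorem isFSLimit_twist {φ : LineMetric L} (hφ : φ.IsContinuous) {h : X → ℝ} {C : ℝ}
    (hC : ∀ x, |h x| ≤ C) {N : ∀ k : ℕ, holSections (n := n) L k → ℝ} {A : ℕ → ℝ} {k₀ : ℕ}
    (hk₀ : 0 < k₀) (hA : ∀ k, 0 ≤ A k) (hN : ∀ k, k₀ ≤ k → DominatesSup φ (N k) (A k))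
    (hpos : ∀ k, k₀ ≤ k → ∀ x, 0 < fsRatio φ (N k) x)
    (hlim : ∀ x, Tendsto (fun k : ℕ => Real.log (fsRatio φ (N k) x) / k) atTop (𝓝 (h x))) :
    IsFSLimit N (φ.twist (uscReg h)) := by
  refine ⟨φ.twist h, fun e _ x hx => ⟨?_, ?_⟩⟩
  · rw [φ.weight_twist h e hx]
    have h1 : Tendsto (fun k : ℕ =>
        ((φ.weight e x + Real.log (fsRatio φ (N k) x) / k : ℝ) : EReal)) atTop
        (𝓝 ((φ.weight e x + h x : ℝ) : EReal)) :=
      EReal.tendsto_coe.2 ((hlim x).const_add _)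
    refine h1.congr' ?_
    filter_upwards [eventually_ge_atTop k₀] with k hk
    exact ((hN k hk).fsWeight_eq (hA k) (hk₀.trans_le hk) (hpos k hk x) e hx).symm
  · have hb : e.baseSet ∈ 𝓝 x := e.open_baseSet.mem_nhds hx
    rw [φ.weight_twist _ e hx, limsup_coe_add_eq hC ((hφ e).continuousAt hb)]
    filter_upwards [hb] with y hy
    exact φ.weight_twist h e hy

theorem isBounded_twist {φ : LineMetric L} (hφ : φ.IsContinuous) {h : X → ℝ} {C : ℝ}
    (hC : ∀ x, |h x| ≤ C) : (φ.twist h).IsBounded := by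
  intro e _ x hx
  have hb : e.baseSet ∈ 𝓝 x := e.open_baseSet.mem_nhds hx
  refine ⟨|φ.weight e x| + 1 + C, ?_⟩
  have h1 := (((hφ e).continuousAt hb).abs).eventually_lt_const (lt_add_one _)
  filter_upwards [hb, h1] with y hy hy1
  rw [φ.weight_twist h e hy]
  exact (abs_add_le _ _).trans (add_le_add (le_of_lt hy1) (hC y))

/-- The regularised supremum of the Fubini–Study metrics is positive. -/
theorem isPositive_twist [IsManifold 𝓘(ℂ, Fin n → ℂ) ω X] {φ : LineMetric L}
    (hφ : φ.IsContinuous) {h : X → ℝ} {C : ℝ}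
    (hC : ∀ x, |h x| ≤ C) {N : ∀ k : ℕ, holSections (n := n) L k → ℝ} {A : ℕ → ℝ} {k₀ : ℕ}
    (hk₀ : 0 < k₀) (hA : ∀ k, 0 ≤ A k) (hN : ∀ k, k₀ ≤ k → DominatesSup φ (N k) (A k))
    (hle : ∀ k, k₀ ≤ k → ∀ x, Real.log (fsRatio φ (N k) x) / k ≤ h x)
    (hpos : ∀ k, k₀ ≤ k → ∀ x, 0 < fsRatio φ (N k) x)
    (happ : ∀ x, ∀ δ > 0, ∃ k, k₀ ≤ k ∧ h x - δ < Real.log (fsRatio φ (N k) x) / k) :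
    (φ.twist (uscReg h)).IsPositive (n := n) := by
  intro e _ c hc
  set Ω := c.target ∩ c.symm ⁻¹' e.baseSet with hΩdef
  have hΩ : IsOpen Ω := c.symm.isOpen_inter_preimage e.open_baseSet
  have hF (z) (hz : z ∈ Ω) : ((φ.twist (uscReg h)).weight e ∘ c.symm) z =
      φ.weight e (c.symm z) + uscReg h (c.symm z) := φ.weight_twist _ e hz.2
  have hwc (z) (hz : z ∈ Ω) : ContinuousAt (φ.weight e) (c.symm z) :=
    (hφ e).continuousAt (e.open_baseSet.mem_nhds hz.2)
  have hcc (z) (hz : z ∈ Ω) : ContinuousAt c.symm z := c.continuousAt_symm hz.1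
  -- The dictionary with `pshOn_of_approx`: `g` is the local coordinate of `s`, and `b = log N(s)`.
  have hlog (z) (hz : z ∈ Ω) (k : ℕ) (hk : k₀ ≤ k) (s : holSections (n := n) L k)
      (hs : s.1 (c.symm z) ≠ 0) :
      (Real.log ‖coord e k (c.symm z) (s.1 (c.symm z))‖ - Real.log (N k s)) / k =
        φ.weight e (c.symm z) + Real.log (φ.powNorm k (c.symm z) (s.1 (c.symm z)) / N k s) / k := by
    have hk' : (k : ℝ) ≠ 0 := by exact_mod_cast (hk₀.trans_le hk).ne'
    have h1 : ‖coord e k (c.symm z) (s.1 (c.symm z))‖ ≠ 0 :=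
      norm_ne_zero_iff.2 (mt (coord_eq_zero_iff e k hz.2 _).1 hs)
    rw [Real.log_div (φ.powNorm_pos k _ hs).ne' ((hN k hk).pos hs).ne', φ.powNorm_eq e k hz.2,
      Real.log_mul h1 (by positivity), Real.log_pow, Real.log_exp]
    field_simp
    ring
  refine pshOn_of_approx (f := fun z => φ.weight e (c.symm z) + h (c.symm z)) hΩ ?_ ?_ ?_ ?_
  · intro z hz y hy
    change (φ.twist (uscReg h)).weight e (c.symm z) < y at hy
    rw [φ.weight_twist _ e hz.2] at hy
    set ε := (y - (φ.weight e (c.symm z) + uscReg h (c.symm z))) / 2 with hε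
    have hε0 : 0 < ε := by linarith
    have h1 := (hwc z hz).eventually_lt_const
      (by linarith : φ.weight e (c.symm z) < φ.weight e (c.symm z) + ε)
    have h2 := upperSemicontinuous_uscReg hC (c.symm z) (uscReg h (c.symm z) + ε) (by linarith)
    have h3 := (hcc z hz).eventually (h1.and h2)
    filter_upwards [mem_nhdsWithin_of_mem_nhds h3, self_mem_nhdsWithin] with z' hz' hzΩ
    change (φ.twist (uscReg h)).weight e (c.symm z') < y
    rw [φ.weight_twist _ e hzΩ.2]
    linarith [hz'.1, hz'.2]
  · intro z hz
    obtain ⟨D, hD⟩ := isBounded_twist hφ (abs_uscReg_le hC) e (c.symm z) hz.2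
    exact ⟨D, (hcc z hz).eventually hD⟩
  · intro z hz δ hδ
    have hδ2 := half_pos hδ
    have h1 := (hwc z hz).eventually_const_lt
      (by linarith : φ.weight e (c.symm z) - δ / 2 < φ.weight e (c.symm z))
    have h2 := frequently_lt_of_lt_uscReg hC
      (by linarith : uscReg h (c.symm z) - δ / 2 < uscReg h (c.symm z))
    have h3 := h2.and_eventually h1
    have h4 : ∃ᶠ z' in 𝓝 z, uscReg h (c.symm z) - δ / 2 < h (c.symm z') ∧
        φ.weight e (c.symm z) - δ / 2 < φ.weight e (c.symm z') := by
      rw [← c.symm.map_nhds_eq (x := z) (by simpa using hz.1), frequently_map] at h3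
      exact h3
    refine h4.mono fun z' hz' => ?_
    change (φ.twist (uscReg h)).weight e (c.symm z) - δ < _
    rw [φ.weight_twist _ e hz.2]
    linarith [hz'.1, hz'.2]
  · intro z hz δ hδ
    obtain ⟨k, hk, hkδ⟩ := happ (c.symm z) δ hδ
    have hk' : (0 : ℝ) < k := by exact_mod_cast hk₀.trans_le hk
    rw [lt_div_iff₀ hk', Real.lt_log_iff_exp_lt (hpos k hk _)] at hkδ
    obtain ⟨s, hs⟩ := exists_lt_of_lt_ciSup hkδ
    have hsx : s.1 (c.symm z) ≠ 0 := by
      intro h0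
      rw [h0, (φ.powNorm_eq_zero_iff k _ 0).2 rfl, zero_div] at hs
      exact (Real.exp_pos _).not_gt hs
    have hratio := div_pos (φ.powNorm_pos k _ hsx) ((hN k hk).pos hsx)
    refine ⟨fun z => coord e k (c.symm z) (s.1 (c.symm z)), Real.log (N k s), k, hk',
      holSections.differentiableOn_chart s e hc,
      mt (coord_eq_zero_iff e k hz.2 _).1 hsx, ?_, fun z' hz' hne => ?_⟩
    · rw [hlog z hz k hk s hsx]
      rw [← Real.lt_log_iff_exp_lt hratio, ← lt_div_iff₀ hk'] at hs
      linarith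
    · have hsx' : s.1 (c.symm z') ≠ 0 := mt (coord_eq_zero_iff e k hz'.2 _).2 hne
      have hratio' := div_pos (φ.powNorm_pos k _ hsx') ((hN k hk).pos hsx')
      rw [hlog z' hz' k hk s hsx', hF z' hz']
      have h1 := Real.log_le_log hratio' ((hN k hk).ratio_le_fsRatio (hA k) s (c.symm z'))
      have h2 := hle k hk (c.symm z')
      have h3 := le_uscReg hC (c.symm z')
      have h4 : Real.log (φ.powNorm k (c.symm z') (s.1 (c.symm z')) / N k s) / k ≤
          Real.log (fsRatio φ (N k) (c.symm z')) / k := by gcongr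
      linarith

/-! ### Products of sections -/

theorem tmul_add {x : X} {k m : ℕ} (s : ⨂[ℂ]^k (L x)) (t t' : ⨂[ℂ]^m (L x)) :
    tmul s (t + t') = tmul s t + tmul s t' := by
  simp only [tmul, TensorProduct.tmul_add, map_add]

theorem add_tmul {x : X} {k m : ℕ} (s s' : ⨂[ℂ]^k (L x)) (t : ⨂[ℂ]^m (L x)) :
    tmul (s + s') t = tmul s t + tmul s' t := by
  simp only [tmul, TensorProduct.add_tmul, map_add]

theorem smul_tmul {x : X} {k m : ℕ} (c : ℂ) (s : ⨂[ℂ]^k (L x)) (t : ⨂[ℂ]^m (L x)) :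
    tmul (c • s) t = c • tmul s t := by
  simp only [tmul, ← TensorProduct.smul_tmul', map_smul]

theorem tmul_smul {x : X} {k m : ℕ} (c : ℂ) (s : ⨂[ℂ]^k (L x)) (t : ⨂[ℂ]^m (L x)) :
    tmul s (c • t) = c • tmul s t := by
  simp only [tmul, TensorProduct.tmul_smul, map_smul]

variable (n L) in
/-- The product of the section ring as a bilinear map. -/
def mulSectionₗ (k m : ℕ) : holSections (n := n) L k →ₗ[ℂ] holSections (n := n) L m →ₗ[ℂ]
    holSections (n := n) L (k + m) :=
  LinearMap.mk₂ ℂ mulSection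
    (fun s s' t => Subtype.ext (funext fun x => add_tmul (s.1 x) (s'.1 x) (t.1 x)))
    (fun c s t => Subtype.ext (funext fun x => smul_tmul c (s.1 x) (t.1 x)))
    (fun s t t' => Subtype.ext (funext fun x => tmul_add (s.1 x) (t.1 x) (t'.1 x)))
    (fun c s t => Subtype.ext (funext fun x => tmul_smul c (s.1 x) (t.1 x)))

/-! ### The gauges attached to a convex function of the jumping numbers -/

namespace GradedNANorm

variable (ν : GradedNANorm (n := n) L) {f : ℝ → ℝ}

theorem jump_mem {k : ℕ} (hk : 0 < k) {s : holSections (n := n) L k} (hs : s ≠ 0) :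
    ν.jump s ∈ ν.dhInterval :=
  subset_convexHull ℝ _ (Or.inr ⟨k, s, hk, hs, rfl⟩)

open Classical in
/-- The function `w ↦ exp (k f(-k⁻¹ log ‖w‖))`, with value `0` at `0`. -/
def gauge (f : ℝ → ℝ) (k : ℕ) (w : holSections (n := n) L k) : ℝ :=
  if w = 0 then 0 else Real.exp (k * f (ν.jump w))

theorem gauge_zero (f : ℝ → ℝ) (k : ℕ) : ν.gauge f k 0 = 0 := if_pos rfl

theorem gauge_of_ne_zero (f : ℝ → ℝ) {k : ℕ} {w : holSections (n := n) L k} (hw : w ≠ 0) :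
    ν.gauge f k w = Real.exp (k * f (ν.jump w)) := if_neg hw

theorem gauge_nonneg (f : ℝ → ℝ) (k : ℕ) (w : holSections (n := n) L k) :
    0 ≤ ν.gauge f k w := by
  rcases eq_or_ne w 0 with rfl | hw
  · exact (ν.gauge_zero f k).ge
  · rw [ν.gauge_of_ne_zero f hw]
    positivity

theorem gauge_smul (f : ℝ → ℝ) (k : ℕ) (c : ℂ) (w : holSections (n := n) L k) (hc : c ≠ 0) :
    ν.gauge f k (c • w) = ν.gauge f k w := by
  rcases eq_or_ne w 0 with rfl | hw
  · rw [smul_zero]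
  · rw [ν.gauge_of_ne_zero f hw, ν.gauge_of_ne_zero f (smul_ne_zero hc hw), jump, jump,
      (ν.norm k).map_smul c w hc]

/-- The norm of `w` is attained at the basis vector of smallest jump in its support. As `f` is
decreasing, the maximum defining the left side is attained at the same vector, so the gauge does not
depend on the orthogonal basis. -/
theorem gaugeNorm_shift (hf : AntitoneOn f ν.dhInterval) (s : SectionBases n L) {k : ℕ}
    (hk : 0 < k) (hs : IsNAOrthogonal (ν.norm k) (s k)) :
    gaugeNorm (s k) (ν.shift f s k) = ν.gauge f k := by
  funext w
  rcases eq_or_ne w 0 with rfl | hw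
  · rw [gaugeNorm_zero, gauge_zero]
  rw [ν.gauge_of_ne_zero f hw]
  obtain ⟨a, ha⟩ := hs
  have hk' : (0 : ℝ) < k := by exact_mod_cast hk
  have hjump (i) : ν.jump (s k i) = a i / k := by
    rw [jump, ha, gaugeNorm_basis, Real.log_exp, neg_neg]
  have hshift (i) : Real.exp (-ν.shift f s k i) = Real.exp (k * f (a i / k)) := by
    rw [shift, neg_neg, hjump]
  have hmem (i) : a i / k ∈ ν.dhInterval := hjump i ▸ ν.jump_mem hk ((s k).ne_zero i)
  obtain ⟨i₀, hi₀, hmax⟩ := exists_gaugeNorm_eq (s k) a hw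
  have hw' : ν.jump w = a i₀ / k := by rw [jump, ha, hmax, Real.log_exp, neg_neg]
  rw [hw']
  refine le_antisymm (gaugeNorm_le _ _ _ (Real.exp_pos _).le fun i hi => ?_) ?_
  · rw [hshift]
    refine Real.exp_le_exp.2 (mul_le_mul_of_nonneg_left (hf (hmem i₀) (hmem i) ?_) hk'.le)
    have := le_gaugeNorm (s k) a hi
    rw [hmax, Real.exp_le_exp, neg_le_neg_iff] at this
    gcongr
  · rw [← hshift]
    exact le_gaugeNorm _ _ hi₀

/-- The jump of the product is at least the degree-weighted mean of the jumps. Monotonicity moves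
`f` to this mean, which lies in the convex set `dhInterval`, and convexity splits it. Degree 0 is
excluded because jumps there divide by zero. -/
theorem gauge_mul_le (hf_anti : AntitoneOn f ν.dhInterval) (hf_conv : ConvexOn ℝ ν.dhInterval f)
    {k m : ℕ} (hk : 0 < k) (hm : 0 < m) (s : holSections (n := n) L k)
    (t : holSections (n := n) L m) :
    ν.gauge f (k + m) (mulSection s t) ≤ ν.gauge f k s * ν.gauge f m t := by
  -- `X` need not be connected, so nonzero sections may have zero product.
  by_cases hst : mulSection s t = 0
  · rw [hst, gauge_zero]
    exact mul_nonneg (ν.gauge_nonneg f k s) (ν.gauge_nonneg f m t)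
  have hs : s ≠ 0 := by
    rintro rfl
    exact hst ((mulSectionₗ n L k m).map_zero₂ t)
  have ht : t ≠ 0 := by
    rintro rfl
    exact hst ((mulSectionₗ n L k m s).map_zero)
  rw [ν.gauge_of_ne_zero f hst, ν.gauge_of_ne_zero f hs, ν.gauge_of_ne_zero f ht, ← Real.exp_add]
  refine Real.exp_le_exp.2 ?_
  have hk' : (0 : ℝ) < k := by exact_mod_cast hk
  have hm' : (0 : ℝ) < m := by exact_mod_cast hm
  have hkm : (0 : ℝ) < k + m := by positivity
  have hjs := ν.jump_mem hk hs
  have hjt := ν.jump_mem hm ht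
  have hjst := ν.jump_mem (Nat.add_pos_left hk m) hst
  have h1 : (0 : ℝ) ≤ k / (k + m) := by positivity
  have h2 : (0 : ℝ) ≤ m / (k + m) := by positivity
  have h12 : (k : ℝ) / (k + m) + m / (k + m) = 1 := by field_simp
  have hconv := hf_conv.2 hjs hjt h1 h2 h12
  have hmem := hf_conv.1 hjs hjt h1 h2 h12
  simp only [smul_eq_mul] at hconv hmem
  have hle : k / (k + m) * ν.jump s + m / (k + m) * ν.jump t ≤ ν.jump (mulSection s t) := by
    have hlog := Real.log_le_log ((ν.norm (k + m)).pos _ hst) (ν.submul k m s t)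
    rw [Real.log_mul ((ν.norm k).pos s hs).ne' ((ν.norm m).pos t ht).ne'] at hlog
    rw [jump, jump, jump, Nat.cast_add, le_div_iff₀ hkm]
    have h3 : ((k : ℝ) / (k + m) * (-Real.log (ν.norm k s) / k) +
        m / (k + m) * (-Real.log (ν.norm m t) / m)) * (k + m) =
        -Real.log (ν.norm k s) + -Real.log (ν.norm m t) := by
      field_simp
    rw [h3]
    linarith
  have hanti := hf_anti hmem hjst hle
  calc ((k + m : ℕ) : ℝ) * f (ν.jump (mulSection s t))
      ≤ (k + m) * (k / (k + m) * f (ν.jump s) + m / (k + m) * f (ν.jump t)) := by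
        rw [Nat.cast_add]
        gcongr
        exact hanti.trans hconv
    _ = k * f (ν.jump s) + m * f (ν.jump t) := by
        field_simp

/-- The envelope of the sup-norm by the gauge of a function of the jumping numbers. -/
def supEnvelope (φ : LineMetric L) (f : ℝ → ℝ) (k : ℕ) : holSections (n := n) L k → ℝ :=
  envelope (supNorm φ k) (ν.gauge f k)

theorem iotaSup_eq (φ : LineMetric L) (hf : AntitoneOn f ν.dhInterval) (s : SectionBases n L)
    {k : ℕ} (hk : 0 < k) (hs : IsNAOrthogonal (ν.norm k) (s k)) :
    ν.iotaSup φ f s k = ν.supEnvelope φ f k := by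
  rw [iotaSup, supEnvelope, ν.gaugeNorm_shift hf s hk hs]

variable [CompactSpace X] {φ : LineMetric L}

/-- The gauge is at least `exp (-kM)` on nonzero vectors, so the triangle inequality over a
decomposition gives the bound. It yields `k⁻¹ log fsRatio ≤ M`, the upper bound needed in Fekete's
lemma. -/
theorem supEnvelope_dominatesSup (hφ : φ.IsContinuous) {M : ℝ}
    (hM : ∀ t ∈ ν.dhInterval, |f t| ≤ M) {k : ℕ} (hk : 0 < k) :
    DominatesSup φ (ν.supEnvelope φ f k) (Real.exp (k * M)) where
  nonneg := envelope_nonneg (supNorm_nonneg φ) (ν.gauge_nonneg f k)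
  map_smul := envelope_smul (supNorm_nonneg φ) (ν.gauge_nonneg f k) (supNorm_smul φ)
    (ν.gauge_smul f k)
  le_mul s x := by
    rw [mul_comm]
    refine le_envelope_mul (Real.exp_pos _).le fun m u hu => ?_
    refine (powNorm_le_supNorm hφ s x).trans ?_
    rw [← hu, Finset.sum_mul]
    refine (supNorm_sum_le hφ _ _).trans (Finset.sum_le_sum fun j _ => ?_)
    rcases eq_or_ne (u j) 0 with h0 | h0
    · rw [h0, supNorm_zero, zero_mul, zero_mul]
    · rw [ν.gauge_of_ne_zero f h0, mul_assoc, ← Real.exp_add]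
      refine le_mul_of_one_le_right (supNorm_nonneg φ _) (Real.one_le_exp ?_)
      have := neg_le_of_abs_le (hM _ (ν.jump_mem hk h0))
      have hk' : (0 : ℝ) ≤ k := k.cast_nonneg
      nlinarith

/-- Pointwise lengths multiply exactly while the envelope norm is submultiplicative, so ratios are
supermultiplicative; the suprema over `s` and `t` are taken independently. -/
theorem fsRatio_supEnvelope_mul_le (hφ : φ.IsContinuous) {M : ℝ}
    (hM : ∀ t ∈ ν.dhInterval, |f t| ≤ M) (hf_anti : AntitoneOn f ν.dhInterval)
    (hf_conv : ConvexOn ℝ ν.dhInterval f) {k m : ℕ} (hk : 0 < k) (hm : 0 < m) (x : X) :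
    fsRatio φ (ν.supEnvelope φ f k) x * fsRatio φ (ν.supEnvelope φ f m) x ≤
      fsRatio φ (ν.supEnvelope φ f (k + m)) x := by
  have hNk := ν.supEnvelope_dominatesSup hφ hM hk
  have hNm := ν.supEnvelope_dominatesSup hφ hM hm
  have hNkm := ν.supEnvelope_dominatesSup hφ hM (Nat.add_pos_left hk m)
  have hmul (s : holSections (n := n) L k) (t : holSections (n := n) L m) :
      ν.supEnvelope φ f (k + m) (mulSection s t) ≤
        ν.supEnvelope φ f k s * ν.supEnvelope φ f m t :=
    envelope_mul_le (supNorm_nonneg φ) (ν.gauge_nonneg f _) (supNorm_nonneg φ)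
      (ν.gauge_nonneg f _) (mulSectionₗ n L k m) (supNorm_nonneg φ) (ν.gauge_nonneg f _)
      (supNorm_mulSection_le hφ) (ν.gauge_mul_le hf_anti hf_conv hk hm) s t
  have hst (s : holSections (n := n) L k) (t : holSections (n := n) L m) :
      (φ.powNorm k x (s.1 x) / ν.supEnvelope φ f k s) *
        (φ.powNorm m x (t.1 x) / ν.supEnvelope φ f m t) ≤
      fsRatio φ (ν.supEnvelope φ f (k + m)) x := by
    rw [div_mul_div_comm, ← φ.powNorm_tmul]
    by_cases h0 : (mulSection s t).1 x = 0
    · rw [show tmul (s.1 x) (t.1 x) = 0 from h0, (φ.powNorm_eq_zero_iff _ x _).2 rfl, zero_div]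
      exact hNkm.fsRatio_nonneg x
    · refine le_trans ?_ (hNkm.ratio_le_fsRatio (Real.exp_pos _).le (mulSection s t) x)
      exact div_le_div_of_nonneg_left (φ.powNorm_nonneg _ _ _) (hNkm.pos h0) (hmul s t)
  rw [fsRatio, Real.iSup_mul_of_nonneg (hNm.fsRatio_nonneg x)]
  refine ciSup_le fun s => ?_
  rw [fsRatio, Real.mul_iSup_of_nonneg (div_nonneg (φ.powNorm_nonneg _ _ _) (hNk.nonneg s))]
  exact ciSup_le fun t => hst s t

/-- The limit of the Fubini–Study metrics of the envelopes. -/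
theorem exists_limit_supEnvelope (hL : IsAmple (n := n) L) (hφ : φ.IsContinuous) {M : ℝ}
    (hM : ∀ t ∈ ν.dhInterval, |f t| ≤ M) (hf_anti : AntitoneOn f ν.dhInterval)
    (hf_conv : ConvexOn ℝ ν.dhInterval f) :
    ∃ (h : X → ℝ) (C : ℝ) (k₀ : ℕ), 0 < k₀ ∧ (∀ x, |h x| ≤ C) ∧
      (∀ k, k₀ ≤ k → ∀ x, ∃ s : holSections (n := n) L k, s.1 x ≠ 0) ∧
      (∀ k, k₀ ≤ k → ∀ x, 0 < fsRatio φ (ν.supEnvelope φ f k) x) ∧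
      (∀ x, Tendsto (fun k : ℕ => Real.log (fsRatio φ (ν.supEnvelope φ f k) x) / k) atTop
        (𝓝 (h x))) ∧
      (∀ k, k₀ ≤ k → ∀ x, Real.log (fsRatio φ (ν.supEnvelope φ f k) x) / k ≤ h x) ∧
      ∀ x, ∀ δ > 0, ∃ k, k₀ ≤ k ∧ h x - δ < Real.log (fsRatio φ (ν.supEnvelope φ f k) x) / k := by
  obtain ⟨k₁, hk₁⟩ := eventually_atTop.1 hL
  set k₀ := max k₁ 1
  have hk₀ : 0 < k₀ := lt_max_of_lt_right one_pos
  have hbpf (k) (hk : k₀ ≤ k) (x : X) : ∃ s : holSections (n := n) L k, s.1 x ≠ 0 :=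
    (hk₁ k ((le_max_left _ _).trans hk)).1 x
  have hdom (k) (hk : k₀ ≤ k) := ν.supEnvelope_dominatesSup hφ hM (hk₀.trans_le hk)
  have hpos (k) (hk : k₀ ≤ k) (x : X) : 0 < fsRatio φ (ν.supEnvelope φ f k) x := by
    obtain ⟨s, hs⟩ := hbpf k hk x
    exact (hdom k hk).fsRatio_pos (Real.exp_pos _).le hs
  have hleM (k) (hk : k₀ ≤ k) (x : X) :
      Real.log (fsRatio φ (ν.supEnvelope φ f k) x) / k ≤ M := by
    have hk' : (0 : ℝ) < k := by exact_mod_cast hk₀.trans_le hk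
    rw [div_le_iff₀' hk', Real.log_le_iff_le_exp (hpos k hk x)]
    exact (hdom k hk).fsRatio_le (Real.exp_pos _).le x
  have hfek (x : X) := exists_tendsto_div_of_superadditive
    (a := fun k => Real.log (fsRatio φ (ν.supEnvelope φ f k) x)) hk₀ (M := M)
    (fun k m hk hm => by
      rw [← Real.log_mul (hpos k hk x).ne' (hpos m hm x).ne']
      exact Real.log_le_log (mul_pos (hpos k hk x) (hpos m hm x))
        (ν.fsRatio_supEnvelope_mul_le hφ hM hf_anti hf_conv (hk₀.trans_le hk)
          (hk₀.trans_le hm) x))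
    (fun k hk => hleM k hk x)
  choose h hlim hle happ using hfek
  -- The limit is at least its degree-`k₀` term, so a uniform lower bound in this single degree
  -- suffices.
  obtain ⟨c, hc, hlow⟩ := (hdom k₀ le_rfl).exists_le_fsRatio hφ (Real.exp_pos _).le
    (hbpf k₀ le_rfl)
  refine ⟨h, |M| + |Real.log c / k₀|, k₀, hk₀, fun x => abs_le.2 ⟨?_, ?_⟩, hbpf, hpos, hlim,
    fun k hk x => hle x k hk, happ⟩
  · have h1 := hle x k₀ le_rfl
    have h2 : Real.log c / k₀ ≤ Real.log (fsRatio φ (ν.supEnvelope φ f k₀) x) / k₀ := by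
      gcongr
      exact hlow x
    linarith [abs_nonneg M, neg_abs_le (Real.log c / k₀)]
  · have h1 : h x ≤ M :=
      le_of_tendsto (hlim x) ((eventually_ge_atTop k₀).mono fun k hk => hleM k hk x)
    linarith [le_abs_self M, abs_nonneg (Real.log c / k₀)]

/-! ### Comparison of the Hermitian norms with the envelopes -/

variable [IsManifold 𝓘(ℂ, Fin n → ℂ) ω X] [MeasurableSpace X] [BorelSpace X]

/-- For a single vector `u`, each rescaling factor over its support is at most its gauge, so `ι(u)`
is at most the `L²`-norm times the gauge. The triangle inequality for `ι` extends the bound to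
decompositions. -/
theorem iotaL2_le (hφ : φ.IsContinuous) {μ : Measure X} (hμ : IsSmoothVolume (n := n) μ)
    (hf : AntitoneOn f ν.dhInterval) (s : SectionBases n L) {k : ℕ} (hk : 0 < k)
    (hs : IsHermOrthogonal (l2Norm μ φ k) (s k)) (hs' : IsNAOrthogonal (ν.norm k) (s k))
    (w : holSections (n := n) L k) :
    ν.iotaL2 μ φ f s k w ≤ Real.sqrt (μ.real Set.univ) * ν.supEnvelope φ f k w := by
  have hone (u : holSections (n := n) L k) : ν.iotaL2 μ φ f s k u ≤
      Real.sqrt (μ.real Set.univ) * (supNorm φ k u * ν.gauge f k u) := by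
    refine Real.sqrt_le_iff.2 ⟨mul_nonneg (Real.sqrt_nonneg _)
      (mul_nonneg (supNorm_nonneg φ u) (ν.gauge_nonneg f k u)), ?_⟩
    calc ∑ i, ‖(s k).repr u i‖ ^ 2 *
          (l2Norm μ φ k (s k i) * Real.exp (-ν.shift f s k i)) ^ 2
        ≤ ∑ i, ‖(s k).repr u i‖ ^ 2 * l2Norm μ φ k (s k i) ^ 2 * ν.gauge f k u ^ 2 := by
          refine Finset.sum_le_sum fun i _ => ?_
          by_cases hi : (s k).repr u i = 0
          · simp [hi]
          · rw [mul_pow, ← mul_assoc]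
            gcongr
            rw [← ν.gaugeNorm_shift hf s hk hs']
            exact le_gaugeNorm _ _ hi
      _ = l2Norm μ φ k u ^ 2 * ν.gauge f k u ^ 2 := by rw [hs u, Finset.sum_mul]
      _ ≤ μ.real Set.univ * supNorm φ k u ^ 2 * ν.gauge f k u ^ 2 := by
          gcongr
          exact l2Norm_sq_le hφ hμ u
      _ = _ := by rw [mul_pow, mul_pow, Real.sq_sqrt measureReal_nonneg]; ring
  rw [mul_comm]
  refine le_envelope_mul (Real.sqrt_nonneg _) fun m u hu => ?_
  rw [← hu, mul_comm, Finset.mul_sum]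
  exact (rescale_sum_le _ _ _ _ _).trans (Finset.sum_le_sum fun j _ => hone (u j))

/-- The expansion of `w` in the basis is one admissible decomposition. Bernstein–Markov bounds each
term, and Cauchy–Schwarz passes from the `ℓ¹` to the `ℓ²` sum at the cost of `√(dim V_k)`, which is
subexponential. The constant is independent of the bases. -/
theorem exists_supEnvelope_le (hφ : φ.IsContinuous) {μ : Measure X}
    (hμ : IsSmoothVolume (n := n) μ) (hf : AntitoneOn f ν.dhInterval) {ε : ℝ} (hε : 0 < ε) :
    ∃ C : ℝ, 0 ≤ C ∧ ∀ (s : SectionBases n L) (k : ℕ), 0 < k →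
      IsHermOrthogonal (l2Norm μ φ k) (s k) → IsNAOrthogonal (ν.norm k) (s k) →
      ∀ w : holSections (n := n) L k,
        ν.supEnvelope φ f k w ≤ C * Real.exp (k * ε) * ν.iotaL2 μ φ f s k w := by
  obtain ⟨C, hC, hBM⟩ := exists_powNorm_sq_le hφ hμ hε
  obtain ⟨D, hD, hdim⟩ := exists_finrank_le hφ hμ hε
  refine ⟨Real.sqrt (C * D), Real.sqrt_nonneg _, fun s k hk hs hs' w => ?_⟩
  have hsup (u : holSections (n := n) L k) :
      supNorm φ k u ≤ Real.sqrt (C * Real.exp (k * ε)) * l2Norm μ φ k u := by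
    refine supNorm_le u (mul_nonneg (Real.sqrt_nonneg _) (l2Norm_nonneg φ μ u)) fun x => ?_
    refine le_of_sq_le_sq ?_ (mul_nonneg (Real.sqrt_nonneg _) (l2Norm_nonneg φ μ u))
    rw [mul_pow, Real.sq_sqrt (by positivity)]
    exact hBM k u x
  set a : Fin (Module.finrank ℂ (holSections (n := n) L k)) → ℝ := fun i =>
    ‖(s k).repr w i‖ * (l2Norm μ φ k (s k i) * Real.exp (-ν.shift f s k i))
  have h1 : ν.supEnvelope φ f k w ≤ Real.sqrt (C * Real.exp (k * ε)) * ∑ i, a i := by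
    conv_lhs => rw [← (s k).sum_repr w]
    refine (envelope_le_sum (supNorm_nonneg φ) (ν.gauge_nonneg f k) _).trans ?_
    rw [Finset.mul_sum]
    refine Finset.sum_le_sum fun i _ => ?_
    by_cases hi : (s k).repr w i = 0
    · simp [hi, a, supNorm_zero]
    · rw [ν.gauge_smul f k _ _ hi, supNorm_smul, ← ν.gaugeNorm_shift hf s hk hs',
        gaugeNorm_basis]
      calc ‖(s k).repr w i‖ * supNorm φ k (s k i) * Real.exp (-ν.shift f s k i)
          ≤ ‖(s k).repr w i‖ * (Real.sqrt (C * Real.exp (k * ε)) * l2Norm μ φ k (s k i)) *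
              Real.exp (-ν.shift f s k i) := by
            gcongr
            exact hsup _
        _ = _ := by simp only [a]; ring
  have hιnn : 0 ≤ ν.iotaL2 μ φ f s k w := Real.sqrt_nonneg _
  have hι : ν.iotaL2 μ φ f s k w ^ 2 = ∑ i, a i ^ 2 := by
    rw [iotaL2, rescale, Real.sq_sqrt (Finset.sum_nonneg fun i _ => by positivity)]
    exact Finset.sum_congr rfl fun i _ => (mul_pow _ _ _).symm
  have hcs : (∑ i, a i) ^ 2 ≤ D * Real.exp (k * ε) * ν.iotaL2 μ φ f s k w ^ 2 := by
    rw [hι]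
    refine (sq_sum_le_card_mul_sum_sq).trans ?_
    rw [Finset.card_univ, Fintype.card_fin]
    gcongr
    exact hdim k _ (s k) hs
  have ha : 0 ≤ ∑ i, a i := Finset.sum_nonneg fun i _ =>
    mul_nonneg (norm_nonneg _) (mul_nonneg (l2Norm_nonneg φ μ _) (Real.exp_pos _).le)
  refine h1.trans (le_of_sq_le_sq ?_ (by positivity))
  calc (Real.sqrt (C * Real.exp (k * ε)) * ∑ i, a i) ^ 2
      = C * Real.exp (k * ε) * (∑ i, a i) ^ 2 := by
        rw [mul_pow, Real.sq_sqrt (by positivity)]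
    _ ≤ C * Real.exp (k * ε) * (D * Real.exp (k * ε) * ν.iotaL2 μ φ f s k w ^ 2) := by gcongr
    _ = (Real.sqrt (C * D) * Real.exp (k * ε) * ν.iotaL2 μ φ f s k w) ^ 2 := by
        rw [mul_pow, mul_pow, Real.sq_sqrt (by positivity)]
        ring

end GradedNANorm

/-- Factors `C exp (kε)` between norms become errors `D + kε` between logarithms; `D` may depend on
`ε`, which is arbitrary. -/
theorem tendsto_div_of_abs_sub_le {a b : ℕ → ℝ} {k₀ : ℕ} {h : ℝ}
    (ha : Tendsto (fun k => a k / k) atTop (𝓝 h))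
    (hab : ∀ ε > 0, ∃ D : ℝ, ∀ k : ℕ, k₀ ≤ k → |b k - a k| ≤ D + k * ε) :
    Tendsto (fun k => b k / k) atTop (𝓝 h) := by
  have h0 : Tendsto (fun k : ℕ => (b k - a k) / k) atTop (𝓝 0) := by
    rw [Metric.tendsto_atTop]
    intro ε hε
    obtain ⟨D, hD⟩ := hab (ε / 2) (half_pos hε)
    obtain ⟨K, hK⟩ := exists_nat_gt (D / (ε / 2))
    refine ⟨max (max K k₀) 1, fun k hk => ?_⟩
    have hk1 : K ≤ k := (le_max_left _ _).trans ((le_max_left _ _).trans hk)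
    have hk2 : k₀ ≤ k := (le_max_right _ _).trans ((le_max_left _ _).trans hk)
    have hk3 : (0 : ℝ) < k := Nat.cast_pos.2 (one_pos.trans_le ((le_max_right _ _).trans hk))
    rw [Real.dist_eq, sub_zero, abs_div, Nat.abs_cast, div_lt_iff₀ hk3]
    have h1 : D < k * (ε / 2) := by
      rw [← div_lt_iff₀ (half_pos hε)]
      exact hK.trans_le (by exact_mod_cast hk1)
    linarith [hD k hk2]
  have := ha.add h0
  rw [add_zero] at this
  refine this.congr fun k => ?_
  rw [← add_div]
  congr 1
  ring

end Limits

/-! ### Transfer of the limit from the envelopes to the Hermitian norms. -/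

section Comparison

variable {n : ℕ} {X : Type*} [TopologicalSpace X] [ChartedSpace (Fin n → ℂ) X]
  {L : X → Type*} [∀ x, AddCommGroup (L x)] [∀ x, Module ℂ (L x)]
  [∀ x, TopologicalSpace (L x)] [TopologicalSpace (TotalSpace ℂ L)]
  [FiberBundle ℂ L] [VectorBundle ℂ ℂ L] [CompactSpace X]
  [IsManifold 𝓘(ℂ, Fin n → ℂ) ω X] [MeasurableSpace X] [BorelSpace X]

theorem GradedNANorm.isFSLimit_iotaL2 (ν : GradedNANorm (n := n) L) {f : ℝ → ℝ} {φ : LineMetric L}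
    (hφ : φ.IsContinuous) {M : ℝ} (hM : ∀ t ∈ ν.dhInterval, |f t| ≤ M)
    (hf : AntitoneOn f ν.dhInterval) {h : X → ℝ} {C : ℝ} {k₀ : ℕ} (hk₀ : 0 < k₀)
    (hC : ∀ x, |h x| ≤ C)
    (hbpf : ∀ k, k₀ ≤ k → ∀ x, ∃ s : holSections (n := n) L k, s.1 x ≠ 0)
    (hlim : ∀ x, Tendsto (fun k : ℕ => Real.log (fsRatio φ (ν.supEnvelope φ f k) x) / k) atTop
      (𝓝 (h x))) {μ : Measure X} (hμ : IsSmoothVolume (n := n) μ) (s : SectionBases n L)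
    (hs : ∀ k, IsHermOrthogonal (l2Norm μ φ k) (s k) ∧ IsNAOrthogonal (ν.norm k) (s k)) :
    IsFSLimit (ν.iotaL2 μ φ f s) (φ.twist (uscReg h)) := by
  -- The instance `ε = 1` only serves to show that `ι` dominates the sup-norm in each degree; the
  -- limit uses arbitrary `ε`.
  obtain ⟨C₁, hC₁, hcmp₁⟩ := ν.exists_supEnvelope_le hφ hμ hf one_pos
  have hdom (k) (hk : k₀ ≤ k) := ν.supEnvelope_dominatesSup hφ hM (hk₀.trans_le hk)
  have hdom' (k) (hk : k₀ ≤ k) : DominatesSup φ (ν.iotaL2 μ φ f s k)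
      (Real.exp (k * M) * (C₁ * Real.exp (k * 1))) :=
    { nonneg := fun w => Real.sqrt_nonneg _
      map_smul := rescale_smul _ _ _
      le_mul := fun w x => by
        refine ((hdom k hk).le_mul w x).trans ?_
        rw [mul_assoc]
        gcongr
        exact hcmp₁ s k (hk₀.trans_le hk) (hs k).1 (hs k).2 w }
  have hA (k : ℕ) : 0 ≤ Real.exp (k * M) * (C₁ * Real.exp (k * 1)) := by positivity
  have hpos (k) (hk : k₀ ≤ k) (x : X) : 0 < fsRatio φ (ν.supEnvelope φ f k) x := by
    obtain ⟨t, ht⟩ := hbpf k hk x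
    exact (hdom k hk).fsRatio_pos (Real.exp_pos _).le ht
  have hpos' (k) (hk : k₀ ≤ k) (x : X) : 0 < fsRatio φ (ν.iotaL2 μ φ f s k) x := by
    obtain ⟨t, ht⟩ := hbpf k hk x
    exact (hdom' k hk).fsRatio_pos (hA k) ht
  refine isFSLimit_twist hφ hC hk₀ hA hdom' hpos' fun x => ?_
  refine tendsto_div_of_abs_sub_le (k₀ := k₀) (hlim x) fun ε hε => ?_
  obtain ⟨C₂, hC₂, hcmp⟩ := ν.exists_supEnvelope_le hφ hμ hf hε
  set V := Real.sqrt (μ.real Set.univ) with hV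
  have hV0 : 0 ≤ V := Real.sqrt_nonneg _
  -- Enlarging `V` and `C₂` by 1 makes them positive, with nonnegative logarithms, even if they
  -- vanish.
  have hlog1 : 0 ≤ Real.log (V + 1) := Real.log_nonneg (by linarith)
  have hlog2 : 0 ≤ Real.log (C₂ + 1) := Real.log_nonneg (by linarith)
  refine ⟨Real.log (V + 1) + Real.log (C₂ + 1), fun k hk => ?_⟩
  have hk0 : 0 < k := hk₀.trans_le hk
  have hkε : 0 ≤ k * ε := by positivity
  have h1 : fsRatio φ (ν.supEnvelope φ f k) x ≤ (V + 1) * fsRatio φ (ν.iotaL2 μ φ f s k) x := by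
    refine (fsRatio_le_of_le (hdom k hk) (hdom' k hk) (hA k) hV0
      (ν.iotaL2_le hφ hμ hf s hk0 (hs k).1 (hs k).2) x).trans ?_
    gcongr
    · exact (hpos' k hk x).le
    · linarith
  have h2 : fsRatio φ (ν.iotaL2 μ φ f s k) x ≤
      (C₂ + 1) * Real.exp (k * ε) * fsRatio φ (ν.supEnvelope φ f k) x := by
    refine (fsRatio_le_of_le (hdom' k hk) (hdom k hk) (Real.exp_pos _).le (by positivity)
      (hcmp s k hk0 (hs k).1 (hs k).2) x).trans ?_
    gcongr
    · exact (hpos k hk x).le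
    · linarith
  have h3 := Real.log_le_log (hpos k hk x) h1
  have h4 := Real.log_le_log (hpos' k hk x) h2
  rw [Real.log_mul (by positivity) (hpos' k hk x).ne'] at h3
  rw [Real.log_mul (by positivity) (hpos k hk x).ne', Real.log_mul (by positivity) (by positivity),
    Real.log_exp] at h4
  rw [abs_le]
  constructor <;> linarith

end Comparison

end FubiniStudy

/-! ### The main theorem. -/

theorem corollary3p3 {n : ℕ} {X : Type*} [TopologicalSpace X] [ChartedSpace (Fin n → ℂ) X]
    [IsManifold 𝓘(ℂ, Fin n → ℂ) ω X] [CompactSpace X] [T2Space X]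
    [MeasurableSpace X] [BorelSpace X]
    (L : X → Type*) [∀ x, AddCommGroup (L x)] [∀ x, Module ℂ (L x)]
    [∀ x, TopologicalSpace (L x)] [TopologicalSpace (TotalSpace ℂ L)]
    [FiberBundle ℂ L] [VectorBundle ℂ ℂ L]
    [ContMDiffVectorBundle ω ℂ L 𝓘(ℂ, Fin n → ℂ)]
    (hL : FubiniStudy.IsAmple (n := n) L)
    (φ : FubiniStudy.LineMetric L) (hφc : φ.IsContinuous) (hφp : φ.IsPositive (n := n))
    (ν : FubiniStudy.GradedNANorm (n := n) L)
    (f : ℝ → ℝ) (hf_bdd : ∃ M : ℝ, ∀ t ∈ ν.dhInterval, |f t| ≤ M)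
    (hf_anti : AntitoneOn f ν.dhInterval) (hf_conv : ConvexOn ℝ ν.dhInterval f) :
    -- bases orthogonal for both norms exist in every degree
    (∀ μ : Measure X, FubiniStudy.IsSmoothVolume (n := n) μ →
      ∃ s : FubiniStudy.SectionBases n L, ∀ k,
        FubiniStudy.IsHermOrthogonal (FubiniStudy.l2Norm μ φ k) (s k) ∧
          FubiniStudy.IsNAOrthogonal (ν.norm k) (s k)) ∧
    -- the two limits exist, agree, and are one bounded positive metric
    ∃ ψ : FubiniStudy.LineMetric L, ψ.IsBounded ∧ ψ.IsPositive (n := n) ∧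
      (∀ s : FubiniStudy.SectionBases n L,
        (∀ k, FubiniStudy.IsNAOrthogonal (ν.norm k) (s k)) →
          FubiniStudy.IsFSLimit (ν.iotaSup φ f s) ψ) ∧
      (∀ μ : Measure X, FubiniStudy.IsSmoothVolume (n := n) μ →
        ∀ s : FubiniStudy.SectionBases n L,
          (∀ k, FubiniStudy.IsHermOrthogonal (FubiniStudy.l2Norm μ φ k) (s k) ∧
            FubiniStudy.IsNAOrthogonal (ν.norm k) (s k)) →
            FubiniStudy.IsFSLimit (ν.iotaL2 μ φ f s) ψ) := by
  obtain ⟨M, hM⟩ := hf_bdd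
  refine ⟨fun μ hμ => ?_, ?_⟩
  · choose s hs using fun k => FubiniStudy.exists_jointly_orthogonal hφc hμ k (ν.norm k)
    exact ⟨s, hs⟩
  obtain ⟨h, C, k₀, hk₀, hC, hbpf, hpos, hlim, hle, happ⟩ :=
    ν.exists_limit_supEnvelope hL hφc hM hf_anti hf_conv
  have hA (k : ℕ) : 0 ≤ Real.exp (k * M) := (Real.exp_pos _).le
  have hdom (k) (hk : k₀ ≤ k) := ν.supEnvelope_dominatesSup hφc hM (hk₀.trans_le hk)
  -- `h` comes from `supEnvelope`, which involves neither a volume form nor a basis, so this single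
  -- metric serves all choices.
  refine ⟨φ.twist (FubiniStudy.uscReg h),
    FubiniStudy.isBounded_twist hφc (FubiniStudy.abs_uscReg_le hC),
    FubiniStudy.isPositive_twist hφc hC hk₀ hA hdom hle hpos happ, fun s hs => ?_,
    fun μ hμ s hs => ν.isFSLimit_iotaL2 hφc hM hf_anti hk₀ hC hbpf hlim hμ s hs⟩
  have heq (k) (hk : k₀ ≤ k) : ν.iotaSup φ f s k = ν.supEnvelope φ f k :=
    ν.iotaSup_eq φ hf_anti s (hk₀.trans_le hk) (hs k)
  refine FubiniStudy.isFSLimit_twist hφc hC hk₀ hA (fun k hk => heq k hk ▸ hdom k hk)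
    (fun k hk x => heq k hk ▸ hpos k hk x) fun x => (hlim x).congr' ?_
  filter_upwards [eventually_ge_atTop k₀] with k hk
  rw [heq k hk]
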